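/- **Proposition 1 (Oracle property).** For each sample size $n$ let $X_1,\dots,X_n$ be i.i.d. random vectors in $\mathbb{R}^d$, let $\Theta\subset\mathbb{R}^p$ be a convex parameter set, $\theta_0\in\Theta$, and let $g^{(\mathcal I)}=\{g_j\}_{j\in\mathcal I}$ and $g^{(\mathcal D)}=\{g_j\}_{j\in\mathcal D}$ be two finite families of real estimating functions $g_j(X;\theta)$, $|\mathcal I|=r_1$, $|\mathcal D|=r_2$, with $\mathbb{E}\{g^{(\mathcal I)}(X_i;\theta_0)\}=0$. Here $d,p,r_1,r_2$, the law of the observations, $\Theta$, $\theta_0$ and the functions $g_j$ may all depend on $n$. Suppose that, for some $\rho>0$ independent of $n$, $\Theta$ contains the Euclidean ball of radius $\rho$ around $\theta_0$. Let $\mathcal A=\{j\in\mathcal D:\mathbb{E}\{g_j(X_i;\theta_0)\}=0\}$, $\mathcal H=\mathcal I\cup\mathcal A$ (disjoint union), $h=|\mathcal H|$, and $g_i(\theta)=g^{(\mathcal H)}(X_i;\theta)=(g_j(X_i;\theta))_{j\in\mathcal H}$. Fix an open interval $\mathcal V\subset(-1,\infty)$ containing $0$, and let the oracle empirical likelihood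 estimator be $$\hat\theta^{(\mathcal H)}_{EL}=\arg\min_{\theta\in\Theta}\ \max_{\lambda\in\hat\Lambda_n(\theta)}\ \sum_{i=1}^n\log\{1+\lambda^{T}g_i(\theta)\},\qquad \hat\Lambda_n(\theta)=\{\lambda\in\mathbb{R}^h:\lambda^{T}g_i(\theta)\in\mathcal V,\ i=1,\dots,n\}$$ (any measurable minimiser, the inner maximum being read as a supremum in $[-\infty,\infty]$). Write $\mathbb{E}_n$ for the sample mean, $|\cdot|_\infty$ for the largest absolute value of the entries, $B^{\otimes 2}=BB^{T}$, $B^{\circ\kappa}=(|b_{ij}|^{\kappa})_{i,j}$, $\lambda_{\min},\lambda_{\max}$ for the smallest and largest eigenvalues, $\hat V(\theta)=\mathbb{E}_n\{g_i(\theta)^{\otimes2}\}$, $V(\theta_0)=\mathbb{E}\{g_i(\theta_0)^{\otimes2}\}$ and $D=\mathbb{E}\{\nabla_\theta g_i(\theta_0)\}$ (an $h\times p$ matrix). Assume that there are constants $C_1,C_2>0$, $C_3,C_4>1$, $C_5$ and $\gamma>4$, none depending on $n$, such that for every $n$ (and with limits taken as $n\to\infty$): 1. $\inf_{\theta\in\Theta:\,|\theta-\theta_0|_\infty>\varepsilon}|\mathbb{E}\{g_i(\theta)\}|_\infty\ge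 C_1\varepsilon$ for every $\varepsilon>0$; 2. $\max_{j\in\mathcal H}\mathbb{E}\{\sup_{\theta\in\Theta}|g_{i,j}(\theta)|^{\gamma}\}\le C_2$, and $\mathbb{P}[C_3^{-1}\le\inf_{\theta\in\Theta}\lambda_{\min}\{\hat V(\theta)\}\le\sup_{\theta\in\Theta}\lambda_{\max}\{\hat V(\theta)\}\le C_3]\to1$; 3. each $g_j(X;\theta)$, $j\in\mathcal H$, is twice continuously differentiable in $\theta\in\Theta$ for every $X$; $$\sup_{\theta\in\Theta}\Big(\big|\mathbb{E}_n[\{\nabla_\theta g_i(\theta)\}^{\circ2}]\big|_\infty+\max_{j\in\mathcal H}\big|\mathbb{E}_n[\{\nabla^2_\theta g_{i,j}(\theta)\}^{\circ2}]\big|_\infty+\big|\mathbb{E}_n[\{g_i(\theta)\}^{\circ\gamma}]\big|_\infty\Big)=O_p(1);$$ and $|\mathbb{E}[\{\nabla_\theta g_i(\theta_0)\}^{\circ2}]|_\infty\le C_5$; 4. $C_4^{-1}<\lambda_{\min}(Q)\le\lambda_{\max}(Q)<C_4$, where $Q=(D^{T})^{\otimes2}=D^{T}D$; 5. $h^3n^{-1+2/\gamma}=o(1)$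 and $h^3p^2n^{-1}=o(1)$. Then, with $J^{(\mathcal H)}=(D^{T}\{V(\theta_0)\}^{-1/2})^{\otimes2}$, for every (possibly $n$-dependent) $\alpha\in\mathbb{R}^p$ with $|\alpha|_2=1$, $$\sqrt n\,\alpha^{T}\{J^{(\mathcal H)}\}^{1/2}\{\hat\theta^{(\mathcal H)}_{EL}-\theta_0\}\ \xrightarrow{d}\ \mathcal N(0,1)\qquad(n\to\infty).$$ -/

import Mathlib

open MeasureTheory ProbabilityTheory Filter Topology
open scoped ENNReal NNReal Matrix

noncomputable section

namespace OracleEL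

/-- A family, indexed by `ι`, of real estimating functions `g_j(x; θ)` with observation
`x ∈ ℝ^d` and parameter `θ ∈ ℝ^p`. -/
abbrev EstFun (ι : Type) (d p : ℕ) : Type :=
  ι → EuclideanSpace ℝ (Fin d) → EuclideanSpace ℝ (Fin p) → ℝ

/-- Largest absolute value `|B|_∞` of the entries of a (finite) matrix. -/
def entrySup {ι κ : Type} (B : Matrix ι κ ℝ) : ℝ := ⨆ i, ⨆ j, |B i j|

/-- Largest absolute value `|v|_∞` of the entries of a (finite) vector. -/
def vecSup {ι : Type} (v : ι → ℝ) : ℝ := ⨆ i, |v i|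

/-- Smallest eigenvalue of a real symmetric matrix. -/
def lamMin {ι : Type} [Fintype ι] [DecidableEq ι] (M : Matrix ι ι ℝ) : ℝ := sInf (spectrum ℝ M)

/-- Largest eigenvalue of a real symmetric matrix. -/
def lamMax {ι : Type} [Fintype ι] [DecidableEq ι] (M : Matrix ι ι ℝ) : ℝ := sSup (spectrum ℝ M)

/-- The power `M ^ a` of a real symmetric positive definite matrix, by the functional calculus:
same eigenvectors, eigenvalues raised to the power `a`. -/
def symPow {ι : Type} [Fintype ι] [DecidableEq ι] (M : Matrix ι ι ℝ) (a : ℝ) : Matrix ι ι ℝ :=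
  cfc (fun t : ℝ => t ^ a) M

/-- `B^{⊗2} = B Bᵀ`. -/
def tensorSq {ι κ : Type} [Fintype κ] (B : Matrix ι κ ℝ) : Matrix ι ι ℝ := B * Bᵀ

/-- Boundedness in probability, `Y_n = O_p(1)`, of `[0,∞]`-valued variables. -/
def IsBigOpOne {Ω : ℕ → Type*} [∀ n, MeasurableSpace (Ω n)] (P : ∀ n, Measure (Ω n))
    (Y : ∀ n, Ω n → ℝ≥0∞) : Prop :=
  ∀ ε : ℝ≥0∞, 0 < ε → ∃ M : ℝ≥0, ∀ᶠ n in atTop, P n {ω | (M : ℝ≥0∞) < Y n ω} ≤ ε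

section Moments

variable {d p r₁ r₂ : ℕ} {ι : Type}

/-- `∂ g_j(x; θ) / ∂ θ_k`, relative to the parameter set `Θ` (one-sided at its boundary). -/
def pderiv (Θ : Set (EuclideanSpace ℝ (Fin p))) (g : EstFun ι d p) (j : ι)
    (x : EuclideanSpace ℝ (Fin d)) (θ : EuclideanSpace ℝ (Fin p)) (k : Fin p) : ℝ :=
  fderivWithin ℝ (g j x) Θ θ (EuclideanSpace.single k 1)

/-- `∂² g_j(x; θ) / ∂ θ_k ∂ θ_l`, relative to the parameter set `Θ`. -/
def pderiv₂ (Θ : Set (EuclideanSpace ℝ (Fin p))) (g : EstFun ι d p) (j : ι)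
    (x : EuclideanSpace ℝ (Fin d)) (θ : EuclideanSpace ℝ (Fin p)) (k l : Fin p) : ℝ :=
  iteratedFDerivWithin ℝ 2 (g j x) Θ θ
    ![EuclideanSpace.single k 1, EuclideanSpace.single l 1]

/-- The sample mean `E_n {f(X_i)}`. -/
def sampleMean {n : ℕ} (x : Fin n → EuclideanSpace ℝ (Fin d))
    (f : EuclideanSpace ℝ (Fin d) → ℝ) : ℝ :=
  (n : ℝ)⁻¹ * ∑ i, f (x i)

/-- Population mean `E {g_i(θ)}`. -/
def popMean (ν : Measure (EuclideanSpace ℝ (Fin d))) (g : EstFun ι d p)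
    (θ : EuclideanSpace ℝ (Fin p)) : ι → ℝ :=
  fun j => ∫ x, g j x θ ∂ν

/-- `V(θ) = E {g_i(θ)^{⊗2}}`. -/
def popV (ν : Measure (EuclideanSpace ℝ (Fin d))) (g : EstFun ι d p)
    (θ : EuclideanSpace ℝ (Fin p)) : Matrix ι ι ℝ :=
  Matrix.of fun j k => ∫ x, g j x θ * g k x θ ∂ν

/-- `V̂(θ) = E_n {g_i(θ)^{⊗2}}`. -/
def sampleV {n : ℕ} (x : Fin n → EuclideanSpace ℝ (Fin d)) (g : EstFun ι d p)
    (θ : EuclideanSpace ℝ (Fin p)) : Matrix ι ι ℝ :=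
  Matrix.of fun j k => sampleMean x fun y => g j y θ * g k y θ

/-- `E {∇_θ g_i(θ)}`, one row for each moment function. -/
def popGrad (ν : Measure (EuclideanSpace ℝ (Fin d))) (Θ : Set (EuclideanSpace ℝ (Fin p)))
    (g : EstFun ι d p) (θ : EuclideanSpace ℝ (Fin p)) : Matrix ι (Fin p) ℝ :=
  Matrix.of fun j k => ∫ x, pderiv Θ g j x θ k ∂ν

/-- `Q = ([E {∇_θ g_i(θ)}]ᵀ)^{⊗2}`. -/
def matQ [Fintype ι] (ν : Measure (EuclideanSpace ℝ (Fin d)))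
    (Θ : Set (EuclideanSpace ℝ (Fin p))) (g : EstFun ι d p) (θ : EuclideanSpace ℝ (Fin p)) :
    Matrix (Fin p) (Fin p) ℝ :=
  tensorSq (popGrad ν Θ g θ)ᵀ

/-- `J = ([E {∇_θ g_i(θ)}]ᵀ V(θ)^{-1/2})^{⊗2}`. -/
def matJ [Fintype ι] [DecidableEq ι] (ν : Measure (EuclideanSpace ℝ (Fin d)))
    (Θ : Set (EuclideanSpace ℝ (Fin p))) (g : EstFun ι d p) (θ : EuclideanSpace ℝ (Fin p)) :
    Matrix (Fin p) (Fin p) ℝ :=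
  tensorSq ((popGrad ν Θ g θ)ᵀ * symPow (popV ν g θ) (-(1 / 2)))

/-- `|E_n[{∇_θ g_i(θ)}^{∘2}]|_∞ + max_j |E_n[{∇²_θ g_{i,j}(θ)}^{∘2}]|_∞ + |E_n[{g_i(θ)}^{∘γ}]|_∞`. -/
def regTerm (γ : ℝ) (Θ : Set (EuclideanSpace ℝ (Fin p))) {n : ℕ}
    (x : Fin n → EuclideanSpace ℝ (Fin d)) (g : EstFun ι d p)
    (θ : EuclideanSpace ℝ (Fin p)) : ℝ :=
  entrySup (Matrix.of fun j k => sampleMean x fun y => |pderiv Θ g j y θ k| ^ 2)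
    + (⨆ j, entrySup (Matrix.of fun k l => sampleMean x fun y => |pderiv₂ Θ g j y θ k l| ^ 2))
    + vecSup (fun j => sampleMean x fun y => |g j y θ| ^ γ)

/-- `Λ̂_n(θ)`: all `λ` with `λᵀ g_i(θ) ∈ 𝒱` for every `i`. -/
def multiplierSet [Fintype ι] (𝒱 : Set ℝ) {n : ℕ} (x : Fin n → EuclideanSpace ℝ (Fin d))
    (g : EstFun ι d p) (θ : EuclideanSpace ℝ (Fin p)) : Set (ι → ℝ) :=
  {lam | ∀ i, ∑ j, lam j * g j (x i) θ ∈ 𝒱}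

/-- `max_{λ ∈ Λ̂_n(θ)} ∑_i log {1 + λᵀ g_i(θ)}`, as a supremum in `[-∞, ∞]`. -/
def elObjective [Fintype ι] (𝒱 : Set ℝ) {n : ℕ} (x : Fin n → EuclideanSpace ℝ (Fin d))
    (g : EstFun ι d p) (θ : EuclideanSpace ℝ (Fin p)) : EReal :=
  ⨆ lam ∈ multiplierSet 𝒱 x g θ,
    ((∑ i, Real.log (1 + ∑ j, lam j * g j (x i) θ) : ℝ) : EReal)

/-- `t` is an empirical likelihood estimate: a minimiser over `Θ` of `elObjective`. -/
def IsELEstimate [Fintype ι] (𝒱 : Set ℝ) (Θ : Set (EuclideanSpace ℝ (Fin p))) {n : ℕ}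
    (x : Fin n → EuclideanSpace ℝ (Fin d)) (g : EstFun ι d p)
    (t : EuclideanSpace ℝ (Fin p)) : Prop :=
  t ∈ Θ ∧ ∀ θ ∈ Θ, elObjective 𝒱 x g t ≤ elObjective 𝒱 x g θ

/-- `𝒜`: the uncertain moments that are valid, i.e. whose expectation at `θ₀` exists and is `0`. -/
def validSet (ν : Measure (EuclideanSpace ℝ (Fin d))) (gD : EstFun (Fin r₂) d p)
    (θ₀ : EuclideanSpace ℝ (Fin p)) : Set (Fin r₂) :=
  {j | Integrable (fun x => gD j x θ₀) ν ∧ ∫ x, gD j x θ₀ ∂ν = 0}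

/-- `ℋ = ℐ ∪ 𝒜` (a disjoint union), where `ℐ` has `r₁` elements. -/
def OracleIndex (r₁ : ℕ) (ν : Measure (EuclideanSpace ℝ (Fin d))) (gD : EstFun (Fin r₂) d p)
    (θ₀ : EuclideanSpace ℝ (Fin p)) : Type :=
  Fin r₁ ⊕ {j : Fin r₂ // j ∈ validSet ν gD θ₀}

instance (ν : Measure (EuclideanSpace ℝ (Fin d))) (gD : EstFun (Fin r₂) d p)
    (θ₀ : EuclideanSpace ℝ (Fin p)) : Finite (OracleIndex r₁ ν gD θ₀) :=
  inferInstanceAs (Finite (Fin r₁ ⊕ {j : Fin r₂ // j ∈ validSet ν gD θ₀}))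

instance (ν : Measure (EuclideanSpace ℝ (Fin d))) (gD : EstFun (Fin r₂) d p)
    (θ₀ : EuclideanSpace ℝ (Fin p)) : Fintype (OracleIndex r₁ ν gD θ₀) :=
  Fintype.ofFinite _

instance (ν : Measure (EuclideanSpace ℝ (Fin d))) (gD : EstFun (Fin r₂) d p)
    (θ₀ : EuclideanSpace ℝ (Fin p)) : DecidableEq (OracleIndex r₁ ν gD θ₀) :=
  Classical.decEq _

/-- `g^{(ℋ)}`: the functions `g^{(ℐ)}` stacked with those of `g^{(𝒟)}` that are indexed by `𝒜`. -/
def oracleFun (ν : Measure (EuclideanSpace ℝ (Fin d))) (gI : EstFun (Fin r₁) d p)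
    (gD : EstFun (Fin r₂) d p) (θ₀ : EuclideanSpace ℝ (Fin p)) :
    EstFun (OracleIndex r₁ ν gD θ₀) d p :=
  Sum.elim gI (fun j => gD j.1)

end Moments

end OracleEL

end

/-! Write ḡ(θ) for the sample mean of the moment vector at θ. For small multipliers, `elLog` lies
between two quadratics in l with linear part n⟪l, ḡ(θ)⟫ (`le_elLog`, `elLog_le`). If a bounds
‖ḡ(θ₀)‖, the profile criterion at θ₀ is O(n a²), hence so is its minimum. Testing a multiplier of
norm of order a in the direction of ḡ(θhat) then forces ‖ḡ(θhat)‖ = O(a)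
(`norm_empMean_estimate_le`).

Passing from a small ḡ(θhat) to θhat near θ₀ needs the identification condition, hence sample means
close to population means uniformly over Θ. A self-normalised exponential inequality on a finite net
gives this (`exists_uniform_event`); the variance of g(θ) - g(θ₀) is of the order of the squared
distance plus n^(-1/2), so most of the fluctuation is absorbed by the identification bound. Once
θhat is close enough for the sample gradient to be stable, inverting D gives ‖θhat - θ₀‖ = O(a)
(`norm_estimate_sub_le`).

The first order condition in θ is extracted without differentiating the multiplier. The optimal l at
a nearby point θhat + s•v is tested at θhat; the saddle property makes the likelihood with l frozen
no smaller at θhat + s•v, so its derivative is nonnegative somewhere between. That derivative is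
approximately n⟪l, D v⟫, and l is approximately the solution μ of V μ = ḡ(θ₀) + D(θhat - θ₀).
Letting s tend to 0 and using v and -v, ⟪D v, μ⟫ is negligible (`abs_inner_le`).

Taking v = J^(-1/2) α and w = V⁻¹ D v gives ⟪D v, μ⟫ = ⟪w, ḡ(θ₀)⟫ + αᵀ J^(1/2) (θhat - θ₀) with ⟪w,
V w⟫ = 1 (`exists_efficient_direction`). So the statistic equals -√n ⟪w, ḡ(θ₀)⟫ plus a remainder.
The main term is a normalised sum with unit variance and fourth moment O(h²), to which a Lyapunov
theorem applies (`tendstoInDistribution_of_rows`).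

The error sizes are a ~ √(h/n) for the score, e ~ √(hp/n) for the gradient, eV ~ h/√n for the second
moment matrix, L ~ √(hp) and S ~ √h p for the first and second derivatives, and b ~ √h n^(1/γ) for
the envelope. The remainder √n (a(e + eV) + a²(L + S + b)) is O(√(h³p²/n) + √(h³ n^(-1+2/γ))), which
is what the two growth conditions control. -/

noncomputable section

namespace OracleEL

open scoped RealInnerProductSpace

/-! ### Averages over a sample -/

section EmpMean

/-- The average of a finite family of vectors. -/
def empMean {n : ℕ} {F : Type*} [AddCommGroup F] [Module ℝ F] (f : Fin n → F) : F :=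
  (n : ℝ)⁻¹ • ∑ i, f i

variable {n : ℕ} {F : Type*} [AddCommGroup F] [Module ℝ F]

lemma empMean_add (f g : Fin n → F) :
    empMean (fun i => f i + g i) = empMean f + empMean g := by
  simp [empMean, Finset.sum_add_distrib]

lemma empMean_sub (f g : Fin n → F) :
    empMean (fun i => f i - g i) = empMean f - empMean g := by
  simp [empMean, Finset.sum_sub_distrib, smul_sub]

lemma empMean_const_mul (c : ℝ) (f : Fin n → ℝ) :
    empMean (fun i => c * f i) = c * empMean f := by
  simp only [empMean, smul_eq_mul, ← Finset.mul_sum]; ring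

lemma empMean_const (hn : 0 < n) (c : F) : empMean (fun _ : Fin n => c) = c := by
  simp only [empMean, Finset.sum_const, Finset.card_univ, Fintype.card_fin]
  rw [← Nat.cast_smul_eq_nsmul ℝ, smul_smul, inv_mul_cancel₀ (by positivity), one_smul]

lemma empMean_mono {f g : Fin n → ℝ} (h : ∀ i, f i ≤ g i) : empMean f ≤ empMean g := by
  simp only [empMean, smul_eq_mul]
  exact mul_le_mul_of_nonneg_left (Finset.sum_le_sum fun i _ => h i) (by positivity)

lemma empMean_nonneg {f : Fin n → ℝ} (h : ∀ i, 0 ≤ f i) : 0 ≤ empMean f := by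
  simp only [empMean, smul_eq_mul]
  exact mul_nonneg (by positivity) (Finset.sum_nonneg fun i _ => h i)

lemma sum_eq_mul_empMean (hn : 0 < n) (f : Fin n → ℝ) : ∑ i, f i = n * empMean f := by
  simp only [empMean, smul_eq_mul]
  rw [← mul_assoc, mul_inv_cancel₀ (by positivity), one_mul]

lemma empMean_finset_sum {κ : Type*} (s : Finset κ) (f : Fin n → κ → F) :
    empMean (fun i => ∑ k ∈ s, f i k) = ∑ k ∈ s, empMean fun i => f i k := by
  simp only [empMean]
  rw [Finset.sum_comm, Finset.smul_sum]

lemma map_empMean {G : Type*} [AddCommGroup G] [Module ℝ G] (φ : F →ₗ[ℝ] G) (f : Fin n → F) :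
    φ (empMean f) = empMean fun i => φ (f i) := by
  simp [empMean]

lemma inner_empMean {H : Type*} [NormedAddCommGroup H] [InnerProductSpace ℝ H] (u : H)
    (f : Fin n → H) : ⟪u, empMean f⟫ = empMean fun i => ⟪u, f i⟫ :=
  map_empMean (innerₛₗ ℝ u) f

lemma norm_empMean_le {F : Type*} [NormedAddCommGroup F] [NormedSpace ℝ F] (f : Fin n → F) :
    ‖empMean f‖ ≤ empMean fun i => ‖f i‖ := by
  simp only [empMean, norm_smul, smul_eq_mul]
  rw [Real.norm_of_nonneg (by positivity)]
  exact mul_le_mul_of_nonneg_left (norm_sum_le _ _) (by positivity)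

lemma abs_empMean_mul_le {f g : Fin n → ℝ} {A B : ℝ} (hA : 0 ≤ A) (hB : 0 ≤ B)
    (hf : empMean (fun i => f i ^ 2) ≤ A ^ 2) (hg : empMean (fun i => g i ^ 2) ≤ B ^ 2) :
    |empMean fun i => f i * g i| ≤ A * B := by
  apply abs_le_of_sq_le_sq _ (by positivity)
  have h := Finset.sum_mul_sq_le_sq_mul_sq Finset.univ f g
  calc (empMean fun i => f i * g i) ^ 2
      = ((n : ℝ)⁻¹) ^ 2 * (∑ i, f i * g i) ^ 2 := by simp only [empMean, smul_eq_mul]; ring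
    _ ≤ ((n : ℝ)⁻¹) ^ 2 * ((∑ i, f i ^ 2) * ∑ i, g i ^ 2) := by gcongr
    _ = (empMean fun i => f i ^ 2) * empMean fun i => g i ^ 2 := by
        simp only [empMean, smul_eq_mul]; ring
    _ ≤ A ^ 2 * B ^ 2 :=
        mul_le_mul hf hg (empMean_nonneg fun i => sq_nonneg _) (by positivity)
    _ = (A * B) ^ 2 := by ring

lemma empMean_abs_mul_le {f g : Fin n → ℝ} {A B : ℝ} (hA : 0 ≤ A) (hB : 0 ≤ B)
    (hf : empMean (fun i => f i ^ 2) ≤ A ^ 2) (hg : empMean (fun i => g i ^ 2) ≤ B ^ 2) :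
    (empMean fun i => |f i| * |g i|) ≤ A * B :=
  (le_abs_self _).trans (abs_empMean_mul_le hA hB (by simpa using hf) (by simpa using hg))

lemma sq_empMean_le (f : Fin n → ℝ) : (empMean f) ^ 2 ≤ empMean fun i => f i ^ 2 := by
  rcases Nat.eq_zero_or_pos n with rfl | hn
  · simp [empMean]
  have h0 : 0 ≤ empMean fun i => f i ^ 2 := empMean_nonneg fun i => sq_nonneg _
  have h := abs_empMean_mul_le (f := f) (g := fun _ => 1) (Real.sqrt_nonneg _) zero_le_one
    (Real.sq_sqrt h0).ge (by rw [empMean_const hn])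
  simp only [mul_one] at h
  calc (empMean f) ^ 2 = |empMean f| ^ 2 := (sq_abs _).symm
    _ ≤ (√(empMean fun i => f i ^ 2)) ^ 2 := by gcongr
    _ = _ := Real.sq_sqrt h0

end EmpMean

/-! ### Elementary bounds for the logarithm -/

/-- Together with the next lemma, a two-sided quadratic comparison. The coefficients 2 and 1/4
around the Taylor value 1/2 are deliberately slack; only their positivity matters later. -/
lemma sub_two_mul_sq_le_log_one_add {y : ℝ} (hy : |y| ≤ 1 / 8) :
    y - 2 * y ^ 2 ≤ Real.log (1 + y) := by
  obtain ⟨h1, h2⟩ := abs_le.1 hy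
  refine le_trans ?_ (Real.one_sub_inv_le_log_of_pos (show 0 < 1 + y by linarith))
  have h5 : 1 - (1 + y)⁻¹ = y / (1 + y) := by
    have : 1 + y ≠ 0 := by linarith
    field_simp; ring
  rw [h5, le_div_iff₀ (by linarith)]
  nlinarith [mul_nonneg (sq_nonneg y) (show (0 : ℝ) ≤ 1 + 2 * y by linarith)]

lemma log_one_add_le_sub_sq_div {y : ℝ} (hy : |y| ≤ 1 / 8) :
    Real.log (1 + y) ≤ y - y ^ 2 / 4 := by
  have := Real.abs_log_sub_add_sum_range_le (x := -y) (by rw [abs_neg]; linarith) 2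
  simp only [Finset.sum_range_succ, Finset.sum_range_zero, abs_neg, sub_neg_eq_add] at this
  norm_num at this
  have hb : |y| ^ 3 / (1 - |y|) ≤ y ^ 2 / 4 := by
    rw [div_le_iff₀ (by linarith)]
    have : |y| ^ 3 = y ^ 2 * |y| := by rw [pow_succ, sq_abs]
    rw [this]
    nlinarith [sq_nonneg y]
  have h3 := (abs_le.1 this).2
  linarith

/-! ### The empirical log-likelihood ratio at a fixed parameter -/

section FixedParameter

variable {n : ℕ} {H : Type*} [NormedAddCommGroup H] [InnerProductSpace ℝ H]
  {z : Fin n → H} {b c₀ C₀ δ : ℝ}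

/-- The empirical log-likelihood ratio with multiplier `l` of the vectors `z i`. -/
def elLog (z : Fin n → H) (l : H) : ℝ := ∑ i, Real.log (1 + ⟪l, z i⟫)

lemma abs_inner_le_of_norm_le (hb : ∀ i, ‖z i‖ ≤ b) {l : H} (hl : ‖l‖ ≤ δ) (i : Fin n) :
    |⟪l, z i⟫| ≤ δ * b :=
  (abs_real_inner_le_norm _ _).trans
    (mul_le_mul hl (hb i) (norm_nonneg _) ((norm_nonneg _).trans hl))

/-- Averaging the scalar bound turns `elLog` into n times a quadratic whose linear coefficient is
the sample mean; `elLog_le` is the upper side. The condition δ * b ≤ 1/8 keeps every inner product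
in the range of the scalar bounds. -/
lemma le_elLog (hn : 0 < n) (hb : ∀ i, ‖z i‖ ≤ b) {l : H} (hl : ‖l‖ ≤ δ) (hδ : δ * b ≤ 1 / 8)
    (hC : empMean (fun i => ⟪l, z i⟫ ^ 2) ≤ C₀ * ‖l‖ ^ 2) :
    n * (⟪l, empMean z⟫ - 2 * C₀ * ‖l‖ ^ 2) ≤ elLog z l := by
  rw [elLog, sum_eq_mul_empMean hn]
  gcongr
  calc ⟪l, empMean z⟫ - 2 * C₀ * ‖l‖ ^ 2
      ≤ empMean (fun i => ⟪l, z i⟫ - 2 * ⟪l, z i⟫ ^ 2) := by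
        rw [empMean_sub, empMean_const_mul, inner_empMean]; linarith
    _ ≤ _ := empMean_mono fun i =>
        sub_two_mul_sq_le_log_one_add ((abs_inner_le_of_norm_le hb hl i).trans hδ)

lemma elLog_le (hn : 0 < n) (hb : ∀ i, ‖z i‖ ≤ b) {l : H} (hl : ‖l‖ ≤ δ) (hδ : δ * b ≤ 1 / 8)
    (hc : c₀ * ‖l‖ ^ 2 ≤ empMean (fun i => ⟪l, z i⟫ ^ 2)) :
    elLog z l ≤ n * (⟪l, empMean z⟫ - c₀ / 4 * ‖l‖ ^ 2) := by
  rw [elLog, sum_eq_mul_empMean hn]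
  gcongr
  calc _ ≤ empMean (fun i => ⟪l, z i⟫ - 4⁻¹ * ⟪l, z i⟫ ^ 2) := empMean_mono fun i => by
        have := log_one_add_le_sub_sq_div ((abs_inner_le_of_norm_le hb hl i).trans hδ)
        linarith
    _ ≤ _ := by
        rw [empMean_sub, empMean_const_mul, inner_empMean]; linarith

/-- A multiplier of norm `δ` in the direction of the average. -/
lemma exists_le_elLog (hn : 0 < n) (hb : ∀ i, ‖z i‖ ≤ b) (hδ0 : 0 ≤ δ) (hδ : δ * b ≤ 1 / 8)
    (hC0 : 0 ≤ C₀) (hC : ∀ l : H, empMean (fun i => ⟪l, z i⟫ ^ 2) ≤ C₀ * ‖l‖ ^ 2) :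
    ∃ l : H, ‖l‖ ≤ δ ∧ n * (δ * ‖empMean z‖ - 2 * C₀ * δ ^ 2) ≤ elLog z l := by
  have hle : ‖(δ / ‖empMean z‖) • empMean z‖ ≤ δ := by
    rw [norm_smul, norm_div, norm_norm, Real.norm_of_nonneg hδ0]
    rcases eq_or_ne ‖empMean z‖ 0 with h | h
    · simpa [h] using hδ0
    · rw [div_mul_cancel₀ _ h]
  refine ⟨_, hle, le_trans ?_ (le_elLog hn hb hle hδ (hC _))⟩
  have h1 : ⟪(δ / ‖empMean z‖) • empMean z, empMean z⟫ = δ * ‖empMean z‖ := by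
    rw [real_inner_smul_left, real_inner_self_eq_norm_sq]
    rcases eq_or_ne ‖empMean z‖ 0 with h | h
    · simp [h]
    · field_simp
  rw [h1]
  gcongr

/-- The first order condition implies global optimality. -/
lemma elLog_le_of_sum_eq_zero {l : H} (hl : ∀ i, -1 < ⟪l, z i⟫)
    (hfoc : ∑ i, (1 + ⟪l, z i⟫)⁻¹ • z i = 0) {l' : H} (hl' : ∀ i, -1 < ⟪l', z i⟫) :
    elLog z l' ≤ elLog z l := by
  rw [← sub_nonpos, elLog, elLog, ← Finset.sum_sub_distrib]
  calc ∑ i, (Real.log (1 + ⟪l', z i⟫) - Real.log (1 + ⟪l, z i⟫))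
      ≤ ∑ i, ⟪l' - l, (1 + ⟪l, z i⟫)⁻¹ • z i⟫ := by
        refine Finset.sum_le_sum fun i _ => ?_
        have h1 : 0 < 1 + ⟪l, z i⟫ := by linarith [hl i]
        have h2 : 0 < 1 + ⟪l', z i⟫ := by linarith [hl' i]
        rw [← Real.log_div h2.ne' h1.ne', inner_smul_right, inner_sub_left]
        refine (Real.log_le_sub_one_of_pos (by positivity)).trans_eq ?_
        field_simp
        ring
    _ = 0 := by rw [← inner_sum, hfoc, inner_zero_right]

lemma hasFDerivAt_elLog {l : H} (hl : ∀ i, -1 < ⟪l, z i⟫) :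
    HasFDerivAt (elLog z) (∑ i, (1 + ⟪l, z i⟫)⁻¹ • innerSL ℝ (z i)) l := by
  unfold elLog
  refine HasFDerivAt.fun_sum fun i _ => ?_
  have h1 : HasFDerivAt (fun l : H => 1 + ⟪l, z i⟫) (innerSL ℝ (z i)) l := by
    have := ((innerSL ℝ (z i)).hasFDerivAt (x := l)).const_add 1
    simpa [real_inner_comm] using this
  exact h1.log (by linarith [hl i])

/-- A maximiser over the ball does at least as well as l = 0, whose value is 0. The upper quadratic
bound then forces ‖l‖ ≤ 4/c₀ ‖z̄‖ < δ, with z̄ the sample mean, so the maximiser is interior and its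
gradient vanishes. -/
lemma exists_elLog_max [FiniteDimensional ℝ H] (hn : 0 < n) (hb : ∀ i, ‖z i‖ ≤ b)
    (hδ0 : 0 < δ) (hδ : δ * b ≤ 1 / 8) (hc0 : 0 < c₀)
    (hc : ∀ l : H, c₀ * ‖l‖ ^ 2 ≤ empMean (fun i => ⟪l, z i⟫ ^ 2))
    (hz : 4 / c₀ * ‖empMean z‖ < δ) :
    ∃ l : H, ‖l‖ ≤ 4 / c₀ * ‖empMean z‖ ∧ ∑ i, (1 + ⟪l, z i⟫)⁻¹ • z i = 0 ∧
      elLog z l ≤ n * (4 / c₀ * ‖empMean z‖ ^ 2) := by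
  have hdom : ∀ l : H, ‖l‖ ≤ δ → ∀ i, -1 < ⟪l, z i⟫ := fun l hl i => by
    linarith [(abs_le.1 ((abs_inner_le_of_norm_le hb hl i).trans hδ)).1]
  have hcont : ContinuousOn (elLog z) (Metric.closedBall 0 δ) := fun l hl =>
    (hasFDerivAt_elLog (hdom l (by simpa using hl))).continuousAt.continuousWithinAt
  obtain ⟨l, hl, hmax⟩ := (isCompact_closedBall (0 : H) δ).exists_isMaxOn
    ⟨0, by simp [hδ0.le]⟩ hcont
  have hlδ : ‖l‖ ≤ δ := by simpa using hl
  have h0 : 0 ≤ elLog z l := by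
    have h := hmax (show (0 : H) ∈ Metric.closedBall 0 δ by simp [hδ0.le])
    have h' : elLog z 0 = 0 := by simp [elLog]
    rw [← h']; exact h
  have hup := elLog_le hn hb hlδ hδ (hc l)
  have hcs : ⟪l, empMean z⟫ ≤ ‖l‖ * ‖empMean z‖ := real_inner_le_norm _ _
  have hn' : (0 : ℝ) < n := by positivity
  have h1 : 0 ≤ ‖l‖ * ‖empMean z‖ - c₀ / 4 * ‖l‖ ^ 2 := by
    have : 0 ≤ ⟪l, empMean z⟫ - c₀ / 4 * ‖l‖ ^ 2 :=
      nonneg_of_mul_nonneg_right (h0.trans hup) hn'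
    linarith
  have h2 : ‖l‖ ≤ 4 / c₀ * ‖empMean z‖ := by
    rcases (norm_nonneg l).eq_or_lt with h | h
    · rw [← h]; positivity
    · have : c₀ / 4 * ‖l‖ ≤ ‖empMean z‖ := by
        by_contra hcon
        push Not at hcon
        nlinarith
      rw [div_mul_eq_mul_div, le_div_iff₀ hc0]; linarith
  refine ⟨l, h2, ?_, ?_⟩
  · have hint : l ∈ interior (Metric.closedBall (0 : H) δ) := by
      rw [interior_closedBall _ hδ0.ne']; simpa using h2.trans_lt hz
    have hloc : IsLocalMax (elLog z) l := hmax.isLocalMax (mem_interior_iff_mem_nhds.1 hint)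
    have hd := hloc.hasFDerivAt_eq_zero (hasFDerivAt_elLog (hdom l hlδ))
    -- The derivative at l is the inner product with u; evaluating it at u itself gives ⟪u, u⟫ = 0.
    set u := ∑ i, (1 + ⟪l, z i⟫)⁻¹ • z i with hu
    have : ⟪u, u⟫ = 0 := by
      have h3 := congrArg (fun φ : H →L[ℝ] ℝ => φ u) hd
      simp only [_root_.sum_apply, _root_.smul_apply,
        innerSL_apply_apply, _root_.zero_apply, smul_eq_mul] at h3
      conv_lhs => rw [hu, sum_inner]
      simpa only [real_inner_smul_left] using h3
    exact inner_self_eq_zero.1 this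
  · refine hup.trans ?_
    gcongr
    have : ‖l‖ * ‖empMean z‖ ≤ 4 / c₀ * ‖empMean z‖ * ‖empMean z‖ := by gcongr
    nlinarith [mul_nonneg hc0.le (sq_nonneg ‖l‖)]

/-- The first order condition determines the multiplier up to second order. -/
lemma norm_empMean_sub_le (hb : ∀ i, ‖z i‖ ≤ b) (hn : 0 < n) {l : H}
    (hl : ∀ i, |⟪l, z i⟫| ≤ 1 / 8) (hfoc : ∑ i, (1 + ⟪l, z i⟫)⁻¹ • z i = 0)
    (hC : empMean (fun i => ⟪l, z i⟫ ^ 2) ≤ C₀ * ‖l‖ ^ 2) :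
    ‖empMean z - empMean fun i => ⟪l, z i⟫ • z i‖ ≤ 2 * b * C₀ * ‖l‖ ^ 2 := by
  have hb0 : 0 ≤ b := (norm_nonneg _).trans (hb ⟨0, hn⟩)
  have h0 : empMean (fun i => (1 + ⟪l, z i⟫)⁻¹ • z i) = 0 := by
    rw [empMean, hfoc, smul_zero]
  have h1 : (empMean z - empMean fun i => ⟪l, z i⟫ • z i)
      = - empMean fun i => (⟪l, z i⟫ ^ 2 * (1 + ⟪l, z i⟫)⁻¹) • z i := by
    rw [eq_neg_iff_add_eq_zero, ← h0, ← empMean_sub, ← empMean_add]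
    congr 1
    ext1 i
    have : 1 + ⟪l, z i⟫ ≠ 0 := by linarith [(abs_le.1 (hl i)).1]
    have h2 : (1 + ⟪l, z i⟫)⁻¹ = 1 - ⟪l, z i⟫ + ⟪l, z i⟫ ^ 2 * (1 + ⟪l, z i⟫)⁻¹ := by
      field_simp
      ring
    conv_rhs => rw [h2, add_smul, sub_smul, one_smul]
  rw [h1, norm_neg]
  refine (norm_empMean_le _).trans ?_
  calc _ ≤ empMean fun i => 2 * b * ⟪l, z i⟫ ^ 2 := by
        refine empMean_mono fun i => ?_
        have h2 := (abs_le.1 (hl i)).1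
        have h3 : (1 + ⟪l, z i⟫)⁻¹ ≤ 2 := by
          rw [inv_le_comm₀ (by linarith) (by norm_num)]; linarith
        have h4 : 0 ≤ (1 + ⟪l, z i⟫)⁻¹ := inv_nonneg.2 (by linarith)
        rw [norm_smul, norm_mul, norm_pow, Real.norm_of_nonneg h4, Real.norm_eq_abs, sq_abs]
        calc ⟪l, z i⟫ ^ 2 * (1 + ⟪l, z i⟫)⁻¹ * ‖z i‖ ≤ ⟪l, z i⟫ ^ 2 * 2 * b := by
              gcongr; exact hb i
          _ = _ := by ring
    _ ≤ _ := by
        rw [empMean_const_mul]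
        calc _ ≤ 2 * b * (C₀ * ‖l‖ ^ 2) := by gcongr
          _ = _ := by ring

end FixedParameter

/-! ### Mean value inequalities along segments -/

section MeanValue

variable {E F : Type*} [NormedAddCommGroup E] [NormedSpace ℝ E] [NormedAddCommGroup F]
  [NormedSpace ℝ F] {Θ : Set E}

/-- Only the derivative along y - x needs a bound, which keeps operator norms out of later
estimates; derivatives relative to Θ suffice because the segment stays in Θ. -/
lemma norm_image_sub_le_of_segment {f : E → F} {f' : E → E →L[ℝ] F} (hΘ : Convex ℝ Θ)
    (hf : ∀ x ∈ Θ, HasFDerivWithinAt f (f' x) Θ x) {x y : E} (hx : x ∈ Θ) (hy : y ∈ Θ) {B : ℝ}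
    (hB : ∀ w ∈ segment ℝ x y, ‖f' w (y - x)‖ ≤ B) : ‖f y - f x‖ ≤ B := by
  have hmem : ∀ t ∈ Set.Icc (0 : ℝ) 1, AffineMap.lineMap x y t ∈ segment ℝ x y := fun t ht => by
    rw [segment_eq_image_lineMap]; exact ⟨t, ht, rfl⟩
  have hd : ∀ t ∈ Set.Icc (0 : ℝ) 1,
      HasDerivWithinAt (fun t : ℝ => f (AffineMap.lineMap x y t))
        (f' (AffineMap.lineMap x y t) (y - x)) (Set.Icc 0 1) t := fun t ht =>
    (hf _ (hΘ.segment_subset hx hy (hmem t ht))).comp_hasDerivWithinAt t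
      AffineMap.hasDerivWithinAt_lineMap fun s hs => hΘ.segment_subset hx hy (hmem s hs)
  simpa using norm_image_sub_le_of_norm_deriv_le_segment_01' hd fun t ht =>
    hB _ (hmem t (Set.Ico_subset_Icc_self ht))

/-- The n functions are treated as one map into an ℓ² product, so the mean value inequality uses the
same intermediate points for all i. Only the averaged square of the derivatives has to be
controlled. -/
lemma empMean_norm_image_sub_sq_le {F : Type*} [NormedAddCommGroup F] [InnerProductSpace ℝ F]
    {n : ℕ} {f : Fin n → E → F} {f' : Fin n → E → E →L[ℝ] F}
    (hΘ : Convex ℝ Θ) (hf : ∀ i, ∀ x ∈ Θ, HasFDerivWithinAt (f i) (f' i x) Θ x) {x y : E}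
    (hx : x ∈ Θ) (hy : y ∈ Θ) {B : ℝ} (hB0 : 0 ≤ B)
    (hB : ∀ w ∈ segment ℝ x y, empMean (fun i => ‖f' i w (y - x)‖ ^ 2) ≤ B ^ 2) :
    empMean (fun i => ‖f i y - f i x‖ ^ 2) ≤ B ^ 2 := by
  rcases Nat.eq_zero_or_pos n with rfl | hn
  · simpa [empMean] using sq_nonneg B
  have hn' : (0 : ℝ) < n := by positivity
  let G : E → PiLp 2 (fun _ : Fin n => F) := fun x => WithLp.toLp 2 fun i => f i x
  let G' : E → E →L[ℝ] PiLp 2 (fun _ : Fin n => F) := fun x =>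
    (PiLp.continuousLinearEquiv 2 ℝ (fun _ : Fin n => F)).symm.toContinuousLinearMap ∘L
      ContinuousLinearMap.pi fun i => f' i x
  have hG : ∀ x ∈ Θ, HasFDerivWithinAt G (G' x) Θ x := fun x hx => by
    rw [hasFDerivWithinAt_piLp]
    exact fun i => hf i x hx
  have key : ‖G y - G x‖ ≤ √n * B := by
    refine norm_image_sub_le_of_segment hΘ hG hx hy fun w hw => ?_
    apply le_of_sq_le_sq _ (by positivity)
    rw [PiLp.norm_sq_eq_of_L2, mul_pow, Real.sq_sqrt hn'.le]
    have h := hB w hw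
    rw [empMean, smul_eq_mul, inv_mul_le_iff₀ hn'] at h
    exact h
  have h2 : ‖G y - G x‖ ^ 2 ≤ n * B ^ 2 := by
    calc ‖G y - G x‖ ^ 2 ≤ (√n * B) ^ 2 := by gcongr
      _ = _ := by rw [mul_pow, Real.sq_sqrt hn'.le]
  rw [PiLp.norm_sq_eq_of_L2] at h2
  rw [empMean, smul_eq_mul, inv_mul_le_iff₀ hn']
  exact h2

end MeanValue

/-! ### Deterministic analysis of the empirical likelihood estimator -/

section Deterministic

variable {n : ℕ} {E H : Type*} [NormedAddCommGroup E] [InnerProductSpace ℝ E]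
  [NormedAddCommGroup H] [InnerProductSpace ℝ H]

/-- Quantitative regularity of a sample `g i : E → H` of moment functions around `θ₀`. -/
structure RegularSample (Θ : Set E) (θ₀ : E) (g : Fin n → E → H) (g' : Fin n → E → E →L[ℝ] H)
    (D : E →L[ℝ] H) (V : H →L[ℝ] H) (C a b L S e eV : ℝ) : Prop where
  n_pos : 0 < n
  convex : Convex ℝ Θ
  mem : θ₀ ∈ Θ
  one_le : 1 ≤ C
  a_pos : 0 < a
  L_nonneg : 0 ≤ L
  S_nonneg : 0 ≤ S
  e_nonneg : 0 ≤ e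
  eV_nonneg : 0 ≤ eV
  hasFDeriv : ∀ i, ∀ θ ∈ Θ, HasFDerivWithinAt (g i) (g' i θ) Θ θ
  norm_le : ∀ i, ∀ θ ∈ Θ, ‖g i θ‖ ≤ b
  lower : ∀ θ ∈ Θ, ∀ u : H, C⁻¹ * ‖u‖ ^ 2 ≤ empMean fun i => ⟪u, g i θ⟫ ^ 2
  upper : ∀ θ ∈ Θ, ∀ u : H, (empMean fun i => ⟪u, g i θ⟫ ^ 2) ≤ C * ‖u‖ ^ 2
  deriv_sq : ∀ θ ∈ Θ, ∀ v, empMean (fun i => ‖g' i θ v‖ ^ 2) ≤ (L * ‖v‖) ^ 2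
  deriv_lip : ∀ θ ∈ Θ, ∀ v,
    ‖empMean (fun i => g' i θ v) - empMean (fun i => g' i θ₀ v)‖ ≤ S * ‖θ - θ₀‖ * ‖v‖
  deriv_dev : ∀ v, ‖empMean (fun i => g' i θ₀ v) - D v‖ ≤ e * ‖v‖
  score : ‖empMean fun i => g i θ₀‖ ≤ a
  second_dev : ∀ u, ‖empMean (fun i => ⟪u, g i θ₀⟫ • g i θ₀) - V u‖ ≤ eV * ‖u‖
  D_upper : ∀ v, ‖D v‖ ≤ C * ‖v‖
  D_lower : ∀ v, ‖v‖ ≤ C * ‖D v‖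
  V_lower : ∀ u, ‖u‖ ≤ C * ‖V u‖

/-- `θhat` minimises over `Θ` the supremum over the multipliers `l` with values `⟪l, g i θ⟫`
in `𝒱`. -/
structure IsProfileMin (𝒱 : Set ℝ) (Θ : Set E) (g : Fin n → E → H) (θhat : E) : Prop where
  mem : θhat ∈ Θ
  min : ∀ θ ∈ Θ, ∀ M : ℝ, (∀ l : H, (∀ i, ⟪l, g i θ⟫ ∈ 𝒱) → elLog (fun i => g i θ) l ≤ M) →
    ∀ l : H, (∀ i, ⟪l, g i θhat⟫ ∈ 𝒱) → elLog (fun i => g i θhat) l ≤ M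

namespace RegularSample

variable {Θ : Set E} {θ₀ θhat : E} {g : Fin n → E → H} {g' : Fin n → E → E →L[ℝ] H}
  {D : E →L[ℝ] H} {V : H →L[ℝ] H} {C a b L S e eV κ : ℝ} {𝒱 : Set ℝ}

section

variable (hR : RegularSample Θ θ₀ g g' D V C a b L S e eV)
include hR

lemma C_pos : 0 < C := zero_lt_one.trans_le hR.one_le

lemma b_nonneg : 0 ≤ b := (norm_nonneg _).trans (hR.norm_le ⟨0, hR.n_pos⟩ θ₀ hR.mem)

lemma upper_sq {θ : E} (hθ : θ ∈ Θ) (u : H) :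
    (empMean fun i => ⟪u, g i θ⟫ ^ 2) ≤ (C * ‖u‖) ^ 2 := by
  refine (hR.upper θ hθ u).trans ?_
  rw [mul_pow]
  gcongr
  exact le_self_pow₀ hR.one_le two_ne_zero

/-- Mean value inequality for the sample mean minus D: on the segment its derivative is the drift
from θ₀, at most S‖θ - θ₀‖, plus the fluctuation e at θ₀. -/
lemma norm_empMean_linearization_le {θ : E} (hθ : θ ∈ Θ) :
    ‖(empMean fun i => g i θ) - (empMean fun i => g i θ₀) - D (θ - θ₀)‖
      ≤ (e + S * ‖θ - θ₀‖) * ‖θ - θ₀‖ := by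
  have hd : ∀ x ∈ Θ, HasFDerivWithinAt (fun x => (empMean fun i => g i x) - D x)
      ((n : ℝ)⁻¹ • (∑ i, g' i x) - D) Θ x := fun x hx =>
    ((HasFDerivWithinAt.fun_sum fun i _ => hR.hasFDeriv i x hx).const_smul _).sub
      D.hasFDerivWithinAt
  have h := norm_image_sub_le_of_segment hR.convex hd hR.mem hθ
    (B := (e + S * ‖θ - θ₀‖) * ‖θ - θ₀‖) fun w hw => ?_
  · have heq : (empMean fun i => g i θ) - (empMean fun i => g i θ₀) - D (θ - θ₀)
        = (empMean fun i => g i θ) - D θ - ((empMean fun i => g i θ₀) - D θ₀) := by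
      rw [map_sub]; abel
    rw [heq]; exact h
  have hwΘ := hR.convex.segment_subset hR.mem hθ hw
  have hwn : ‖w - θ₀‖ ≤ ‖θ - θ₀‖ := by
    rw [segment_eq_image_lineMap] at hw
    obtain ⟨t, ht, rfl⟩ := hw
    rw [AffineMap.lineMap_apply, vsub_eq_sub, vadd_eq_add, add_sub_cancel_right, norm_smul,
      Real.norm_of_nonneg ht.1]
    exact mul_le_of_le_one_left (norm_nonneg _) ht.2
  have h1 : ((n : ℝ)⁻¹ • (∑ i, g' i w) - D) (θ - θ₀)
      = (empMean (fun i => g' i w (θ - θ₀)) - empMean fun i => g' i θ₀ (θ - θ₀))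
        + (empMean (fun i => g' i θ₀ (θ - θ₀)) - D (θ - θ₀)) := by
    simp [empMean]
  rw [h1]
  calc _ ≤ S * ‖w - θ₀‖ * ‖θ - θ₀‖ + e * ‖θ - θ₀‖ :=
        (norm_add_le _ _).trans (add_le_add (hR.deriv_lip w hwΘ _) (hR.deriv_dev _))
    _ ≤ S * ‖θ - θ₀‖ * ‖θ - θ₀‖ + e * ‖θ - θ₀‖ := by
        have := hR.S_nonneg
        gcongr
    _ = _ := by ring

/-- Pairing the difference W with itself and moving one factor at a time gives two averages of
products. Cauchy–Schwarz bounds each by the eigenvalue bound C times the L² increment L‖θ - θ₀‖, so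
no higher empirical moments enter. -/
lemma norm_secondMoment_sub_le {θ : E} (hθ : θ ∈ Θ) (u : H) :
    ‖empMean (fun i => ⟪u, g i θ⟫ • g i θ) - empMean (fun i => ⟪u, g i θ₀⟫ • g i θ₀)‖
      ≤ 2 * C * L * ‖θ - θ₀‖ * ‖u‖ := by
  have hC := hR.C_pos
  have hL := hR.L_nonneg
  have hdiff : empMean (fun i => ‖g i θ - g i θ₀‖ ^ 2) ≤ (L * ‖θ - θ₀‖) ^ 2 :=
    empMean_norm_image_sub_sq_le hR.convex hR.hasFDeriv hR.mem hθ (by positivity) fun w hw =>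
      hR.deriv_sq w (hR.convex.segment_subset hR.mem hθ hw) _
  have hinner : ∀ w : H, empMean (fun i => ⟪w, g i θ - g i θ₀⟫ ^ 2)
      ≤ (L * ‖θ - θ₀‖ * ‖w‖) ^ 2 := fun w => by
    calc _ ≤ empMean (fun i => ‖w‖ ^ 2 * ‖g i θ - g i θ₀‖ ^ 2) := empMean_mono fun i => by
          rw [← mul_pow, ← sq_abs]
          have := abs_real_inner_le_norm w (g i θ - g i θ₀)
          gcongr
      _ ≤ ‖w‖ ^ 2 * (L * ‖θ - θ₀‖) ^ 2 := by
          rw [empMean_const_mul]; gcongr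
      _ = _ := by ring
  set W := empMean (fun i => ⟪u, g i θ⟫ • g i θ) - empMean (fun i => ⟪u, g i θ₀⟫ • g i θ₀)
    with hW
  have hWW : ‖W‖ * ‖W‖ ≤ 2 * C * L * ‖θ - θ₀‖ * ‖u‖ * ‖W‖ := by
    rw [← real_inner_self_eq_norm_mul_norm]
    have : ⟪W, W⟫ = empMean (fun i => ⟪u, g i θ⟫ * ⟪W, g i θ - g i θ₀⟫)
        + empMean (fun i => ⟪u, g i θ - g i θ₀⟫ * ⟪W, g i θ₀⟫) := by
      conv_lhs => rw [hW, inner_sub_right, inner_empMean, inner_empMean, ← empMean_sub]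
      rw [← empMean_add]
      congr 1
      ext1 i
      rw [inner_smul_right, inner_smul_right, inner_sub_right, inner_sub_right]
      ring
    rw [this]
    have h1 := (le_abs_self _).trans (abs_empMean_mul_le (by positivity) (by positivity)
      (hR.upper_sq hθ u) (hinner W))
    have h2 := (le_abs_self _).trans (abs_empMean_mul_le (by positivity) (by positivity)
      (hinner u) (hR.upper_sq hR.mem W))
    linarith
  rcases (norm_nonneg W).eq_or_lt with h | h
  · rw [← h]; positivity
  · exact le_of_mul_le_mul_right hWW h

end

section

variable [FiniteDimensional ℝ H] (hR : RegularSample Θ θ₀ g g' D V C a b L S e eV)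
  (hκ : κ ≤ 1 / 8) (h𝒱 : ∀ y, |y| ≤ κ → y ∈ 𝒱) (h𝒱' : 𝒱 ⊆ Set.Ioi (-1))
include hR hκ h𝒱'

/-- By concavity, the small critical multiplier is optimal among all multipliers with values in 𝒱,
including those outside the ball of radius δ. This identifies the profile value at θ and bounds it
by n times a multiple of the squared mean. -/
lemma exists_multiplier {θ : E} (hθ : θ ∈ Θ) {δ : ℝ} (hδ0 : 0 < δ) (hδ : δ * b ≤ κ)
    (hz : 4 * C * ‖empMean fun i => g i θ‖ < δ) :
    ∃ l : H, ‖l‖ < δ ∧ ∑ i, (1 + ⟪l, g i θ⟫)⁻¹ • g i θ = 0 ∧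
      elLog (fun i => g i θ) l ≤ n * (4 * C * ‖empMean fun i => g i θ‖ ^ 2) ∧
      ∀ l' : H, (∀ i, ⟪l', g i θ⟫ ∈ 𝒱) → elLog (fun i => g i θ) l' ≤ elLog (fun i => g i θ) l := by
  have h4 : 4 / C⁻¹ = 4 * C := by rw [div_inv_eq_mul]
  obtain ⟨l, hl, hfoc, hle⟩ := exists_elLog_max (z := fun i => g i θ) hR.n_pos
    (fun i => hR.norm_le i θ hθ) hδ0 (hδ.trans hκ) (inv_pos.2 hR.C_pos) (hR.lower θ hθ)
    (by rwa [h4])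
  rw [h4] at hl hle
  refine ⟨l, hl.trans_lt hz, hfoc, hle, fun l' hl' =>
    elLog_le_of_sum_eq_zero (fun i => ?_) hfoc fun i => h𝒱' (hl' i)⟩
  have := abs_inner_le_of_norm_le (fun i => hR.norm_le i θ hθ) (hl.trans hz.le) i
  linarith [(abs_le.1 (this.trans hδ)).1]

include h𝒱

/-- The profile value at θhat is at most that at θ₀, hence at most 4 C n a². A multiplier of length
8 C a along the mean at θhat would exceed this if that mean were large. -/
lemma norm_empMean_estimate_le (hmin : IsProfileMin 𝒱 Θ g θhat) (hab : 8 * C * a * b ≤ κ) :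
    ‖empMean fun i => g i θhat‖ ≤ 17 * C ^ 2 * a := by
  have hC := hR.C_pos
  have ha := hR.a_pos
  have hn : (0 : ℝ) < n := by exact_mod_cast hR.n_pos
  have hδ0 : 0 < 8 * C * a := by positivity
  obtain ⟨l, -, -, hle, hmax⟩ := hR.exists_multiplier hκ h𝒱' hR.mem hδ0 hab (by
    have := hR.score
    calc _ ≤ 4 * C * a := by gcongr
      _ < _ := by nlinarith [mul_pos hC ha])
  obtain ⟨l', hl', hge⟩ := exists_le_elLog (z := fun i => g i θhat) hR.n_pos
    (fun i => hR.norm_le i _ hmin.mem) hδ0.le (hab.trans hκ) hC.le (hR.upper _ hmin.mem)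
  have h1 := hmin.min θ₀ hR.mem _ hmax l' fun i => h𝒱 _
    ((abs_inner_le_of_norm_le (fun i => hR.norm_le i _ hmin.mem) hl' i).trans hab)
  have h2 := le_of_mul_le_mul_left (hge.trans (h1.trans hle)) hn
  have h3 : 4 * C * ‖empMean fun i => g i θ₀‖ ^ 2 ≤ 4 * C * a ^ 2 := by
    have := hR.score
    gcongr
  -- The quadratic loss 2C(8Ca)² equals 8Ca · 16C²a, and 4Ca² is at most 8Ca · a.
  have h4 : 8 * C * a * ‖empMean fun i => g i θhat‖ ≤ 8 * C * a * (16 * C ^ 2 * a + a) := by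
    nlinarith [mul_pos hC (pow_pos ha 2)]
  have h5 := le_of_mul_le_mul_left h4 hδ0
  nlinarith [mul_le_mul_of_nonneg_right (one_le_pow₀ hR.one_le : 1 ≤ C ^ 2) ha.le]

-- Under `he` and `hS`, C times the linearisation error is at most half of ‖θhat - θ₀‖ and can be
-- absorbed on the left. Preliminary consistency enters only through `hS`.
omit hκ h𝒱' h𝒱 [FiniteDimensional ℝ H] in
lemma norm_estimate_sub_le (hθ : θhat ∈ Θ) {a' : ℝ}
    (ha' : ‖empMean fun i => g i θhat‖ ≤ a') (he : C * e ≤ 1 / 4)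
    (hS : C * (S * ‖θhat - θ₀‖) ≤ 1 / 4) : ‖θhat - θ₀‖ ≤ 2 * C * (a' + a) := by
  have hC := hR.C_pos
  have h1 := hR.D_lower (θhat - θ₀)
  have h2 := hR.norm_empMean_linearization_le hθ
  have h3 : ‖D (θhat - θ₀)‖ ≤ a' + a + (e + S * ‖θhat - θ₀‖) * ‖θhat - θ₀‖ := by
    have : D (θhat - θ₀) = (empMean fun i => g i θhat) - (empMean fun i => g i θ₀)
        - ((empMean fun i => g i θhat) - (empMean fun i => g i θ₀) - D (θhat - θ₀)) := by abel
    rw [this]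
    calc _ ≤ _ := (norm_sub_le _ _).trans (add_le_add_left (norm_sub_le _ _) _)
      _ ≤ _ := by linarith [hR.score]
  have h4 : C * ((e + S * ‖θhat - θ₀‖) * ‖θhat - θ₀‖) ≤ 1 / 2 * ‖θhat - θ₀‖ := by
    rw [← mul_assoc]
    gcongr
    linarith
  nlinarith

end

end RegularSample

end Deterministic

/-! ### First order conditions of the saddle point -/

section FirstOrder

variable {n : ℕ} {E H : Type*} [NormedAddCommGroup E] [InnerProductSpace ℝ E]
  [NormedAddCommGroup H] [InnerProductSpace ℝ H]

namespace RegularSample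

variable {Θ : Set E} {θ₀ θhat : E} {g : Fin n → E → H} {g' : Fin n → E → E →L[ℝ] H}
  {D : E →L[ℝ] H} {V : H →L[ℝ] H} {C a b L S e eV κ : ℝ} {𝒱 : Set ℝ}

/-- With l frozen, the log-likelihood along the segment does not decrease from one end to the other,
so the mean value theorem yields a point of nonnegative slope. -/
lemma exists_deriv_nonneg (hR : RegularSample Θ θ₀ g g' D V C a b L S e eV) {θ v : E} {s : ℝ}
    (hs : 0 < s) (hseg : ∀ t ∈ Set.Icc 0 s, Θ ∈ 𝓝 (θ + t • v)) {l : H}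
    (hl : ∀ i, ∀ θ ∈ Θ, -1 < ⟪l, g i θ⟫)
    (hle : elLog (fun i => g i θ) l ≤ elLog (fun i => g i (θ + s • v)) l) :
    ∃ t ∈ Set.Ioo 0 s, 0 ≤ empMean fun i =>
      ⟪l, g' i (θ + t • v) v⟫ * (1 + ⟪l, g i (θ + t • v)⟫)⁻¹ := by
  have hd : ∀ t ∈ Set.Icc 0 s, HasDerivAt (fun t : ℝ => elLog (fun i => g i (θ + t • v)) l)
      (∑ i, ⟪l, g' i (θ + t • v) v⟫ * (1 + ⟪l, g i (θ + t • v)⟫)⁻¹) t := fun t ht => by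
    unfold elLog
    refine HasDerivAt.fun_sum fun i _ => ?_
    have h1 : HasDerivAt (fun t : ℝ => θ + t • v) v t := by
      simpa using ((hasDerivAt_id t).smul_const v).const_add θ
    have h2 := ((hR.hasFDeriv i _ (mem_of_mem_nhds (hseg t ht))).hasFDerivAt
      (hseg t ht)).comp_hasDerivAt t h1
    have h3 : HasDerivAt (fun t : ℝ => 1 + ⟪l, g i (θ + t • v)⟫) ⟪l, g' i (θ + t • v) v⟫ t :=
      ((innerSL ℝ l).hasFDerivAt.comp_hasDerivAt t h2).const_add 1
    rw [← div_eq_mul_inv]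
    exact h3.log (by linarith [hl i _ (mem_of_mem_nhds (hseg t ht))])
  obtain ⟨t, ht, heq⟩ := exists_hasDerivAt_eq_slope _ _ hs
    (fun t ht => (hd t ht).continuousAt.continuousWithinAt)
    fun t ht => hd t (Set.Ioo_subset_Icc_self ht)
  refine ⟨t, ht, ?_⟩
  rw [empMean, heq, smul_eq_mul]
  simp only [zero_smul, add_zero, sub_zero]
  exact mul_nonneg (by positivity) (div_nonneg (by linarith) hs.le)

/-- Replacing (1 + y)⁻¹ by 1 costs at most 2|y|, which leaves an average of products handled by
Cauchy–Schwarz. Replacing the sample gradient at θ by D then costs at most e + S r. -/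
lemma neg_le_inner_deriv (hR : RegularSample Θ θ₀ g g' D V C a b L S e eV) {θ v : E}
    (hθ : θ ∈ Θ) {l : H} {Λ r : ℝ} (hl : ‖l‖ ≤ Λ) (hΛb : Λ * b ≤ 1 / 8) (hr : ‖θ - θ₀‖ ≤ r)
    (hv : ‖v‖ = 1)
    (h0 : 0 ≤ empMean fun i => ⟪l, g' i θ v⟫ * (1 + ⟪l, g i θ⟫)⁻¹) :
    -(2 * C * L * Λ ^ 2 + Λ * (e + S * r)) ≤ ⟪l, D v⟫ := by
  have hC := hR.C_pos
  have hL := hR.L_nonneg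
  have hS := hR.S_nonneg
  have hΛ0 : 0 ≤ Λ := (norm_nonneg _).trans hl
  have hy : ∀ i, |⟪l, g i θ⟫| ≤ 1 / 8 := fun i =>
    (abs_inner_le_of_norm_le (fun i => hR.norm_le i θ hθ) hl i).trans hΛb
  have h1 : empMean (fun i => ⟪l, g' i θ v⟫ * (1 + ⟪l, g i θ⟫)⁻¹)
      ≤ empMean (fun i => ⟪l, g' i θ v⟫ + 2 * (|⟪l, g' i θ v⟫| * |⟪l, g i θ⟫|)) := by
    refine empMean_mono fun i => ?_
    obtain ⟨h2, h3⟩ := abs_le.1 (hy i)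
    have h4 : 0 < 1 + ⟪l, g i θ⟫ := by linarith
    have h5 : |(1 + ⟪l, g i θ⟫)⁻¹ - 1| ≤ 2 * |⟪l, g i θ⟫| := by
      have : (1 + ⟪l, g i θ⟫)⁻¹ - 1 = -⟪l, g i θ⟫ * (1 + ⟪l, g i θ⟫)⁻¹ := by
        field_simp; ring
      rw [this, abs_mul, abs_neg, abs_of_pos (inv_pos.2 h4), mul_comm]
      gcongr
      rw [inv_le_comm₀ h4 (by norm_num)]; linarith
    calc ⟪l, g' i θ v⟫ * (1 + ⟪l, g i θ⟫)⁻¹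
        = ⟪l, g' i θ v⟫ + ⟪l, g' i θ v⟫ * ((1 + ⟪l, g i θ⟫)⁻¹ - 1) := by ring
      _ ≤ ⟪l, g' i θ v⟫ + |⟪l, g' i θ v⟫| * |(1 + ⟪l, g i θ⟫)⁻¹ - 1| := by
          have := (le_abs_self _).trans_eq (abs_mul ⟪l, g' i θ v⟫ ((1 + ⟪l, g i θ⟫)⁻¹ - 1))
          linarith
      _ ≤ ⟪l, g' i θ v⟫ + |⟪l, g' i θ v⟫| * (2 * |⟪l, g i θ⟫|) := by gcongr
      _ = _ := by ring
  rw [empMean_add, empMean_const_mul] at h1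
  have h2 : (empMean fun i => |⟪l, g' i θ v⟫| * |⟪l, g i θ⟫|) ≤ (Λ * L) * (C * Λ) := by
    refine empMean_abs_mul_le (by positivity) (by positivity) ?_ ?_
    · calc _ ≤ empMean (fun i => Λ ^ 2 * ‖g' i θ v‖ ^ 2) := empMean_mono fun i => by
            rw [← mul_pow, ← sq_abs]
            have := abs_real_inner_le_norm l (g' i θ v)
            gcongr
            exact this.trans (by gcongr)
        _ ≤ Λ ^ 2 * (L * 1) ^ 2 := by
            rw [empMean_const_mul, ← hv]
            have := hR.deriv_sq θ hθ v
            gcongr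
        _ = _ := by ring
    · exact (hR.upper_sq hθ l).trans (by gcongr)
  rw [← inner_empMean] at h1
  have h3 : ⟪l, empMean fun i => g' i θ v⟫ ≤ ⟪l, D v⟫ + Λ * (e + S * r) := by
    have h4 : ‖(empMean fun i => g' i θ v) - D v‖ ≤ e + S * r := by
      have h5 := hR.deriv_lip θ hθ v
      have h6 := hR.deriv_dev v
      rw [hv, mul_one] at h5 h6
      calc _ = ‖(empMean (fun i => g' i θ v) - empMean fun i => g' i θ₀ v)
            + (empMean (fun i => g' i θ₀ v) - D v)‖ := by congr 1; abel
        _ ≤ S * ‖θ - θ₀‖ + e := (norm_add_le _ _).trans (add_le_add h5 h6)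
        _ ≤ e + S * r := by rw [add_comm]; gcongr
    have h7 : ⟪l, (empMean fun i => g' i θ v) - D v⟫ ≤ Λ * (e + S * r) :=
      (real_inner_le_norm _ _).trans (by gcongr)
    rw [inner_sub_right] at h7
    linarith
  linarith

/-- V(l - μ) splits into the fluctuation of the second moment matrix, its drift in θ, the quadratic
error in the condition for l, the linearisation error of the mean, and the shift from θ to θ₁. The
lower bound on V converts this into a bound on l - μ. -/
lemma norm_multiplier_sub_le (hR : RegularSample Θ θ₀ g g' D V C a b L S e eV) {θ θ₁ : E}
    (hθ : θ ∈ Θ) {l μ : H} {Λ r s : ℝ} (hl : ‖l‖ ≤ Λ) (hΛb : Λ * b ≤ 1 / 8)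
    (hr : ‖θ - θ₀‖ ≤ r) (hfoc : ∑ i, (1 + ⟪l, g i θ⟫)⁻¹ • g i θ = 0)
    (hμ : V μ = (empMean fun i => g i θ₀) + D (θ₁ - θ₀)) (hs : ‖θ - θ₁‖ ≤ s) :
    ‖l - μ‖ ≤ C * (eV * Λ + 2 * C * L * r * Λ + 2 * b * C * Λ ^ 2 + (e + S * r) * r + C * s) := by
  have hC := hR.C_pos
  have hL := hR.L_nonneg
  have hS := hR.S_nonneg
  have he := hR.e_nonneg
  have heV := hR.eV_nonneg
  have hb := hR.b_nonneg
  have hΛ0 : 0 ≤ Λ := (norm_nonneg _).trans hl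
  have hr0 : 0 ≤ r := (norm_nonneg _).trans hr
  have hy : ∀ i, |⟪l, g i θ⟫| ≤ 1 / 8 := fun i =>
    (abs_inner_le_of_norm_le (fun i => hR.norm_le i θ hθ) hl i).trans hΛb
  refine (hR.V_lower _).trans ?_
  gcongr
  have h1 := hR.second_dev l
  have h2 := hR.norm_secondMoment_sub_le hθ l
  have h3 := norm_empMean_sub_le (z := fun i => g i θ) (fun i => hR.norm_le i θ hθ) hR.n_pos hy
    hfoc (hR.upper θ hθ l)
  have h4 := hR.norm_empMean_linearization_le hθ
  have h5 := hR.D_upper (θ - θ₁)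
  set A := empMean (fun i => ⟪l, g i θ⟫ • g i θ)
  set A₀ := empMean (fun i => ⟪l, g i θ₀⟫ • g i θ₀)
  set m := empMean fun i => g i θ
  set m₀ := empMean fun i => g i θ₀
  have hDs : D (θ - θ₀) = D (θ - θ₁) + D (θ₁ - θ₀) := by rw [← map_add]; congr 1; abel
  have key : V (l - μ) = -(A₀ - V l) - (A - A₀) - (m - A) + (m - m₀ - D (θ - θ₀))
      + D (θ - θ₁) := by
    rw [map_sub, hμ, hDs]; abel
  rw [key]
  refine (norm_add_le _ _).trans (add_le_add ((norm_add_le _ _).trans (add_le_add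
    ((norm_sub_le _ _).trans (add_le_add ((norm_sub_le _ _).trans (add_le_add ?_ ?_)) ?_)) ?_)) ?_)
  · rw [norm_neg]; exact h1.trans (by gcongr)
  · exact h2.trans (by gcongr)
  · exact h3.trans (by gcongr)
  · exact h4.trans (by gcongr)
  · exact h5.trans (by gcongr)

variable [FiniteDimensional ℝ H]

/-- The first order condition in `θ` of the saddle point problem. -/
theorem abs_inner_le (hR : RegularSample Θ θ₀ g g' D V C a b L S e eV)
    (hκ : κ ≤ 1 / 8) (h𝒱 : ∀ y, |y| ≤ κ → y ∈ 𝒱) (h𝒱' : 𝒱 ⊆ Set.Ioi (-1))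
    (hmin : IsProfileMin 𝒱 Θ g θhat) {r Λ : ℝ} (hr : ‖θhat - θ₀‖ < r)
    (hball : Metric.ball θ₀ r ⊆ Θ) (hrΛ : r ≤ Λ) (heS : e + S * r ≤ C)
    (hΛ : 4 * C * (a + 2 * C * r) < Λ) (hΛb : Λ * b ≤ κ) {μ : H}
    (hμ : V μ = (empMean fun i => g i θ₀) + D (θhat - θ₀)) {v : E} (hv : ‖v‖ = 1) :
    |⟪D v, μ⟫| ≤ 6 * C ^ 3 * (Λ * (e + eV) + Λ ^ 2 * (L + S + b)) := by
  have hC := hR.C_pos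
  have h1C := hR.one_le
  have hL := hR.L_nonneg
  have hS := hR.S_nonneg
  have he := hR.e_nonneg
  have heV := hR.eV_nonneg
  have hb := hR.b_nonneg
  have hr0 : 0 < r := (norm_nonneg _).trans_lt hr
  have hΛ0 : 0 < Λ := hr0.trans_le hrΛ
  set B := 6 * C ^ 3 * (Λ * (e + eV) + Λ ^ 2 * (L + S + b)) with hB
  have one_sided : ∀ v : E, ‖v‖ = 1 → -B ≤ ⟪D v, μ⟫ := by
    intro v hv
    refine le_of_forall_pos_le_add fun ε hε => ?_
    -- Small enough to keep the segment inside the ball, and to make the shift from θhat to θhat +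
    -- s•v, which contributes C³ s in the end, at most ε.
    obtain ⟨s, hs0, hs⟩ : ∃ s : ℝ, 0 < s ∧ s < min (r - ‖θhat - θ₀‖) (ε / C ^ 3) :=
      exists_between (lt_min (by linarith) (by positivity))
    have hsr : s < r - ‖θhat - θ₀‖ := hs.trans_le (min_le_left _ _)
    have hsε : C ^ 3 * s ≤ ε := by
      have := (hs.trans_le (min_le_right _ _)).le
      rw [le_div_iff₀ (by positivity)] at this
      linarith
    have hnorm : ∀ t ∈ Set.Icc 0 s, ‖θhat + t • v - θ₀‖ < r := fun t ht => by
      calc _ = ‖θhat - θ₀ + t • v‖ := by congr 1; abel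
        _ ≤ ‖θhat - θ₀‖ + t := by
            refine (norm_add_le _ _).trans_eq ?_
            rw [norm_smul, hv, mul_one, Real.norm_of_nonneg ht.1]
        _ < r := by linarith [ht.2]
    have hnhds : ∀ t ∈ Set.Icc 0 s, Θ ∈ 𝓝 (θhat + t • v) := fun t ht =>
      mem_of_superset (Metric.isOpen_ball.mem_nhds
        (by rw [Metric.mem_ball, dist_eq_norm]; exact hnorm t ht)) hball
    have hss : s ∈ Set.Icc 0 s := ⟨hs0.le, le_rfl⟩
    have hθs : θhat + s • v ∈ Θ := mem_of_mem_nhds (hnhds s hss)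
    have hns := (hnorm s hss).le
    have hm : ‖empMean fun i => g i (θhat + s • v)‖ ≤ a + 2 * C * r := by
      have h1 := hR.norm_empMean_linearization_le hθs
      have h2 := hR.D_upper (θhat + s • v - θ₀)
      have h3 := hR.score
      have h4 : (e + S * ‖θhat + s • v - θ₀‖) * ‖θhat + s • v - θ₀‖ ≤ C * r := by
        refine (mul_le_mul ?_ hns (norm_nonneg _) hC.le)
        refine le_trans ?_ heS
        gcongr
      have h5 : C * ‖θhat + s • v - θ₀‖ ≤ C * r := by gcongr
      calc _ = ‖((empMean fun i => g i (θhat + s • v)) - (empMean fun i => g i θ₀)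
            - D (θhat + s • v - θ₀)) + D (θhat + s • v - θ₀) + empMean fun i => g i θ₀‖ := by
            congr 1; abel
        _ ≤ _ := (norm_add_le _ _).trans (add_le_add_left (norm_add_le _ _) _)
        _ ≤ _ := by linarith
    obtain ⟨l, hl, hfoc, -, hmax⟩ := hR.exists_multiplier hκ h𝒱' hθs hΛ0 hΛb
      (lt_of_le_of_lt (by gcongr) hΛ)
    -- l is optimal at θhat + s•v and merely admissible at θhat, so minimality of the profile at
    -- θhat compares the two points with the same l.
    have hle := hmin.min _ hθs _ hmax l fun i => h𝒱 _
      ((abs_inner_le_of_norm_le (fun i => hR.norm_le i _ hmin.mem) hl.le i).trans hΛb)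
    obtain ⟨t, ht, hpos⟩ := hR.exists_deriv_nonneg hs0 hnhds (fun i θ hθ => by
      have := abs_inner_le_of_norm_le (fun i => hR.norm_le i θ hθ) hl.le i
      linarith [(abs_le.1 (this.trans hΛb)).1]) hle
    have htI := Set.Ioo_subset_Icc_self ht
    have h1 := hR.neg_le_inner_deriv (mem_of_mem_nhds (hnhds t htI)) hl.le (hΛb.trans hκ)
      (hnorm t htI).le hv hpos
    have h2 := hR.norm_multiplier_sub_le hθs hl.le (hΛb.trans hκ) hns hfoc hμ (s := s) (by
      rw [add_sub_cancel_left, norm_smul, hv, mul_one, Real.norm_of_nonneg hs0.le])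
    have h3 : ⟪l - μ, D v⟫ ≤ C * (eV * Λ + 2 * C * L * r * Λ + 2 * b * C * Λ ^ 2
        + (e + S * r) * r + C * s) * C := by
      have h4 := hR.D_upper v
      rw [hv, mul_one] at h4
      exact (real_inner_le_norm _ _).trans (mul_le_mul h2 h4 (norm_nonneg _)
        ((norm_nonneg _).trans h2))
    rw [inner_sub_left] at h3
    rw [real_inner_comm]
    have hC2 : 1 ≤ C ^ 2 := one_le_pow₀ h1C
    have hC3 : C ^ 2 ≤ C ^ 3 := pow_le_pow_right₀ h1C (by norm_num)
    have hC1 : C ≤ C ^ 3 := le_self_pow₀ h1C (by norm_num)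
    have e1 : 2 * C * L * Λ ^ 2 ≤ C ^ 3 * (2 * (Λ ^ 2 * L)) := by
      have : 2 * C * L * Λ ^ 2 = C * (2 * (Λ ^ 2 * L)) := by ring
      rw [this]; gcongr
    have e2 : Λ * (e + S * r) ≤ C ^ 3 * (Λ * e + Λ ^ 2 * S) := by
      calc Λ * (e + S * r) ≤ Λ * (e + S * Λ) := by gcongr
        _ = 1 * (Λ * e + Λ ^ 2 * S) := by ring
        _ ≤ _ := by gcongr; exact hC2.trans hC3
    have e3 : C * (eV * Λ + 2 * C * L * r * Λ + 2 * b * C * Λ ^ 2 + (e + S * r) * r + C * s) * C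
        ≤ C ^ 3 * (Λ * eV + 2 * (Λ ^ 2 * L) + 2 * (Λ ^ 2 * b) + (Λ * e + Λ ^ 2 * S)) + ε := by
      calc _ ≤ C * (eV * Λ + 2 * C * L * Λ * Λ + 2 * b * C * Λ ^ 2 + (e + S * Λ) * Λ + C * s) * C
          := by gcongr
        _ = C ^ 3 * (2 * (Λ ^ 2 * L) + 2 * (Λ ^ 2 * b)) + C ^ 2 * (Λ * eV + (Λ * e + Λ ^ 2 * S))
            + C ^ 3 * s := by ring
        _ ≤ C ^ 3 * (2 * (Λ ^ 2 * L) + 2 * (Λ ^ 2 * b)) + C ^ 3 * (Λ * eV + (Λ * e + Λ ^ 2 * S))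
            + ε := by gcongr
        _ = _ := by ring
    have e4 : B = C ^ 3 * (6 * (Λ * e) + 6 * (Λ * eV) + 6 * (Λ ^ 2 * L) + 6 * (Λ ^ 2 * S)
        + 6 * (Λ ^ 2 * b)) := by rw [hB]; ring
    have e5 : C ^ 3 * (2 * (Λ ^ 2 * L)) + C ^ 3 * (Λ * e + Λ ^ 2 * S)
        + C ^ 3 * (Λ * eV + 2 * (Λ ^ 2 * L) + 2 * (Λ ^ 2 * b) + (Λ * e + Λ ^ 2 * S)) ≤ B := by
      rw [e4, ← mul_add, ← mul_add]
      gcongr C ^ 3 * ?_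
      have := mul_nonneg hΛ0.le he
      have := mul_nonneg hΛ0.le heV
      have := mul_nonneg (sq_nonneg Λ) hL
      have := mul_nonneg (sq_nonneg Λ) hS
      have := mul_nonneg (sq_nonneg Λ) hb
      linarith
    linarith
  refine abs_le.2 ⟨one_sided v hv, ?_⟩
  have := one_sided (-v) (by rwa [norm_neg])
  rw [map_neg, inner_neg_left] at this
  linarith

end RegularSample

end FirstOrder

/-! ### Deviations of sample means -/

section Sample

variable {n : ℕ} {Ω 𝒳 : Type*} [MeasurableSpace Ω] [MeasurableSpace 𝒳] {P : Measure Ω}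
  {ν : Measure 𝒳} {X : Fin n → Ω → 𝒳}

lemma hasLaw_comp_real (hlaw : ∀ i, HasLaw (X i) ν P) {φ : 𝒳 → ℝ} (hφ : Measurable φ) (i : Fin n) :
    HasLaw (fun ω => φ (X i ω)) (ν.map φ) P :=
  HasLaw.fun_comp ⟨hφ.aemeasurable, rfl⟩ (hlaw i)

lemma memLp_comp_of_hasLaw (hlaw : ∀ i, HasLaw (X i) ν P) {φ : 𝒳 → ℝ} {q : ℝ≥0∞}
    (hφ : MemLp φ q ν) (i : Fin n) : MemLp (fun ω => φ (X i ω)) q P := by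
  have h := hlaw i
  have h1 : MemLp φ q (P.map (X i)) := by rwa [h.map_eq]
  exact h1.comp_of_map h.aemeasurable

lemma aemeasurable_empMean (hlaw : ∀ i, HasLaw (X i) ν P) {φ : 𝒳 → ℝ} (hφ : Measurable φ) :
    AEMeasurable (fun ω => empMean fun i => φ (X i ω)) P := by
  exact (Finset.aemeasurable_fun_sum _ fun i _ =>
    hφ.comp_aemeasurable (hlaw i).aemeasurable).const_mul (n : ℝ)⁻¹

variable [IsProbabilityMeasure P]

lemma integral_sq_empMean_sub_le (hn : 0 < n) (hlaw : ∀ i, HasLaw (X i) ν P)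
    (hindep : iIndepFun X P) {φ : 𝒳 → ℝ} (hφm : Measurable φ) (hφ : MemLp φ 2 ν) :
    Integrable (fun ω => ((empMean fun i => φ (X i ω)) - ∫ x, φ x ∂ν) ^ 2) P ∧
    ∫ ω, ((empMean fun i => φ (X i ω)) - ∫ x, φ x ∂ν) ^ 2 ∂P ≤ (∫ x, φ x ^ 2 ∂ν) / n := by
  have hn' : (0 : ℝ) < n := by positivity
  have hL : ∀ i, MemLp (fun ω => φ (X i ω)) 2 P := memLp_comp_of_hasLaw hlaw hφ
  have hS : MemLp (fun ω => empMean fun i => φ (X i ω)) 2 P :=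
    (memLp_finsetSum _ fun i _ => hL i).const_mul (n : ℝ)⁻¹
  have hmean : ∀ i, ∫ ω, φ (X i ω) ∂P = ∫ x, φ x ∂ν := fun i =>
    (hlaw i).integral_comp hφm.aestronglyMeasurable
  have hE : ∫ ω, (empMean fun i => φ (X i ω)) ∂P = ∫ x, φ x ∂ν := by
    unfold empMean
    rw [integral_smul, integral_finsetSum _ fun i _ => (hL i).integrable one_le_two]
    simp only [hmean, Finset.sum_const, Finset.card_univ, Fintype.card_fin, smul_eq_mul,
      nsmul_eq_mul]
    rw [← mul_assoc, inv_mul_cancel₀ hn'.ne', one_mul]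
  refine ⟨(hS.sub (memLp_const _)).integrable_sq, ?_⟩
  have hvar : Var[fun ω => empMean fun i => φ (X i ω); P] ≤ (∫ x, φ x ^ 2 ∂ν) / n := by
    have h1 : (fun ω => empMean fun i => φ (X i ω))
        = fun ω => (n : ℝ)⁻¹ * (∑ i, fun ω => φ (X i ω)) ω := by
      ext ω; simp [empMean]
    rw [h1, variance_const_mul, IndepFun.variance_sum (fun i _ => hL i) fun i _ j _ hij =>
      (hindep.indepFun hij).comp hφm hφm]
    have h2 : ∀ i, Var[fun ω => φ (X i ω); P] ≤ ∫ x, φ x ^ 2 ∂ν := fun i => by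
      refine (variance_le_expectation_sq (hL i).aestronglyMeasurable).trans_eq ?_
      exact (hlaw i).integral_comp (f := fun x => φ x ^ 2) (hφm.pow_const 2).aestronglyMeasurable
    calc _ ≤ (n : ℝ)⁻¹ ^ 2 * ∑ i : Fin n, ∫ x, φ x ^ 2 ∂ν := by gcongr; exact h2 _
      _ = _ := by
        simp only [Finset.sum_const, Finset.card_univ, Fintype.card_fin, nsmul_eq_mul]
        field_simp
  rwa [variance_eq_integral hS.aemeasurable, hE] at hvar

/-- Chebyshev's inequality for a finite family of sample means. -/
lemma measureReal_sum_sq_dev_le (hn : 0 < n) (hlaw : ∀ i, HasLaw (X i) ν P)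
    (hindep : iIndepFun X P) {κ : Type*} [Fintype κ] {φ : κ → 𝒳 → ℝ}
    (hφm : ∀ k, Measurable (φ k)) (hφ : ∀ k, MemLp (φ k) 2 ν) {B : ℝ}
    (hB : ∀ k, ∫ x, φ k x ^ 2 ∂ν ≤ B) {t : ℝ} (ht : 0 < t) :
    P.real {ω | t ≤ ∑ k, ((empMean fun i => φ k (X i ω)) - ∫ x, φ k x ∂ν) ^ 2}
      ≤ Fintype.card κ * B / (n * t) := by
  have hn' : (0 : ℝ) < n := by positivity
  have h := fun k => integral_sq_empMean_sub_le hn hlaw hindep (hφm k) (hφ k)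
  have h1 := mul_meas_ge_le_integral_of_nonneg (μ := P)
    (f := fun ω => ∑ k, ((empMean fun i => φ k (X i ω)) - ∫ x, φ k x ∂ν) ^ 2)
    (ae_of_all _ fun ω => Finset.sum_nonneg fun k _ => sq_nonneg _)
    (integrable_finsetSum _ fun k _ => (h k).1) t
  have h2 : ∫ ω, ∑ k, ((empMean fun i => φ k (X i ω)) - ∫ x, φ k x ∂ν) ^ 2 ∂P
      ≤ Fintype.card κ * (B / n) := by
    rw [integral_finsetSum _ fun k _ => (h k).1]
    refine (Finset.sum_le_sum fun k _ => (h k).2.trans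
      (div_le_div_of_nonneg_right (hB k) hn'.le)).trans_eq ?_
    simp
  rw [le_div_iff₀ (by positivity)]
  calc _ = n * (t * P.real {ω | t ≤ ∑ k, ((empMean fun i => φ k (X i ω)) - ∫ x, φ k x ∂ν) ^ 2})
        := by ring
    _ ≤ n * (Fintype.card κ * (B / n)) := mul_le_mul_of_nonneg_left (h1.trans h2) hn'.le
    _ = _ := by field_simp

/-! ### A self-normalised exponential inequality -/

variable [IsProbabilityMeasure ν]

/-- The ratio of the right side to the left has derivative of the sign of x, because 1 + x/2 + x²/2
> 0; hence its minimum is its value 1 at 0. The bound holds on the whole line, so no boundedness is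
needed below. -/
lemma exp_sub_half_sq_le (x : ℝ) : Real.exp (x - x ^ 2 / 2) ≤ 1 + x + x ^ 2 / 2 := by
  let f : ℝ → ℝ := fun x => (1 + x + x ^ 2 / 2) * Real.exp (-(x - x ^ 2 / 2))
  have hf : ∀ x, HasDerivAt f (x * (1 + x / 2 + x ^ 2 / 2) * Real.exp (-(x - x ^ 2 / 2))) x := by
    intro x
    have h2 : HasDerivAt (fun x : ℝ => x ^ 2 / 2) x x := by
      simpa using (hasDerivAt_pow 2 x).div_const 2
    have h1 : HasDerivAt (fun x : ℝ => 1 + x + x ^ 2 / 2) (1 + x) x :=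
      ((hasDerivAt_id x).const_add 1).add h2
    have h3 := ((hasDerivAt_id x).sub h2).neg.exp
    refine (h1.mul h3).congr_deriv ?_
    simp only [id, Pi.sub_apply, Pi.neg_apply]
    ring
  have hq : ∀ x : ℝ, 0 < 1 + x / 2 + x ^ 2 / 2 := fun x => by nlinarith [sq_nonneg (x + 1 / 2)]
  have h0 : f 0 = 1 := by simp [f]
  have key : 1 ≤ f x := by
    rcases le_total 0 x with hx | hx
    · have : MonotoneOn f (Set.Ici 0) := by
        refine monotoneOn_of_deriv_nonneg (convex_Ici 0)
          (fun x _ => (hf x).continuousAt.continuousWithinAt)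
          (fun x _ => (hf x).differentiableAt.differentiableWithinAt) fun y hy => ?_
        rw [interior_Ici, Set.mem_Ioi] at hy
        rw [(hf y).deriv]
        have := hq y
        positivity
      rw [← h0]; exact this Set.self_mem_Ici hx hx
    · have : AntitoneOn f (Set.Iic 0) := by
        refine antitoneOn_of_deriv_nonpos (convex_Iic 0)
          (fun x _ => (hf x).continuousAt.continuousWithinAt)
          (fun x _ => (hf x).differentiableAt.differentiableWithinAt) fun y hy => ?_
        rw [interior_Iic, Set.mem_Iio] at hy
        rw [(hf y).deriv]
        exact mul_nonpos_of_nonpos_of_nonneg (mul_nonpos_of_nonpos_of_nonneg hy.le (hq y).le)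
          (Real.exp_pos _).le
      rw [← h0]; exact this hx Set.self_mem_Iic hx
  simp only [f] at key
  rw [Real.exp_neg, ← div_eq_mul_inv, one_le_div (Real.exp_pos _)] at key
  exact key

/-- Subtracting half the square inside the exponential makes it integrable under a second moment
alone; the linear term integrates to 0 and 1 + y ≤ exp y finishes. -/
lemma integral_exp_sub_half_sq_le {φ : 𝒳 → ℝ} (hφ : MemLp φ 2 ν)
    (h0 : ∫ x, φ x ∂ν = 0) (l : ℝ) :
    Integrable (fun x => Real.exp (l * φ x - l ^ 2 * φ x ^ 2 / 2)) ν ∧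
    ∫ x, Real.exp (l * φ x - l ^ 2 * φ x ^ 2 / 2) ∂ν
      ≤ Real.exp (l ^ 2 * (∫ x, φ x ^ 2 ∂ν) / 2) := by
  have hint : Integrable (fun x => 1 + l * φ x + l ^ 2 / 2 * φ x ^ 2) ν :=
    ((integrable_const 1).add ((hφ.integrable one_le_two).const_mul l)).add
      (hφ.integrable_sq.const_mul _)
  have hle : ∀ x, Real.exp (l * φ x - l ^ 2 * φ x ^ 2 / 2)
      ≤ 1 + l * φ x + l ^ 2 / 2 * φ x ^ 2 := fun x => by
    have := exp_sub_half_sq_le (l * φ x)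
    rw [mul_pow] at this
    linarith
  have hint' : Integrable (fun x => Real.exp (l * φ x - l ^ 2 * φ x ^ 2 / 2)) ν := by
    refine hint.mono' ?_ (ae_of_all _ fun x => ?_)
    · have := hφ.aestronglyMeasurable.aemeasurable
      exact (Real.measurable_exp.comp_aemeasurable ((this.const_mul l).sub
        (((this.pow_const 2).const_mul (l ^ 2)).div_const 2))).aestronglyMeasurable
    · rw [Real.norm_of_nonneg (Real.exp_pos _).le]; exact hle x
  refine ⟨hint', (integral_mono hint' hint hle).trans ?_⟩
  have hint1 : Integrable (fun x => 1 + l * φ x) ν :=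
    (integrable_const 1).add ((hφ.integrable one_le_two).const_mul l)
  rw [integral_add hint1 (hφ.integrable_sq.const_mul _), integral_add (integrable_const 1)
    ((hφ.integrable one_le_two).const_mul l), integral_const_mul, integral_const_mul, h0]
  simp only [integral_const, probReal_univ, smul_eq_mul, mul_one, mul_zero, add_zero]
  calc _ = l ^ 2 * (∫ x, φ x ^ 2 ∂ν) / 2 + 1 := by ring
    _ ≤ _ := Real.add_one_le_exp _

/-- Markov's inequality for the product of the compensated exponentials. On the event considered,
the empirical compensator is at most l²(B - nσ²)/2, and the expectation contributes nl²σ²/2, so σ²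
cancels. -/
lemma measureReal_sum_ge_le (hlaw : ∀ i, HasLaw (X i) ν P)
    (hindep : iIndepFun X P) {φ : 𝒳 → ℝ} (hφm : Measurable φ) (hφ : MemLp φ 2 ν)
    (h0 : ∫ x, φ x ∂ν = 0) {s B : ℝ} (hB : 0 < B) (hs : 0 ≤ s) :
    P.real {ω | s ≤ ∑ i, φ (X i ω) ∧ ∑ i, φ (X i ω) ^ 2 + n * ∫ x, φ x ^ 2 ∂ν ≤ B}
      ≤ Real.exp (-(s ^ 2 / (2 * B))) := by
  set σ2 := ∫ x, φ x ^ 2 ∂ν with hσ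
  -- The minimiser of -l s + l² B / 2.
  set l := s / B with hl
  have hl0 : 0 ≤ l := by positivity
  let w : 𝒳 → ℝ := fun x => Real.exp (l * φ x - l ^ 2 * φ x ^ 2 / 2)
  have hwm : Measurable w := Real.measurable_exp.comp
    ((hφm.const_mul l).sub (((hφm.pow_const 2).const_mul (l ^ 2)).div_const 2))
  obtain ⟨hwi, hwle⟩ := integral_exp_sub_half_sq_le hφ h0 l
  have hWi : ∀ i, Integrable (fun ω => w (X i ω)) P := fun i => by
    have := memLp_comp_of_hasLaw hlaw (memLp_one_iff_integrable.2 hwi) i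
    exact memLp_one_iff_integrable.1 this
  have hprod : ∫ ω, ∏ i, w (X i ω) ∂P = (∫ x, w x ∂ν) ^ n := by
    rw [hindep.integral_fun_prod_comp (f := fun _ => w) (fun i => (hlaw i).aemeasurable)
      fun i => hwm.aestronglyMeasurable]
    have : ∀ i, ∫ ω, w (X i ω) ∂P = ∫ x, w x ∂ν := fun i =>
      (hlaw i).integral_comp hwm.aestronglyMeasurable
    simp [this]
  have hindw : iIndepFun (fun i ω => w (X i ω)) P := hindep.comp (fun _ => w) fun _ => hwm
  -- A non-integrable product would have integral 0 by convention, whereas independence gives a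
  -- power of a positive number.
  have hprod_int : Integrable (fun ω => ∏ i, w (X i ω)) P := by
    by_contra hcon
    have h1 := integral_undef hcon
    rw [hprod] at h1
    have h2 : 0 < ∫ x, w x ∂ν := integral_exp_pos hwi
    exact (pow_pos h2 n).ne' h1
  have hset : {ω | s ≤ ∑ i, φ (X i ω) ∧ ∑ i, φ (X i ω) ^ 2 + n * σ2 ≤ B}
      ⊆ {ω | Real.exp (l * s - l ^ 2 * (B - n * σ2) / 2) ≤ ∏ i, w (X i ω)} := by
    rintro ω ⟨h1, h2⟩
    simp only [Set.mem_ofPred_eq, w]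
    rw [← Real.exp_sum, Real.exp_le_exp, Finset.sum_sub_distrib, ← Finset.mul_sum,
      ← Finset.sum_div, ← Finset.mul_sum]
    have h3 : ∑ i, φ (X i ω) ^ 2 ≤ B - n * σ2 := by linarith
    gcongr
  have hmk := mul_meas_ge_le_integral_of_nonneg (μ := P) (f := fun ω => ∏ i, w (X i ω))
    (ae_of_all _ fun ω => Finset.prod_nonneg fun i _ => (Real.exp_pos _).le) hprod_int
    (Real.exp (l * s - l ^ 2 * (B - n * σ2) / 2))
  rw [hprod] at hmk
  have hpow : (∫ x, w x ∂ν) ^ n ≤ Real.exp (n * (l ^ 2 * σ2 / 2)) := by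
    rw [Real.exp_nat_mul]
    exact pow_le_pow_left₀ (integral_nonneg fun x => (Real.exp_pos _).le) hwle n
  refine (measureReal_mono hset).trans ?_
  have h4 := hmk.trans hpow
  rw [← le_div_iff₀' (Real.exp_pos _), ← Real.exp_sub] at h4
  refine h4.trans_eq ?_
  congr 1
  rw [hl]
  field_simp
  ring

/-- A self-normalised deviation inequality for sample means: no tail assumption on `φ` beyond a
second moment is needed once the empirical second moment is controlled. -/
lemma measureReal_abs_empMean_sub_ge_le (hn : 0 < n) (hlaw : ∀ i, HasLaw (X i) ν P)
    (hindep : iIndepFun X P) {φ : 𝒳 → ℝ} (hφm : Measurable φ) (hφ : MemLp φ 2 ν)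
    {A A' τ : ℝ} (hA : 0 < A) (hA' : ∫ x, φ x ^ 2 ∂ν ≤ A') (hτ : 0 ≤ τ) :
    P.real {ω | τ ≤ |(empMean fun i => φ (X i ω)) - ∫ x, φ x ∂ν| ∧
        (empMean fun i => φ (X i ω) ^ 2) ≤ A}
      ≤ 2 * Real.exp (-(n * τ ^ 2 / (2 * (2 * A + 3 * A')))) := by
  have hn' : (0 : ℝ) < n := by positivity
  set m := ∫ x, φ x ∂ν with hm
  have hA0 : 0 ≤ A' := (integral_nonneg fun x => sq_nonneg _).trans hA'
  have hmsq : m ^ 2 ≤ A' := by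
    have h1 := variance_nonneg φ ν
    rw [variance_eq_sub hφ] at h1
    simp only [Pi.pow_apply] at h1
    linarith
  -- After centring, the sample squares average at most 2A + 2A', and the population variance adds
  -- A'.
  set B := n * (2 * A + 3 * A') with hB
  have hB0 : 0 < B := by positivity
  have key : ∀ ε : ℝ, ε ^ 2 = 1 →
      P.real {ω | n * τ ≤ ∑ i, ε * (φ (X i ω) - m) ∧ (empMean fun i => φ (X i ω) ^ 2) ≤ A}
        ≤ Real.exp (-((n * τ) ^ 2 / (2 * B))) := by
    intro ε hε
    have hψ : MemLp (fun x => ε * (φ x - m)) 2 ν := (hφ.sub (memLp_const m)).const_mul ε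
    have hψ0 : ∫ x, ε * (φ x - m) ∂ν = 0 := by
      rw [integral_const_mul, integral_sub (hφ.integrable one_le_two) (integrable_const m)]
      simp [hm]
    have hsq : ∫ x, (ε * (φ x - m)) ^ 2 ∂ν ≤ A' := by
      simp only [mul_pow, hε, one_mul]
      rw [← variance_eq_integral hφm.aemeasurable]
      exact (variance_le_expectation_sq hφ.aestronglyMeasurable).trans hA'
    refine (measureReal_mono ?_).trans (measureReal_sum_ge_le hlaw hindep
      ((hφm.sub_const m).const_mul ε) hψ hψ0 hB0 (by positivity))
    rintro ω ⟨h1, h2⟩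
    refine ⟨h1, ?_⟩
    simp only [mul_pow, hε, one_mul]
    have h3 : ∑ i, (φ (X i ω) - m) ^ 2 ≤ n * (2 * A + 2 * A') := by
      rw [sum_eq_mul_empMean hn]
      gcongr
      calc _ ≤ empMean (fun i => 2 * φ (X i ω) ^ 2 + 2 * m ^ 2) := empMean_mono fun i => by
            nlinarith [sq_nonneg (φ (X i ω) + m)]
        _ ≤ _ := by
            rw [empMean_add, empMean_const hn, empMean_const_mul]; linarith
    have h4 : ∫ x, (φ x - m) ^ 2 ∂ν ≤ A' := by simpa only [mul_pow, hε, one_mul] using hsq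
    calc _ ≤ n * (2 * A + 2 * A') + n * A' := by gcongr
      _ = B := by rw [hB]; ring
  have hexp : (n * τ) ^ 2 / (2 * B) = n * τ ^ 2 / (2 * (2 * A + 3 * A')) := by
    rw [hB]
    field_simp
  have hsub : {ω | τ ≤ |(empMean fun i => φ (X i ω)) - m| ∧ (empMean fun i => φ (X i ω) ^ 2) ≤ A}
      ⊆ {ω | n * τ ≤ ∑ i, 1 * (φ (X i ω) - m) ∧ (empMean fun i => φ (X i ω) ^ 2) ≤ A} ∪
        {ω | n * τ ≤ ∑ i, -1 * (φ (X i ω) - m) ∧ (empMean fun i => φ (X i ω) ^ 2) ≤ A} := by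
    rintro ω ⟨h1, h2⟩
    have h3 : ∑ i, (φ (X i ω) - m) = n * ((empMean fun i => φ (X i ω)) - m) := by
      rw [sum_eq_mul_empMean hn, empMean_sub, empMean_const hn]
    simp only [Set.mem_union, Set.mem_ofPred_eq, ← Finset.mul_sum, h3]
    rcases le_abs.1 h1 with h | h
    · left; exact ⟨by rw [one_mul]; gcongr, h2⟩
    · right
      exact ⟨by rw [neg_one_mul, ← mul_neg]; gcongr, h2⟩
  calc _ ≤ _ := (measureReal_mono hsub).trans (measureReal_union_le _ _)
    _ ≤ _ := add_le_add (key 1 (by norm_num)) (key (-1) (by norm_num))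
    _ = _ := by rw [hexp]; ring

end Sample

/-! ### A central limit theorem for row-wise i.i.d. arrays -/

section CharFun

lemma norm_exp_I_sub_taylor_le (x : ℝ) :
    ‖Complex.exp (x * Complex.I) - (1 + x * Complex.I - x ^ 2 / 2)‖ ≤ 4 * |x| ^ 3 := by
  have hn : ‖(x * Complex.I : ℂ)‖ = |x| := by simp
  rcases le_total |x| 1 with hx | hx
  · have h := Complex.exp_bound (x := x * Complex.I) (by rwa [hn]) (n := 3) (by norm_num)
    rw [hn] at h
    have h1 : ∑ m ∈ Finset.range 3, (x * Complex.I : ℂ) ^ m / m.factorial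
        = 1 + x * Complex.I - x ^ 2 / 2 := by
      simp [Finset.sum_range_succ, mul_pow]
      ring
    rw [h1] at h
    refine h.trans ?_
    have := pow_nonneg (abs_nonneg x) 3
    norm_num [Nat.factorial]
    linarith
  · have h1 : ‖Complex.exp (x * Complex.I)‖ = 1 := Complex.norm_exp_ofReal_mul_I x
    have h2 : ‖(x : ℂ) ^ 2 / 2‖ = |x| ^ 2 / 2 := by simp
    calc _ ≤ ‖Complex.exp (x * Complex.I)‖ + ((‖(1 : ℂ)‖ + ‖(x * Complex.I : ℂ)‖)
          + ‖(x : ℂ) ^ 2 / 2‖) := (norm_sub_le _ _).trans (add_le_add_right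
            ((norm_sub_le _ _).trans (add_le_add_left (norm_add_le _ _) _)) _)
      _ = 1 + (1 + |x| + |x| ^ 2 / 2) := by rw [h1, h2, hn, norm_one]
      _ ≤ _ := by
        have h3 : |x| ≤ |x| ^ 3 := le_self_pow₀ hx (by norm_num)
        have h4 : |x| ^ 2 ≤ |x| ^ 3 := pow_le_pow_right₀ hx (by norm_num)
        linarith

variable {𝒳 : Type*} [MeasurableSpace 𝒳] {ν : Measure 𝒳} [IsProbabilityMeasure ν]

/-- The third-order Taylor remainder is governed by the third absolute moment, which is at most the
square root of the fourth when the variance is 1. That form is what makes the Lyapunov ratio appear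
in the limit theorem. -/
lemma norm_charFun_sub_le {φ : 𝒳 → ℝ} (hm : Measurable φ) (hφ : MemLp φ 4 ν)
    (h0 : ∫ x, φ x ∂ν = 0) (h1 : ∫ x, φ x ^ 2 ∂ν = 1) (t : ℝ) :
    ‖charFun (ν.map φ) t - (1 - ((t ^ 2 / 2 : ℝ) : ℂ))‖ ≤ 4 * |t| ^ 3 * √(∫ x, φ x ^ 4 ∂ν) := by
  have hφ2 : MemLp φ 2 ν := hφ.mono_exponent (by norm_num)
  have hi1 := hφ2.integrable one_le_two
  have hi2 := hφ2.integrable_sq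
  have hi4 : Integrable (fun x => φ x ^ 4) ν := by
    have := hφ.integrable_norm_pow (by norm_num)
    refine this.congr (ae_of_all _ fun x => ?_)
    simp only [Real.norm_eq_abs]
    exact (show Even 4 by decide).pow_abs _
  set K := ∫ x, φ x ^ 4 ∂ν with hK
  -- Follows from the nonnegative integral of (φ² - 1)²; it allows division by √K below.
  have hK1 : 1 ≤ K := by
    have : 0 ≤ ∫ x, (φ x ^ 2 - 1) ^ 2 ∂ν := integral_nonneg fun x => sq_nonneg _
    have h2 : ∫ x, (φ x ^ 2 - 1) ^ 2 ∂ν = K - 1 := by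
      have : (fun x => (φ x ^ 2 - 1) ^ 2) = fun x => φ x ^ 4 - (2 * φ x ^ 2 - 1) := by
        ext x; ring
      have hi3 : Integrable (fun x => 2 * φ x ^ 2 - 1) ν :=
        (hi2.const_mul 2).sub (integrable_const 1)
      rw [this, integral_sub hi4 hi3,
        integral_sub (hi2.const_mul 2) (integrable_const 1), integral_const_mul, h1]
      simp only [integral_const, probReal_univ, smul_eq_mul, ← hK]; norm_num
    linarith
  have hc : 0 < √K := Real.sqrt_pos.2 (by linarith)
  -- The arithmetic–geometric mean inequality, with weights chosen so that both terms integrate to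
  -- √K / 2.
  have hb : ∀ x, |φ x| ^ 3 ≤ √K / 2 * φ x ^ 2 + (2 * √K)⁻¹ * φ x ^ 4 := fun x => by
    rw [← (show Even 4 by decide).pow_abs, ← sq_abs, inv_mul_eq_div, ← sub_nonneg]
    have : √K / 2 * |φ x| ^ 2 + |φ x| ^ 4 / (2 * √K) - |φ x| ^ 3
        = |φ x| ^ 2 * (√K - |φ x|) ^ 2 / (2 * √K) := by
      field_simp; ring
    rw [this]; positivity
  have hbi : Integrable (fun x => √K / 2 * φ x ^ 2 + (2 * √K)⁻¹ * φ x ^ 4) ν :=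
    (hi2.const_mul _).add (hi4.const_mul _)
  have hbv : ∫ x, (√K / 2 * φ x ^ 2 + (2 * √K)⁻¹ * φ x ^ 4) ∂ν = √K := by
    rw [integral_add (hi2.const_mul _) (hi4.const_mul _), integral_const_mul,
      integral_const_mul, h1, ← hK]
    nth_rw 3 [← Real.sq_sqrt (show 0 ≤ K by linarith)]
    field_simp
    ring
  have hexp : Integrable (fun x => Complex.exp ((t * φ x : ℝ) * Complex.I)) ν := by
    refine (integrable_const (1 : ℝ)).mono' (by fun_prop) (ae_of_all _ fun x => ?_)
    rw [Complex.norm_exp_ofReal_mul_I]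
  have hT : Integrable (fun x => (1 + (t * φ x : ℝ) * Complex.I - ((t * φ x : ℝ) : ℂ) ^ 2 / 2 : ℂ))
      ν := by
    have e1 : Integrable (fun x => ((t * φ x : ℝ) : ℂ)) ν := (hi1.const_mul t).ofReal
    have e2 : Integrable (fun x => ((t * φ x : ℝ) : ℂ) ^ 2) ν := by
      have : Integrable (fun x => (t * φ x) ^ 2) ν := by
        simp only [mul_pow]; exact hi2.const_mul _
      simpa using this.ofReal (𝕜 := ℂ)
    exact ((integrable_const (1 : ℂ)).add (e1.mul_const _)).sub (e2.div_const 2)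
  have hTv : ∫ x, (1 + (t * φ x : ℝ) * Complex.I - ((t * φ x : ℝ) : ℂ) ^ 2 / 2 : ℂ) ∂ν
      = 1 - ((t ^ 2 / 2 : ℝ) : ℂ) := by
    have e1 : Integrable (fun x => ((t * φ x : ℝ) : ℂ) * Complex.I) ν :=
      ((hi1.const_mul t).ofReal (𝕜 := ℂ)).mul_const _
    have e2 : Integrable (fun x => (((t * φ x) ^ 2 / 2 : ℝ) : ℂ)) ν := by
      have : Integrable (fun x => (t * φ x) ^ 2 / 2) ν := by
        simp only [mul_pow]; exact (hi2.const_mul _).div_const 2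
      exact this.ofReal
    have e3 : (fun x => (1 + (t * φ x : ℝ) * Complex.I - ((t * φ x : ℝ) : ℂ) ^ 2 / 2 : ℂ))
        = fun x => (1 + (t * φ x : ℝ) * Complex.I - (((t * φ x) ^ 2 / 2 : ℝ) : ℂ) : ℂ) := by
      ext x; push_cast; ring
    have e4 : Integrable (fun x => 1 + ((t * φ x : ℝ) : ℂ) * Complex.I) ν :=
      (integrable_const (1 : ℂ)).add e1
    rw [e3, integral_sub e4 e2, integral_add (integrable_const 1) e1, integral_mul_const,
      integral_complex_ofReal, integral_complex_ofReal, integral_const_mul, h0]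
    have e5 : ∫ x, (t * φ x) ^ 2 / 2 ∂ν = t ^ 2 / 2 := by
      simp only [mul_pow]
      rw [integral_div, integral_const_mul, h1, mul_one]
    rw [e5]
    simp
  rw [charFun_apply_real, integral_map hm.aemeasurable (by fun_prop), ← hTv]
  have : (fun x => Complex.exp (t * φ x * Complex.I))
      = fun x => Complex.exp ((t * φ x : ℝ) * Complex.I) := by ext x; push_cast; rfl
  rw [this, ← integral_sub hexp hT]
  calc _ ≤ ∫ x, 4 * |t| ^ 3 * (√K / 2 * φ x ^ 2 + (2 * √K)⁻¹ * φ x ^ 4) ∂ν := by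
        refine norm_integral_le_of_norm_le (hbi.const_mul _) (ae_of_all _ fun x => ?_)
        refine (norm_exp_I_sub_taylor_le _).trans ?_
        rw [abs_mul, mul_pow, ← mul_assoc]
        have := hb x
        gcongr
    _ = _ := by rw [integral_const_mul, hbv]

end CharFun

/-! ### Limits in distribution along a sequence of probability spaces -/

section Rows

variable {Ω : ℕ → Type*} [∀ n, MeasurableSpace (Ω n)] {P : ∀ n, Measure (Ω n)}
  [∀ n, IsProbabilityMeasure (P n)]

/-- At t/√n the row characteristic function is 1 - t²/(2n) up to 4|t|³ √(E φ⁴ / n) / n, which is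
o(1/n); its n-th power then tends to exp(-t²/2). -/
theorem tendstoInDistribution_of_rows {𝒳 : ℕ → Type*} [∀ n, MeasurableSpace (𝒳 n)]
    {ν : ∀ n, Measure (𝒳 n)} [∀ n, IsProbabilityMeasure (ν n)] {X : ∀ n, Fin n → Ω n → 𝒳 n}
    (hlaw : ∀ n i, HasLaw (X n i) (ν n) (P n)) (hindep : ∀ n, iIndepFun (X n) (P n))
    {φ : ∀ n, 𝒳 n → ℝ} (hm : ∀ n, Measurable (φ n))
    (hφ : ∀ᶠ n in atTop, MemLp (φ n) 4 (ν n) ∧ ∫ x, φ n x ∂(ν n) = 0 ∧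
      ∫ x, φ n x ^ 2 ∂(ν n) = 1)
    (hlyap : Tendsto (fun n => (∫ x, φ n x ^ 4 ∂(ν n)) / n) atTop (𝓝 0)) :
    TendstoInDistribution (fun (n : ℕ) ω => √(n : ℝ) * empMean fun i => φ n (X n i ω)) atTop
      (id : ℝ → ℝ) P (gaussianReal 0 1) where
  forall_aemeasurable n := (aemeasurable_empMean (hlaw n) (hm n)).const_mul _
  tendsto := by
    refine ProbabilityMeasure.tendsto_iff_tendsto_charFun.2 fun t => ?_
    have hlim : charFun ((gaussianReal 0 1).map id) t = Complex.exp (-(t ^ 2 / 2 : ℝ)) := by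
      rw [Measure.map_id, charFun_gaussianReal]
      congr 1
      push_cast
      simp
    change Tendsto (fun n => charFun ((P n).map _) t) atTop (𝓝 (charFun ((gaussianReal 0 1).map id) t))
    rw [hlim]
    have hcf : ∀ n, charFun ((P n).map fun ω => √(n : ℝ) * empMean fun i => φ n (X n i ω)) t
        = charFun ((ν n).map (φ n)) (√(n : ℝ) * (n : ℝ)⁻¹ * t) ^ n := fun n => by
      have h1 : (fun ω => √(n : ℝ) * empMean fun i => φ n (X n i ω))
          = fun ω => (√(n : ℝ) * (n : ℝ)⁻¹) * ∑ i, φ n (X n i ω) := by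
        ext ω; simp only [empMean, smul_eq_mul]; ring
      have h2 : iIndepFun (fun i ω => φ n (X n i ω)) (P n) :=
        (hindep n).comp (fun _ => φ n) fun _ => hm n
      have h3 := fun i => hasLaw_comp_real (hlaw n) (hm n) i
      rw [h1, charFun_map_mul_comp (Finset.aemeasurable_fun_sum _ fun i _ => (h3 i).aemeasurable),
        h2.charFun_map_fun_sum_eq_prod fun i => (h3 i).aemeasurable]
      simp only [fun i => (h3 i).map_eq, Finset.prod_const, Finset.card_univ, Fintype.card_fin,
        Pi.pow_apply]
    simp_rw [hcf]
    apply Complex.tendsto_pow_exp_of_isLittleO_sub_add_div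
    rw [Asymptotics.isLittleO_iff]
    intro c hc
    have hlyap' : Tendsto (fun n : ℕ => 4 * |t| ^ 3 * √((∫ x, φ n x ^ 4 ∂(ν n)) / n)) atTop
        (𝓝 0) := by
      have := (Real.continuous_sqrt.tendsto 0).comp hlyap
      simpa using this.const_mul (4 * |t| ^ 3)
    filter_upwards [hφ, hlyap'.eventually (gt_mem_nhds hc), eventually_gt_atTop 0] with n hn hcn hn0
    obtain ⟨hL, h0, h1⟩ := hn
    have hn' : (0 : ℝ) < n := by positivity
    have hsq : √(n : ℝ) * (n : ℝ)⁻¹ = (√(n : ℝ))⁻¹ := by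
      nth_rw 2 [← Real.mul_self_sqrt hn'.le]
      field_simp
    have h := norm_charFun_sub_le (hm n) hL h0 h1 (√(n : ℝ) * (n : ℝ)⁻¹ * t)
    rw [hsq] at h ⊢
    have e1 : (((√(n : ℝ))⁻¹ * t) ^ 2 / 2 : ℝ) = (t ^ 2 / 2) / n := by
      rw [mul_pow, inv_pow, Real.sq_sqrt hn'.le]; field_simp
    rw [e1] at h
    have e2 : (1 : ℂ) + -(t ^ 2 / 2 : ℝ) / n = 1 - ((t ^ 2 / 2) / n : ℝ) := by
      push_cast; ring
    rw [e2]
    refine h.trans ?_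
    have e3 : ‖(1 : ℂ) / n‖ = 1 / n := by simp
    rw [e3]
    have e4 : 4 * |(√(n : ℝ))⁻¹ * t| ^ 3 * √(∫ x, φ n x ^ 4 ∂(ν n))
        = 4 * |t| ^ 3 * √((∫ x, φ n x ^ 4 ∂(ν n)) / n) * (1 / n) := by
      rw [abs_mul, mul_pow, abs_inv, abs_of_nonneg (Real.sqrt_nonneg _),
        Real.sqrt_div' _ hn'.le]
      have : (√(n : ℝ)) ^ 3 = √(n : ℝ) * n := by
        rw [pow_succ, Real.sq_sqrt hn'.le, mul_comm]
      rw [inv_pow, this]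
      have : 0 < √(n : ℝ) := Real.sqrt_pos.2 hn'
      field_simp
    rw [e4]
    gcongr

/-- Slutsky's theorem when the probability space varies with the index. -/
theorem tendstoInDistribution_of_sub {Y Z : ∀ n, Ω n → ℝ} {μ : Measure ℝ}
    [IsProbabilityMeasure μ] (hY : TendstoInDistribution Y atTop (id : ℝ → ℝ) P μ)
    (hZ : ∀ n, AEMeasurable (Z n) (P n))
    (hsub : ∀ ε > 0, Tendsto (fun n => (P n).real {ω | ε < |Z n ω - Y n ω|}) atTop (𝓝 0)) :
    TendstoInDistribution Z atTop (id : ℝ → ℝ) P μ where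
  forall_aemeasurable := hZ
  tendsto := by
    have hYm := hY.forall_aemeasurable
    refine ProbabilityMeasure.tendsto_iff_tendsto_charFun.2 fun t => ?_
    have hYt := ProbabilityMeasure.tendsto_iff_tendsto_charFun.1 hY.tendsto t
    change Tendsto (fun n => charFun ((P n).map _) t) atTop _ at hYt
    change Tendsto (fun n => charFun ((P n).map _) t) atTop _
    refine (tendsto_iff_of_dist ?_).1 hYt
    rw [Metric.tendsto_atTop]
    intro ε hε
    -- The complex exponentials differ by at most |t| η off the exceptional event, which is at most
    -- ε/4, and by at most 2 on it.
    set η := ε / (4 * (|t| + 1)) with hη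
    have hη0 : 0 < η := by positivity
    obtain ⟨N, hN⟩ := Metric.tendsto_atTop.1 (hsub η hη0) (ε / 8) (by positivity)
    refine ⟨N, fun n hn => ?_⟩
    have hp : (P n).real {ω | η < |Z n ω - Y n ω|} < ε / 8 := by
      have := hN n hn
      rwa [Real.dist_eq, sub_zero, abs_of_nonneg measureReal_nonneg] at this
    have hint : ∀ W : Ω n → ℝ, AEMeasurable W (P n) →
        Integrable (fun ω => Complex.exp ((t * W ω : ℝ) * Complex.I)) (P n) := fun W hW => by
      refine (integrable_const (1 : ℝ)).mono' (by fun_prop) (ae_of_all _ fun x => ?_)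
      rw [Complex.norm_exp_ofReal_mul_I]
    have hcf : ∀ W : Ω n → ℝ, AEMeasurable W (P n) → charFun ((P n).map W) t
        = ∫ ω, Complex.exp ((t * W ω : ℝ) * Complex.I) ∂(P n) := fun W hW => by
      rw [charFun_apply_real, integral_map hW (by fun_prop)]
      congr 1
      ext ω
      push_cast
      rfl
    have hms : NullMeasurableSet {ω | η < |Z n ω - Y n ω|} (P n) :=
      nullMeasurableSet_lt aemeasurable_const ((hZ n).sub (hYm n)).abs
    set T := {ω | η < |Z n ω - Y n ω|} with hT
    have hbd : ∀ ω, ‖Complex.exp ((t * Y n ω : ℝ) * Complex.I)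
        - Complex.exp ((t * Z n ω : ℝ) * Complex.I)‖
        ≤ |t| * η + T.indicator (fun _ => 2) ω := fun ω => by
      by_cases hω : ω ∈ T
      · rw [Set.indicator_of_mem hω]
        refine (norm_sub_le _ _).trans ?_
        rw [Complex.norm_exp_ofReal_mul_I, Complex.norm_exp_ofReal_mul_I]
        nlinarith [mul_nonneg (abs_nonneg t) hη0.le]
      · rw [Set.indicator_of_notMem hω, add_zero]
        have h1 := Real.norm_exp_I_mul_ofReal_sub_one_le (x := t * Y n ω - t * Z n ω)
        have h2 : Complex.exp ((t * Y n ω : ℝ) * Complex.I)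
            - Complex.exp ((t * Z n ω : ℝ) * Complex.I)
            = Complex.exp ((t * Z n ω : ℝ) * Complex.I)
              * (Complex.exp (Complex.I * (t * Y n ω - t * Z n ω : ℝ)) - 1) := by
          rw [mul_sub, ← Complex.exp_add, mul_one]
          congr 2
          push_cast; ring
        rw [h2, norm_mul, Complex.norm_exp_ofReal_mul_I, one_mul]
        refine h1.trans ?_
        rw [← mul_sub, Real.norm_eq_abs, abs_mul, abs_sub_comm]
        gcongr
        exact not_lt.1 hω
    rw [Real.dist_eq, sub_zero, abs_of_nonneg dist_nonneg, dist_eq_norm, hcf _ (hYm n),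
      hcf _ (hZ n), ← integral_sub (hint _ (hYm n)) (hint _ (hZ n))]
    have hi : Integrable (T.indicator fun _ => (2 : ℝ)) (P n) :=
      (integrable_const _).indicator₀ hms
    calc _ ≤ ∫ ω, (|t| * η + T.indicator (fun _ => (2 : ℝ)) ω) ∂(P n) :=
          norm_integral_le_of_norm_le ((integrable_const _).add hi) (ae_of_all _ hbd)
      _ = |t| * η + (P n).real T * 2 := by
          rw [integral_add (integrable_const _) hi, integral_indicator₀ hms, setIntegral_const]
          simp
      _ < ε := by
          have : |t| * η ≤ ε / 4 := by
            rw [hη, mul_div_assoc', div_le_div_iff₀ (by positivity) (by norm_num)]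
            nlinarith
          linarith

end Rows

/-! ### Extreme eigenvalues and powers of symmetric matrices -/

section Matrices

variable {ι : Type} [Fintype ι] [DecidableEq ι] {M : Matrix ι ι ℝ}

lemma forall_spectrum_nonneg_iff (hM : M.IsHermitian) :
    (∀ x ∈ spectrum ℝ M, 0 ≤ x) ↔ ∀ u : ι → ℝ, 0 ≤ u ⬝ᵥ (M *ᵥ u) := by
  have h1 : (∀ x ∈ spectrum ℝ M, 0 ≤ x) ↔ M.PosSemidef := by
    rw [hM.posSemidef_iff_eigenvalues_nonneg, hM.spectrum_real_eq_range_eigenvalues,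
      Set.forall_mem_range]
    rfl
  rw [h1, Matrix.posSemidef_iff_dotProduct_mulVec]
  simp only [star_trivial, hM, true_and]

lemma isHermitian_sub_smul_one (hM : M.IsHermitian) (c : ℝ) :
    (M - algebraMap ℝ (Matrix ι ι ℝ) c).IsHermitian := by
  refine hM.sub ?_
  rw [Algebra.algebraMap_eq_smul_one]
  exact Matrix.isHermitian_one.smul (IsSelfAdjoint.all c)

-- Subtracting c shifts the spectrum by c, so the bound says that M - c is positive semidefinite.
-- Nonemptiness matters because the infimum of the empty set is 0.
open scoped Pointwise in
lemma le_lamMin_iff [Nonempty ι] (hM : M.IsHermitian) (c : ℝ) :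
    c ≤ lamMin M ↔ ∀ u : ι → ℝ, c * (u ⬝ᵥ u) ≤ u ⬝ᵥ (M *ᵥ u) := by
  have hne : (spectrum ℝ M).Nonempty := by
    rw [hM.spectrum_real_eq_range_eigenvalues]; exact Set.range_nonempty _
  rw [lamMin, le_csInf_iff M.finite_real_spectrum.bddBelow hne]
  have h := forall_spectrum_nonneg_iff (isHermitian_sub_smul_one hM c)
  rw [← spectrum.sub_singleton_eq] at h
  have h2 : (∀ b ∈ spectrum ℝ M, c ≤ b) ↔ ∀ x ∈ spectrum ℝ M - ({c} : Set ℝ), 0 ≤ x := by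
    simp [Set.sub_singleton]
  rw [h2, h]
  refine forall_congr' fun u => ?_
  rw [Algebra.algebraMap_eq_smul_one, Matrix.sub_mulVec, dotProduct_sub, Matrix.smul_mulVec,
    Matrix.one_mulVec, dotProduct_smul, smul_eq_mul, sub_nonneg]

open scoped Pointwise in
lemma lamMax_le_iff [Nonempty ι] (hM : M.IsHermitian) (c : ℝ) :
    lamMax M ≤ c ↔ ∀ u : ι → ℝ, u ⬝ᵥ (M *ᵥ u) ≤ c * (u ⬝ᵥ u) := by
  have hne : (spectrum ℝ M).Nonempty := by
    rw [hM.spectrum_real_eq_range_eigenvalues]; exact Set.range_nonempty _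
  rw [lamMax, csSup_le_iff M.finite_real_spectrum.bddAbove hne]
  have h := forall_spectrum_nonneg_iff (isHermitian_sub_smul_one hM c).neg
  rw [neg_sub, ← spectrum.singleton_sub_eq] at h
  have h2 : (∀ b ∈ spectrum ℝ M, b ≤ c) ↔ ∀ x ∈ ({c} : Set ℝ) - spectrum ℝ M, 0 ≤ x := by
    simp [Set.singleton_sub]
  rw [h2, h]
  refine forall_congr' fun u => ?_
  rw [Algebra.algebraMap_eq_smul_one, Matrix.sub_mulVec, dotProduct_sub, Matrix.smul_mulVec,
    Matrix.one_mulVec, dotProduct_smul, smul_eq_mul, sub_nonneg]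

lemma symPow_transpose (M : Matrix ι ι ℝ) (a : ℝ) : (symPow M a)ᵀ = symPow M a := by
  have h : IsSelfAdjoint (symPow M a) := cfc_predicate _ M
  rw [← Matrix.conjTranspose_eq_transpose_of_trivial]
  exact h

/-- The spectrum is finite, so every power function is continuous on it, negative powers included;
positivity of the eigenvalues supplies the exponent law. -/
lemma symPow_mul_symPow (hM : M.PosDef) (a b : ℝ) :
    symPow M a * symPow M b = symPow M (a + b) := by
  have hc : ∀ f : ℝ → ℝ, ContinuousOn f (spectrum ℝ M) := fun f =>
    M.finite_real_spectrum.continuousOn f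
  rw [symPow, symPow, symPow, ← cfc_mul _ _ M (hc _) (hc _)]
  refine cfc_congr fun x hx => ?_
  rw [hM.isHermitian.spectrum_real_eq_range_eigenvalues] at hx
  obtain ⟨i, rfl⟩ := hx
  exact (Real.rpow_add (hM.eigenvalues_pos i) a b).symm

lemma symPow_one (hM : M.IsHermitian) : symPow M 1 = M := by
  simp only [symPow, Real.rpow_one]
  exact cfc_id' ℝ M hM

lemma symPow_zero (hM : M.IsHermitian) : symPow M 0 = 1 := by
  simp only [symPow, Real.rpow_zero]
  exact cfc_const_one ℝ M hM

lemma symPow_neg_one (hM : M.PosDef) : symPow M (-1) = M⁻¹ := by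
  symm
  apply Matrix.inv_eq_left_inv
  nth_rw 2 [← symPow_one hM.isHermitian]
  rw [symPow_mul_symPow hM, neg_add_cancel, symPow_zero hM.isHermitian]

end Matrices

/-! ### Vectors and matrices in coordinates -/

section Coordinates

variable {ι κ : Type}

lemma ofLp_empMean {n : ℕ} (f : Fin n → EuclideanSpace ℝ ι) (j : ι) :
    (empMean f) j = empMean fun i => f i j := by
  simp [empMean]

lemma vecSup_nonneg (v : ι → ℝ) : 0 ≤ vecSup v := Real.iSup_nonneg fun _ => abs_nonneg _

lemma vecSup_le [Nonempty ι] {v : ι → ℝ} {B : ℝ} (h : ∀ i, |v i| ≤ B) : vecSup v ≤ B := ciSup_le h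

lemma entrySup_nonneg (A : Matrix ι κ ℝ) : 0 ≤ entrySup A :=
  Real.iSup_nonneg fun _ => Real.iSup_nonneg fun _ => abs_nonneg _

variable [Fintype ι] [Fintype κ]

/-- A matrix as a continuous linear map between Euclidean spaces. -/
def matCLM (A : Matrix ι κ ℝ) : EuclideanSpace ℝ κ →L[ℝ] EuclideanSpace ℝ ι :=
  ((WithLp.linearEquiv 2 ℝ (ι → ℝ)).symm.toLinearMap ∘ₗ A.mulVecLin ∘ₗ
    (WithLp.linearEquiv 2 ℝ (κ → ℝ)).toLinearMap).toContinuousLinearMap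

@[simp]
lemma ofLp_matCLM (A : Matrix ι κ ℝ) (v : EuclideanSpace ℝ κ) :
    (matCLM A v).ofLp = A *ᵥ v.ofLp := by
  simp [matCLM]

lemma matCLM_apply (A : Matrix ι κ ℝ) (v : EuclideanSpace ℝ κ) (i : ι) :
    matCLM A v i = ∑ k, A i k * v k := by
  rw [ofLp_matCLM]; rfl

lemma inner_eq_dotProduct (u v : EuclideanSpace ℝ ι) : ⟪u, v⟫ = u.ofLp ⬝ᵥ v.ofLp := by
  simp [PiLp.inner_apply, dotProduct, mul_comm]

lemma sq_norm_eq_dotProduct (u : EuclideanSpace ℝ ι) : ‖u‖ ^ 2 = u.ofLp ⬝ᵥ u.ofLp := by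
  rw [← inner_eq_dotProduct, real_inner_self_eq_norm_sq]

/-- Bounds the operator norm by the Frobenius norm, so that entrywise moment estimates suffice for
all random matrices. -/
lemma sq_norm_le_of_rows {u : EuclideanSpace ℝ ι} {v : EuclideanSpace ℝ κ} {A : ι → κ → ℝ}
    (hu : ∀ i, u i = ∑ k, A i k * v k) : ‖u‖ ^ 2 ≤ (∑ i, ∑ k, A i k ^ 2) * ‖v‖ ^ 2 := by
  rw [EuclideanSpace.real_norm_sq_eq, EuclideanSpace.real_norm_sq_eq, Finset.sum_mul]
  refine Finset.sum_le_sum fun i _ => ?_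
  rw [hu]
  exact Finset.sum_mul_sq_le_sq_mul_sq _ _ _

lemma norm_le_of_rows {u : EuclideanSpace ℝ ι} {v : EuclideanSpace ℝ κ} {A : ι → κ → ℝ} {B : ℝ}
    (hB : 0 ≤ B) (hu : ∀ i, u i = ∑ k, A i k * v k) (hA : ∑ i, ∑ k, A i k ^ 2 ≤ B ^ 2) :
    ‖u‖ ≤ B * ‖v‖ := by
  apply le_of_sq_le_sq _ (by positivity)
  refine (sq_norm_le_of_rows hu).trans ?_
  rw [mul_pow]
  gcongr

lemma le_vecSup (v : ι → ℝ) (i : ι) : |v i| ≤ vecSup v :=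
  le_ciSup (f := fun i => |v i|) (Set.finite_range _).bddAbove i

lemma le_entrySup (A : Matrix ι κ ℝ) (i : ι) (k : κ) : |A i k| ≤ entrySup A :=
  (le_ciSup (f := fun k => |A i k|) (Set.finite_range _).bddAbove k).trans
    (le_ciSup (f := fun i => ⨆ k, |A i k|) (Set.finite_range _).bddAbove i)

end Coordinates

/-! ### Moment functions of a sample in coordinates -/

section Model

variable {d p n : ℕ} {ι : Type}

/-- Standing regularity of a family of estimating functions at a fixed sample size. -/
structure SmoothModel (Θ : Set (EuclideanSpace ℝ (Fin p))) (θ₀ : EuclideanSpace ℝ (Fin p))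
    (ρ : ℝ) (g : EstFun ι d p) : Prop where
  convex : Convex ℝ Θ
  pos : 0 < ρ
  ball : Metric.ball θ₀ ρ ⊆ Θ
  measurable : ∀ j, ∀ θ ∈ Θ, Measurable fun x => g j x θ
  smooth : ∀ j x, ContDiffOn ℝ 2 (g j x) Θ

variable {Θ : Set (EuclideanSpace ℝ (Fin p))} {θ₀ : EuclideanSpace ℝ (Fin p)} {ρ : ℝ}
  {g : EstFun ι d p}

namespace SmoothModel

lemma mem (hM : SmoothModel Θ θ₀ ρ g) : θ₀ ∈ Θ := hM.ball (Metric.mem_ball_self hM.pos)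

lemma uniqueDiffOn (hM : SmoothModel Θ θ₀ ρ g) : UniqueDiffOn ℝ Θ :=
  uniqueDiffOn_convex hM.convex
    ⟨θ₀, mem_interior.2 ⟨_, hM.ball, Metric.isOpen_ball, Metric.mem_ball_self hM.pos⟩⟩

lemma mem_nhds (hM : SmoothModel Θ θ₀ ρ g) : Θ ∈ 𝓝 θ₀ :=
  mem_of_superset (Metric.ball_mem_nhds _ hM.pos) hM.ball

lemma hasFDerivWithinAt (hM : SmoothModel Θ θ₀ ρ g) (j : ι) (x : EuclideanSpace ℝ (Fin d))
    {θ : EuclideanSpace ℝ (Fin p)} (hθ : θ ∈ Θ) :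
    HasFDerivWithinAt (g j x) (fderivWithin ℝ (g j x) Θ θ) Θ θ :=
  ((hM.smooth j x).differentiableOn two_ne_zero θ hθ).hasFDerivWithinAt

lemma continuousOn (hM : SmoothModel Θ θ₀ ρ g) (j : ι) (x : EuclideanSpace ℝ (Fin d)) :
    ContinuousOn (g j x) Θ := (hM.smooth j x).continuousOn

end SmoothModel

lemma clm_apply_eq_sum {F : Type*} [NormedAddCommGroup F] [NormedSpace ℝ F]
    (φ : EuclideanSpace ℝ (Fin p) →L[ℝ] F) (v : EuclideanSpace ℝ (Fin p)) :
    φ v = ∑ k, v k • φ (EuclideanSpace.single k 1) := by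
  conv_lhs => rw [← (EuclideanSpace.basisFun (Fin p) ℝ).sum_repr v]
  simp [map_sum]

lemma fderivWithin_apply_eq_sum (j : ι) (x : EuclideanSpace ℝ (Fin d))
    (θ v : EuclideanSpace ℝ (Fin p)) :
    fderivWithin ℝ (g j x) Θ θ v = ∑ k, pderiv Θ g j x θ k * v k := by
  rw [clm_apply_eq_sum]
  simp [pderiv, mul_comm]

lemma SmoothModel.hasFDerivWithinAt_pderiv (hM : SmoothModel Θ θ₀ ρ g) (j : ι)
    (x : EuclideanSpace ℝ (Fin d)) {θ : EuclideanSpace ℝ (Fin p)} (hθ : θ ∈ Θ) (k : Fin p) :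
    HasFDerivWithinAt (fun θ => pderiv Θ g j x θ k)
      ((ContinuousLinearMap.apply ℝ ℝ (EuclideanSpace.single k 1)) ∘L
        fderivWithin ℝ (fderivWithin ℝ (g j x) Θ) Θ θ) Θ θ := by
  have h1 : DifferentiableWithinAt ℝ (fderivWithin ℝ (g j x) Θ) Θ θ :=
    ((hM.smooth j x).fderivWithin hM.uniqueDiffOn (m := 1) (by norm_num)).differentiableOn
      one_ne_zero θ hθ
  exact (ContinuousLinearMap.apply ℝ ℝ (EuclideanSpace.single k (1 : ℝ))).hasFDerivAt.comp_hasFDerivWithinAt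
    θ h1.hasFDerivWithinAt

lemma SmoothModel.fderivWithin_pderiv_apply (hM : SmoothModel Θ θ₀ ρ g) (j : ι)
    (x : EuclideanSpace ℝ (Fin d)) {θ : EuclideanSpace ℝ (Fin p)} (hθ : θ ∈ Θ) (k : Fin p)
    (v : EuclideanSpace ℝ (Fin p)) :
    ((ContinuousLinearMap.apply ℝ ℝ (EuclideanSpace.single k (1 : ℝ))) ∘L
        fderivWithin ℝ (fderivWithin ℝ (g j x) Θ) Θ θ) v
      = ∑ l, pderiv₂ Θ g j x θ l k * v l := by
  rw [clm_apply_eq_sum]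
  refine Finset.sum_congr rfl fun l _ => ?_
  rw [pderiv₂, iteratedFDerivWithin_two_apply' _ hM.uniqueDiffOn hθ, smul_eq_mul, mul_comm]
  rfl

/-- The vector `(g_j(x_i; θ))_j`. -/
def momentVec (g : EstFun ι d p) (x : Fin n → EuclideanSpace ℝ (Fin d)) (i : Fin n)
    (θ : EuclideanSpace ℝ (Fin p)) : EuclideanSpace ℝ ι :=
  WithLp.toLp 2 fun j => g j (x i) θ

/-- The derivative of `momentVec` relative to `Θ`. -/
def momentDeriv (Θ : Set (EuclideanSpace ℝ (Fin p))) (g : EstFun ι d p)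
    (x : Fin n → EuclideanSpace ℝ (Fin d)) (i : Fin n) (θ : EuclideanSpace ℝ (Fin p)) :
    EuclideanSpace ℝ (Fin p) →L[ℝ] EuclideanSpace ℝ ι :=
  (PiLp.continuousLinearEquiv 2 ℝ (fun _ : ι => ℝ)).symm.toContinuousLinearMap ∘L
    ContinuousLinearMap.pi fun j => fderivWithin ℝ (g j (x i)) Θ θ

variable {x : Fin n → EuclideanSpace ℝ (Fin d)}

lemma momentDeriv_apply (i : Fin n) (θ v : EuclideanSpace ℝ (Fin p)) (j : ι) :
    momentDeriv Θ g x i θ v j = ∑ k, pderiv Θ g j (x i) θ k * v k :=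
  fderivWithin_apply_eq_sum j (x i) θ v

lemma isHermitian_sampleV (θ : EuclideanSpace ℝ (Fin p)) : (sampleV x g θ).IsHermitian := by
  ext j k
  simp [sampleV, mul_comm]

variable [Fintype ι]

lemma hasFDerivWithinAt_momentVec (hM : SmoothModel Θ θ₀ ρ g) (i : Fin n)
    {θ : EuclideanSpace ℝ (Fin p)} (hθ : θ ∈ Θ) :
    HasFDerivWithinAt (momentVec g x i) (momentDeriv Θ g x i θ) Θ θ := by
  rw [hasFDerivWithinAt_piLp]
  exact fun j => hM.hasFDerivWithinAt j (x i) hθ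

lemma inner_momentVec (l : EuclideanSpace ℝ ι) (i : Fin n) (θ : EuclideanSpace ℝ (Fin p)) :
    ⟪l, momentVec g x i θ⟫ = ∑ j, l j * g j (x i) θ := by
  rw [inner_eq_dotProduct]; rfl

/-- The quadratic form of the sample second moment matrix. -/
lemma dotProduct_sampleV (θ : EuclideanSpace ℝ (Fin p)) (u : EuclideanSpace ℝ ι) :
    u.ofLp ⬝ᵥ (sampleV x g θ *ᵥ u.ofLp) = empMean fun i => ⟪u, momentVec g x i θ⟫ ^ 2 := by
  simp only [inner_momentVec, sampleV, sampleMean, dotProduct, Matrix.mulVec, Matrix.of_apply,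
    empMean, smul_eq_mul, sq]
  simp only [Finset.mul_sum, Finset.sum_mul]
  rw [Finset.sum_comm]
  simp_rw [Finset.sum_comm (s := Finset.univ (α := ι)) (t := Finset.univ (α := Fin n))]
  refine Finset.sum_congr rfl fun i _ => ?_
  rw [Finset.sum_comm]
  refine Finset.sum_congr rfl fun j _ => Finset.sum_congr rfl fun k _ => ?_
  ring

/-- The eigenvalue condition on the sample second moment matrix as a bound on quadratic forms. -/
lemma sampleV_eigenvalue_iff [DecidableEq ι] [Nonempty ι] {c C : ℝ}
    {θ : EuclideanSpace ℝ (Fin p)} :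
    (c ≤ lamMin (sampleV x g θ) ∧ lamMax (sampleV x g θ) ≤ C) ↔
      ∀ u : EuclideanSpace ℝ ι, c * ‖u‖ ^ 2 ≤ (empMean fun i => ⟪u, momentVec g x i θ⟫ ^ 2) ∧
        (empMean fun i => ⟪u, momentVec g x i θ⟫ ^ 2) ≤ C * ‖u‖ ^ 2 := by
  rw [le_lamMin_iff (isHermitian_sampleV θ), lamMax_le_iff (isHermitian_sampleV θ), ← forall_and]
  simp_rw [← dotProduct_sampleV, sq_norm_eq_dotProduct]
  exact ⟨fun h u => h u.ofLp, fun h u => h (WithLp.toLp 2 u)⟩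

/-! ### Consequences of a bound on `regTerm` -/

section RegTerm

variable {γ K : ℝ} {θ : EuclideanSpace ℝ (Fin p)}

lemma regTerm_bounds (h : regTerm γ Θ x g θ ≤ K) :
    (∀ j k, empMean (fun i => pderiv Θ g j (x i) θ k ^ 2) ≤ K) ∧
    (∀ j k l, empMean (fun i => pderiv₂ Θ g j (x i) θ k l ^ 2) ≤ K) ∧
    ∀ j, empMean (fun i => |g j (x i) θ| ^ γ) ≤ K := by
  set A : Matrix ι (Fin p) ℝ := Matrix.of fun j k => sampleMean x fun y => |pderiv Θ g j y θ k| ^ 2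
    with hA
  set B : ι → Matrix (Fin p) (Fin p) ℝ := fun j =>
    Matrix.of fun k l => sampleMean x fun y => |pderiv₂ Θ g j y θ k l| ^ 2 with hB
  set w : ι → ℝ := fun j => sampleMean x fun y => |g j y θ| ^ γ with hw
  have h' : entrySup A + (⨆ j, entrySup (B j)) + vecSup w ≤ K := h
  have h1 := entrySup_nonneg A
  have h2 : 0 ≤ ⨆ j, entrySup (B j) := Real.iSup_nonneg fun j => entrySup_nonneg _
  have h3 := vecSup_nonneg w
  refine ⟨fun j k => ?_, fun j k l => ?_, fun j => ?_⟩
  · have h4 : A j k ≤ K := ((le_abs_self _).trans (le_entrySup A j k)).trans (by linarith)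
    simp only [hA, Matrix.of_apply, sq_abs] at h4
    exact h4
  · have h5 : entrySup (B j) ≤ ⨆ j, entrySup (B j) :=
      le_ciSup (f := fun j => entrySup (B j)) (Set.finite_range _).bddAbove j
    have h4 : B j k l ≤ K :=
      ((le_abs_self _).trans (le_entrySup (B j) k l)).trans (by linarith)
    simp only [hB, Matrix.of_apply, sq_abs] at h4
    exact h4
  · have h4 := (le_abs_self _).trans (le_vecSup w j)
    exact h4.trans (by linarith)

/-- A single term |g_j|^γ is at most the sum over the sample, hence at most nK. This deterministic
envelope is the source of the exponent 2/γ in the growth condition. -/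
lemma norm_momentVec_le (hn : 0 < n) (hγ : 0 < γ) (h : regTerm γ Θ x g θ ≤ K) (i : Fin n) :
    ‖momentVec g x i θ‖ ≤ √(Fintype.card ι) * (n * K) ^ γ⁻¹ := by
  obtain ⟨-, -, h3⟩ := regTerm_bounds h
  have hn' : (0 : ℝ) < n := by positivity
  have hj : ∀ j, |g j (x i) θ| ≤ (n * K) ^ γ⁻¹ := fun j => by
    have h4 : |g j (x i) θ| ^ γ ≤ n * K := by
      calc |g j (x i) θ| ^ γ ≤ ∑ i, |g j (x i) θ| ^ γ :=
            Finset.single_le_sum (f := fun i => |g j (x i) θ| ^ γ) (fun i _ => by positivity)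
              (Finset.mem_univ i)
        _ = n * empMean (fun i => |g j (x i) θ| ^ γ) := sum_eq_mul_empMean hn _
        _ ≤ n * K := by gcongr; exact h3 j
    calc |g j (x i) θ| = (|g j (x i) θ| ^ γ) ^ γ⁻¹ := by
          rw [← Real.rpow_mul (abs_nonneg _), mul_inv_cancel₀ hγ.ne', Real.rpow_one]
      _ ≤ _ := Real.rpow_le_rpow (by positivity) h4 (by positivity)
  rcases isEmpty_or_nonempty ι with hι | ⟨⟨j₀⟩⟩
  · have : momentVec g x i θ = 0 := Subsingleton.elim _ _
    rw [this]; simp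
  have hB : 0 ≤ (n * K) ^ γ⁻¹ := (abs_nonneg _).trans (hj j₀)
  apply le_of_sq_le_sq _ (by positivity)
  rw [EuclideanSpace.real_norm_sq_eq, mul_pow, Real.sq_sqrt (by positivity)]
  calc _ ≤ ∑ _j : ι, ((n * K) ^ γ⁻¹) ^ 2 := Finset.sum_le_sum fun j _ => by
        rw [← sq_abs]
        exact pow_le_pow_left₀ (abs_nonneg _) (hj j) 2
    _ = _ := by simp

lemma empMean_norm_momentDeriv_sq_le (hK : 0 ≤ K) (h : regTerm γ Θ x g θ ≤ K)
    (v : EuclideanSpace ℝ (Fin p)) :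
    empMean (fun i => ‖momentDeriv Θ g x i θ v‖ ^ 2)
      ≤ (√(Fintype.card ι * p * K) * ‖v‖) ^ 2 := by
  obtain ⟨h1, -, -⟩ := regTerm_bounds h
  rw [mul_pow, Real.sq_sqrt (by positivity)]
  calc _ ≤ empMean (fun i => ‖v‖ ^ 2 * ∑ j, ∑ k, pderiv Θ g j (x i) θ k ^ 2) :=
        empMean_mono fun i => (sq_norm_le_of_rows (momentDeriv_apply i θ v)).trans_eq (mul_comm _ _)
    _ = ‖v‖ ^ 2 * ∑ j, ∑ k, empMean (fun i => pderiv Θ g j (x i) θ k ^ 2) := by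
        rw [empMean_const_mul, empMean_finset_sum]
        simp_rw [empMean_finset_sum]
    _ ≤ ‖v‖ ^ 2 * ∑ _j : ι, ∑ _k : Fin p, K := by
        gcongr; exact h1 _ _
    _ = _ := by simp; ring

end RegTerm

/-- The averaged partial derivative is differentiated in θ; by Jensen each averaged second
derivative has square at most K, and Cauchy–Schwarz over the p directions gives √(pK). -/
lemma norm_empMean_pderiv_sub_le {γ K : ℝ} (hM : SmoothModel Θ θ₀ ρ g) (hK : 0 ≤ K)
    (h : ∀ θ ∈ Θ, regTerm γ Θ x g θ ≤ K) {θ : EuclideanSpace ℝ (Fin p)} (hθ : θ ∈ Θ) (j : ι)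
    (k : Fin p) :
    |empMean (fun i => pderiv Θ g j (x i) θ k) - empMean (fun i => pderiv Θ g j (x i) θ₀ k)|
      ≤ √(p * K) * ‖θ - θ₀‖ := by
  have hd : ∀ θ ∈ Θ, HasFDerivWithinAt (fun θ => empMean fun i => pderiv Θ g j (x i) θ k)
      ((n : ℝ)⁻¹ • ∑ i, ((ContinuousLinearMap.apply ℝ ℝ (EuclideanSpace.single k (1 : ℝ))) ∘L
        fderivWithin ℝ (fderivWithin ℝ (g j (x i)) Θ) Θ θ)) Θ θ := fun θ hθ =>
    (HasFDerivWithinAt.fun_sum (u := Finset.univ) fun i _ =>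
      hM.hasFDerivWithinAt_pderiv j (x i) hθ k).const_smul (n : ℝ)⁻¹
  refine norm_image_sub_le_of_segment hM.convex hd hM.mem hθ fun w hw => ?_
  have hwΘ := hM.convex.segment_subset hM.mem hθ hw
  set v := θ - θ₀
  have h1 : ((n : ℝ)⁻¹ • ∑ i, ((ContinuousLinearMap.apply ℝ ℝ (EuclideanSpace.single k (1 : ℝ))) ∘L
      fderivWithin ℝ (fderivWithin ℝ (g j (x i)) Θ) Θ w)) v
      = ∑ l, (empMean fun i => pderiv₂ Θ g j (x i) w l k) * v l := by
    calc _ = empMean fun i => ((ContinuousLinearMap.apply ℝ ℝ (EuclideanSpace.single k (1 : ℝ))) ∘L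
          fderivWithin ℝ (fderivWithin ℝ (g j (x i)) Θ) Θ w) v := by simp [empMean]
      _ = empMean fun i => ∑ l, v l * pderiv₂ Θ g j (x i) w l k := by
          congr 1; ext i; rw [hM.fderivWithin_pderiv_apply j (x i) hwΘ k v]
          simp_rw [mul_comm]
      _ = _ := by
          rw [empMean_finset_sum]
          simp_rw [empMean_const_mul, mul_comm]
  rw [h1, Real.norm_eq_abs]
  apply abs_le_of_sq_le_sq _ (by positivity)
  obtain ⟨-, h2, -⟩ := regTerm_bounds (h w hwΘ)
  calc _ ≤ (∑ l, (empMean fun i => pderiv₂ Θ g j (x i) w l k) ^ 2) * ∑ l, v l ^ 2 :=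
        Finset.sum_mul_sq_le_sq_mul_sq _ _ _
    _ ≤ (∑ _l : Fin p, K) * ∑ l, v l ^ 2 := by
        gcongr with l
        exact (sq_empMean_le _).trans (h2 j l k)
    _ = _ := by
        rw [mul_pow, Real.sq_sqrt (by positivity), EuclideanSpace.real_norm_sq_eq]
        simp

lemma norm_empMean_momentDeriv_sub_le {γ K : ℝ} (hM : SmoothModel Θ θ₀ ρ g) (hK : 0 ≤ K)
    (h : ∀ θ ∈ Θ, regTerm γ Θ x g θ ≤ K) {θ : EuclideanSpace ℝ (Fin p)} (hθ : θ ∈ Θ)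
    (v : EuclideanSpace ℝ (Fin p)) :
    ‖empMean (fun i => momentDeriv Θ g x i θ v) - empMean (fun i => momentDeriv Θ g x i θ₀ v)‖
      ≤ √(Fintype.card ι * K) * p * ‖θ - θ₀‖ * ‖v‖ := by
  refine norm_le_of_rows (A := fun j k => empMean (fun i => pderiv Θ g j (x i) θ k)
    - empMean (fun i => pderiv Θ g j (x i) θ₀ k)) (by positivity) (fun j => ?_) ?_
  · rw [PiLp.sub_apply, ofLp_empMean, ofLp_empMean]
    simp_rw [momentDeriv_apply, empMean_finset_sum]
    rw [← Finset.sum_sub_distrib]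
    refine Finset.sum_congr rfl fun k _ => ?_
    simp_rw [mul_comm _ (v k)]
    rw [empMean_const_mul, empMean_const_mul]; ring
  · calc _ ≤ ∑ _j : ι, ∑ _k : Fin p, (√(p * K) * ‖θ - θ₀‖) ^ 2 := by
          refine Finset.sum_le_sum fun j _ => Finset.sum_le_sum fun k _ => ?_
          rw [← sq_abs]
          exact pow_le_pow_left₀ (abs_nonneg _) (norm_empMean_pderiv_sub_le hM hK h hθ j k) 2
      _ = _ := by
          simp only [Finset.sum_const, Finset.card_univ, Fintype.card_fin, nsmul_eq_mul, mul_pow]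
          rw [Real.sq_sqrt (by positivity), Real.sq_sqrt (by positivity)]
          ring

end Model

/-! ### From matrix and moment conditions to a regular sample -/

section Assembly

variable {d p n : ℕ} {ι : Type} [Fintype ι]
  {Θ : Set (EuclideanSpace ℝ (Fin p))} {θ₀ : EuclideanSpace ℝ (Fin p)} {ρ : ℝ}
  {g : EstFun ι d p} {x : Fin n → EuclideanSpace ℝ (Fin d)}
  {ν : Measure (EuclideanSpace ℝ (Fin d))}

omit [Fintype ι] in
lemma isHermitian_popV (θ : EuclideanSpace ℝ (Fin p)) : (popV ν g θ).IsHermitian := by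
  ext j k
  simp [popV, mul_comm]

lemma isHermitian_matQ (θ : EuclideanSpace ℝ (Fin p)) : (matQ ν Θ g θ).IsHermitian := by
  rw [matQ, tensorSq, Matrix.transpose_transpose, Matrix.IsHermitian,
    Matrix.conjTranspose_eq_transpose_of_trivial, Matrix.transpose_mul, Matrix.transpose_transpose]

lemma sq_norm_matCLM_popGrad (θ v : EuclideanSpace ℝ (Fin p)) :
    ‖matCLM (popGrad ν Θ g θ) v‖ ^ 2 = v.ofLp ⬝ᵥ (matQ ν Θ g θ *ᵥ v.ofLp) := by
  rw [sq_norm_eq_dotProduct, ofLp_matCLM, matQ, tensorSq, Matrix.transpose_transpose,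
    ← Matrix.mulVec_mulVec, Matrix.dotProduct_mulVec v.ofLp, Matrix.vecMul_transpose]

section QBounds

variable {C : ℝ} [Nonempty (Fin p)]
  (hQ : C⁻¹ ≤ lamMin (matQ ν Θ g θ₀) ∧ lamMax (matQ ν Θ g θ₀) ≤ C) (hC : 1 ≤ C)
include hQ hC

lemma norm_matCLM_popGrad_le (v : EuclideanSpace ℝ (Fin p)) :
    ‖matCLM (popGrad ν Θ g θ₀) v‖ ≤ C * ‖v‖ := by
  apply le_of_sq_le_sq _ (by positivity)
  rw [sq_norm_matCLM_popGrad, mul_pow]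
  refine ((lamMax_le_iff (isHermitian_matQ θ₀) C).1 hQ.2 v.ofLp).trans ?_
  rw [← sq_norm_eq_dotProduct]
  gcongr
  exact le_self_pow₀ hC two_ne_zero

lemma sq_norm_le_matCLM_popGrad (v : EuclideanSpace ℝ (Fin p)) :
    ‖v‖ ^ 2 ≤ C * ‖matCLM (popGrad ν Θ g θ₀) v‖ ^ 2 := by
  have h := (le_lamMin_iff (isHermitian_matQ θ₀) C⁻¹).1 hQ.1 v.ofLp
  rw [← sq_norm_eq_dotProduct, ← sq_norm_matCLM_popGrad, inv_mul_le_iff₀ (by linarith)] at h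
  exact h

lemma norm_le_matCLM_popGrad (v : EuclideanSpace ℝ (Fin p)) :
    ‖v‖ ≤ C * ‖matCLM (popGrad ν Θ g θ₀) v‖ := by
  apply le_of_sq_le_sq _ (by positivity)
  refine (sq_norm_le_matCLM_popGrad hQ hC v).trans ?_
  rw [mul_pow]
  gcongr
  exact le_self_pow₀ hC two_ne_zero

/-- The number of moments is at least the number of parameters. -/
lemma card_le_card_of_popGrad : p ≤ Fintype.card ι := by
  have hinj : Function.Injective (matCLM (popGrad ν Θ g θ₀)) := by
    rw [injective_iff_map_eq_zero]
    intro v hv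
    have := norm_le_matCLM_popGrad hQ hC v
    rw [hv, norm_zero, mul_zero] at this
    exact norm_le_zero_iff.1 this
  have := LinearMap.finrank_le_finrank_of_injective
    (f := (matCLM (popGrad ν Θ g θ₀)).toLinearMap) hinj
  simpa using this

end QBounds

/-- Frobenius bounds imply operator norm bounds for deviations of sample matrices. -/
lemma norm_empMean_momentDeriv_sub_matCLM_le {e : ℝ} (he : 0 ≤ e)
    (h : ∑ j, ∑ k, (empMean (fun i => pderiv Θ g j (x i) θ₀ k)
      - ∫ y, pderiv Θ g j y θ₀ k ∂ν) ^ 2 ≤ e ^ 2) (v : EuclideanSpace ℝ (Fin p)) :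
    ‖empMean (fun i => momentDeriv Θ g x i θ₀ v) - matCLM (popGrad ν Θ g θ₀) v‖ ≤ e * ‖v‖ := by
  refine norm_le_of_rows (A := fun j k => empMean (fun i => pderiv Θ g j (x i) θ₀ k)
    - ∫ y, pderiv Θ g j y θ₀ k ∂ν) he (fun j => ?_) h
  rw [PiLp.sub_apply, ofLp_empMean, matCLM_apply]
  simp_rw [momentDeriv_apply, empMean_finset_sum]
  rw [← Finset.sum_sub_distrib]
  refine Finset.sum_congr rfl fun k _ => ?_
  simp_rw [mul_comm _ (v k)]
  rw [empMean_const_mul, popGrad, Matrix.of_apply]; ring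

lemma norm_empMean_momentVec_sub_matCLM_le {e : ℝ} (he : 0 ≤ e)
    (h : ∑ j, ∑ k, (empMean (fun i => g j (x i) θ₀ * g k (x i) θ₀)
      - ∫ y, g j y θ₀ * g k y θ₀ ∂ν) ^ 2 ≤ e ^ 2) (u : EuclideanSpace ℝ ι) :
    ‖empMean (fun i => ⟪u, momentVec g x i θ₀⟫ • momentVec g x i θ₀) - matCLM (popV ν g θ₀) u‖
      ≤ e * ‖u‖ := by
  refine norm_le_of_rows (A := fun j k => empMean (fun i => g j (x i) θ₀ * g k (x i) θ₀)
    - ∫ y, g j y θ₀ * g k y θ₀ ∂ν) he (fun j => ?_) h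
  rw [PiLp.sub_apply, ofLp_empMean, matCLM_apply]
  have : ∀ i, (⟪u, momentVec g x i θ₀⟫ • momentVec g x i θ₀) j
      = ∑ k, u k * (g j (x i) θ₀ * g k (x i) θ₀) := fun i => by
    rw [PiLp.smul_apply, inner_momentVec, smul_eq_mul, Finset.sum_mul]
    refine Finset.sum_congr rfl fun k _ => ?_
    simp only [momentVec]; ring
  simp_rw [this, empMean_finset_sum]
  rw [← Finset.sum_sub_distrib]
  refine Finset.sum_congr rfl fun k _ => ?_
  rw [empMean_const_mul, popV, Matrix.of_apply]; ring

/-- Lower bound on the quadratic form of `popV` from that of the sample. -/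
lemma inner_matCLM_popV_ge {c e : ℝ} (he : 0 ≤ e)
    (hc : ∀ u : EuclideanSpace ℝ ι, c * ‖u‖ ^ 2 ≤ empMean fun i => ⟪u, momentVec g x i θ₀⟫ ^ 2)
    (h : ∑ j, ∑ k, (empMean (fun i => g j (x i) θ₀ * g k (x i) θ₀)
      - ∫ y, g j y θ₀ * g k y θ₀ ∂ν) ^ 2 ≤ e ^ 2) (u : EuclideanSpace ℝ ι) :
    (c - e) * ‖u‖ ^ 2 ≤ ⟪u, matCLM (popV ν g θ₀) u⟫ := by
  have h1 := norm_empMean_momentVec_sub_matCLM_le he h u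
  have h2 : ⟪u, empMean fun i => ⟪u, momentVec g x i θ₀⟫ • momentVec g x i θ₀⟫
      = empMean fun i => ⟪u, momentVec g x i θ₀⟫ ^ 2 := by
    rw [inner_empMean]
    congr 1; ext i
    rw [inner_smul_right, sq]
  have h3 := real_inner_le_norm u (empMean (fun i => ⟪u, momentVec g x i θ₀⟫ • momentVec g x i θ₀)
    - matCLM (popV ν g θ₀) u)
  rw [inner_sub_right, h2] at h3
  have h4 : ‖u‖ * ‖empMean (fun i => ⟪u, momentVec g x i θ₀⟫ • momentVec g x i θ₀)
      - matCLM (popV ν g θ₀) u‖ ≤ ‖u‖ * (e * ‖u‖) := by gcongr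
  have := hc u
  nlinarith

/-- The sample is regular in the sense of `RegularSample` on the event where its empirical
moments are controlled. -/
theorem regularSample_moments {γ C₃ C₄ C K a e eV : ℝ} [Nonempty (Fin p)]
    (hM : SmoothModel Θ θ₀ ρ g) (hn : 0 < n) (hγ : 0 < γ) (hC₃ : 1 ≤ C₃) (hC₄ : 1 ≤ C₄)
    (hC : 2 * C₃ ≤ C) (hC' : C₄ ≤ C) (hK : 0 ≤ K) (ha : 0 < a) (he : 0 ≤ e) (heV : 0 ≤ eV)
    (heV' : eV ≤ (2 * C₃)⁻¹)
    (hQ : C₄⁻¹ ≤ lamMin (matQ ν Θ g θ₀) ∧ lamMax (matQ ν Θ g θ₀) ≤ C₄)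
    (heig : ∀ θ ∈ Θ, ∀ u : EuclideanSpace ℝ ι,
      C₃⁻¹ * ‖u‖ ^ 2 ≤ (empMean fun i => ⟪u, momentVec g x i θ⟫ ^ 2) ∧
        (empMean fun i => ⟪u, momentVec g x i θ⟫ ^ 2) ≤ C₃ * ‖u‖ ^ 2)
    (hreg : ∀ θ ∈ Θ, regTerm γ Θ x g θ ≤ K)
    (hscore : ∑ j, (empMean fun i => g j (x i) θ₀) ^ 2 ≤ a ^ 2)
    (hgrad : ∑ j, ∑ k, (empMean (fun i => pderiv Θ g j (x i) θ₀ k)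
      - ∫ y, pderiv Θ g j y θ₀ k ∂ν) ^ 2 ≤ e ^ 2)
    (hsecond : ∑ j, ∑ k, (empMean (fun i => g j (x i) θ₀ * g k (x i) θ₀)
      - ∫ y, g j y θ₀ * g k y θ₀ ∂ν) ^ 2 ≤ eV ^ 2) :
    RegularSample Θ θ₀ (momentVec g x) (momentDeriv Θ g x) (matCLM (popGrad ν Θ g θ₀))
      (matCLM (popV ν g θ₀)) C a (√(Fintype.card ι) * (n * K) ^ γ⁻¹)
      (√(Fintype.card ι * p * K)) (√(Fintype.card ι * K) * p) e eV where
  n_pos := hn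
  convex := hM.convex
  mem := hM.mem
  one_le := by linarith
  a_pos := ha
  L_nonneg := by positivity
  S_nonneg := by positivity
  e_nonneg := he
  eV_nonneg := heV
  hasFDeriv i θ hθ := hasFDerivWithinAt_momentVec hM i hθ
  norm_le i θ hθ := norm_momentVec_le hn hγ (hreg θ hθ) i
  lower θ hθ u := le_trans (by gcongr; linarith) (heig θ hθ u).1
  upper θ hθ u := (heig θ hθ u).2.trans (by gcongr; linarith)
  deriv_sq θ hθ v := empMean_norm_momentDeriv_sq_le hK (hreg θ hθ) v
  deriv_lip θ hθ v := norm_empMean_momentDeriv_sub_le hM hK hreg hθ v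
  deriv_dev v := norm_empMean_momentDeriv_sub_matCLM_le he hgrad v
  score := by
    apply le_of_sq_le_sq _ ha.le
    rw [EuclideanSpace.real_norm_sq_eq]
    simp_rw [ofLp_empMean]
    exact hscore
  second_dev u := norm_empMean_momentVec_sub_matCLM_le heV hsecond u
  D_upper v := (norm_matCLM_popGrad_le hQ hC₄ v).trans (by gcongr)
  D_lower v := (norm_le_matCLM_popGrad hQ hC₄ v).trans (by gcongr)
  V_lower u := by
    have h1 := inner_matCLM_popV_ge heV (fun u => (heig θ₀ hM.mem u).1) hsecond u
    have h2 := real_inner_le_norm u (matCLM (popV ν g θ₀) u)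
    -- The fluctuation `eV` uses up at most half of the sample eigenvalue bound, leaving the other
    -- half for the population matrix.
    have h3 : (2 * C₃)⁻¹ ≤ C₃⁻¹ - eV := by
      have : C₃⁻¹ = (2 * C₃)⁻¹ + (2 * C₃)⁻¹ := by field_simp; norm_num
      linarith
    have h4 : (2 * C₃)⁻¹ * ‖u‖ ^ 2 ≤ ‖u‖ * ‖matCLM (popV ν g θ₀) u‖ := by
      have := mul_le_mul_of_nonneg_right h3 (sq_nonneg ‖u‖)
      linarith
    rw [inv_mul_le_iff₀ (by linarith)] at h4
    have h5 : ‖u‖ ≤ 2 * C₃ * ‖matCLM (popV ν g θ₀) u‖ := by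
      rcases (norm_nonneg u).eq_or_lt with h | h
      · rw [← h]; positivity
      · nlinarith
    exact h5.trans (by gcongr)

/-- Comparing extended suprema through real upper bounds M is all that the deterministic analysis
uses; the suprema need be neither attained nor finite at every θ. -/
lemma isProfileMin_of_isELEstimate {𝒱 : Set ℝ} {t : EuclideanSpace ℝ (Fin p)}
    (h : IsELEstimate 𝒱 Θ x g t) : IsProfileMin 𝒱 Θ (momentVec g x) t where
  mem := h.1
  min θ hθ M hM l hl := by
    have h1 : elObjective 𝒱 x g θ ≤ (M : EReal) := by
      refine iSup₂_le fun lam hlam => ?_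
      have h2 := hM (WithLp.toLp 2 lam) fun i => by
        rw [inner_momentVec]; exact hlam i
      rw [elLog] at h2
      simp_rw [inner_momentVec] at h2
      exact EReal.coe_le_coe_iff.2 h2
    have h2 : ((elLog (fun i => momentVec g x i t) l : ℝ) : EReal) ≤ elObjective 𝒱 x g t := by
      rw [elLog]
      simp_rw [inner_momentVec]
      refine le_iSup₂ (f := fun (lam : ι → ℝ) (_ : lam ∈ multiplierSet 𝒱 x g t) =>
        ((∑ i, Real.log (1 + ∑ j, lam j * g j (x i) t) : ℝ) : EReal)) l.ofLp fun i => ?_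
      have := hl i
      rwa [inner_momentVec] at this
    exact EReal.coe_le_coe_iff.1 ((h2.trans (h.2 θ hθ)).trans h1)

end Assembly

/-! ### Population moments -/

section PopulationMoments

variable {𝒳 : Type*} [MeasurableSpace 𝒳] {ν : Measure 𝒳} [IsProbabilityMeasure ν] {γ C : ℝ}
  {φ ψ : 𝒳 → ℝ}

lemma abs_pow_le_one_add_rpow {γ : ℝ} {k : ℕ} (hk : (k : ℝ) ≤ γ) (t : ℝ) :
    |t| ^ k ≤ 1 + |t| ^ γ := by
  rcases le_total |t| 1 with h | h
  · have := pow_le_one₀ (n := k) (abs_nonneg t) h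
    have : 0 ≤ |t| ^ γ := by positivity
    linarith
  · rw [← Real.rpow_natCast]
    have := Real.rpow_le_rpow_of_exponent_le h hk
    linarith

/-- A function with bounded `γ`-th moment, `γ > 4`, has controlled moments of lower order. -/
lemma memLp_four_of_lintegral_le (hγ : 4 < γ) (hC : 0 ≤ C) (hφ : Measurable φ)
    (h : ∫⁻ x, ‖φ x‖ₑ ^ γ ∂ν ≤ ENNReal.ofReal C) :
    MemLp φ 4 ν ∧ ∀ k ≤ 4, ∫ x, |φ x| ^ k ∂ν ≤ 1 + C := by
  have hγ0 : 0 < γ := by linarith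
  have hfin : ∫⁻ x, ‖φ x‖ₑ ^ γ ∂ν < ∞ := h.trans_lt ENNReal.ofReal_lt_top
  have hmem : MemLp φ (ENNReal.ofReal γ) ν := by
    refine ⟨hφ.aestronglyMeasurable, ?_⟩
    rw [eLpNorm_lt_top_iff_lintegral_rpow_enorm_lt_top (by simpa using hγ0) ENNReal.ofReal_ne_top,
      ENNReal.toReal_ofReal hγ0.le]
    exact hfin
  have h4 : MemLp φ 4 ν := hmem.mono_exponent (by
    rw [show (4 : ℝ≥0∞) = ENNReal.ofReal 4 by norm_num]
    exact ENNReal.ofReal_le_ofReal hγ.le)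
  have heq : ∀ x, ENNReal.ofReal (|φ x| ^ γ) = ‖φ x‖ₑ ^ γ := fun x => by
    rw [← ENNReal.ofReal_rpow_of_nonneg (abs_nonneg _) hγ0.le, Real.enorm_eq_ofReal_abs]
  have hint : Integrable (fun x => |φ x| ^ γ) ν := by
    refine ⟨(hφ.abs.pow_const γ).aestronglyMeasurable, ?_⟩
    rw [hasFiniteIntegral_iff_ofReal (ae_of_all _ fun x => by positivity)]
    simpa only [heq] using hfin
  have hle : ∫ x, |φ x| ^ γ ∂ν ≤ C := by
    rw [integral_eq_lintegral_of_nonneg_ae (ae_of_all _ fun x => by positivity)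
      hint.aestronglyMeasurable]
    simp only [heq]
    exact ENNReal.toReal_le_of_le_ofReal hC h
  refine ⟨h4, fun k hk => ?_⟩
  have hk' : (k : ℝ) ≤ γ := by
    have : (k : ℝ) ≤ 4 := by exact_mod_cast hk
    linarith
  calc ∫ x, |φ x| ^ k ∂ν ≤ ∫ x, (1 + |φ x| ^ γ) ∂ν :=
        integral_mono_of_nonneg (ae_of_all _ fun x => by positivity)
          ((integrable_const 1).add hint) (ae_of_all _ fun x => abs_pow_le_one_add_rpow hk' _)
    _ = 1 + ∫ x, |φ x| ^ γ ∂ν := by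
        rw [integral_add (integrable_const 1) hint]; simp
    _ ≤ _ := by gcongr

omit [IsProbabilityMeasure ν] in
lemma integrable_pow_four (hφ : MemLp φ 4 ν) : Integrable (fun x => φ x ^ 4) ν := by
  have h := hφ.integrable_norm_pow (p := 4) (by norm_num)
  simpa only [Real.norm_eq_abs, Even.pow_abs (⟨2, rfl⟩ : Even 4)] using h

lemma memLp_two_of_four (hφ : MemLp φ 4 ν) : MemLp φ 2 ν := hφ.mono_exponent (by norm_num)

omit [IsProbabilityMeasure ν] in
lemma memLp_mul_two (hφ : MemLp φ 4 ν) (hψ : MemLp ψ 4 ν) : MemLp (fun x => φ x * ψ x) 2 ν := by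
  refine (memLp_two_iff_integrable_sq
    (hφ.aestronglyMeasurable.mul hψ.aestronglyMeasurable)).2 ?_
  refine ((integrable_pow_four hφ).add (integrable_pow_four hψ)).mono'
    ((hφ.aestronglyMeasurable.mul hψ.aestronglyMeasurable).pow 2) (ae_of_all _ fun x => ?_)
  rw [Real.norm_of_nonneg (sq_nonneg _)]
  simp only [Pi.add_apply, Pi.mul_apply]
  nlinarith [sq_nonneg (φ x ^ 2 - ψ x ^ 2), sq_nonneg (φ x ^ 2), sq_nonneg (ψ x ^ 2)]

omit [IsProbabilityMeasure ν] in
lemma integral_sq_mul_le (hφ : MemLp φ 4 ν) (hψ : MemLp ψ 4 ν) {B : ℝ}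
    (h1 : ∫ x, φ x ^ 4 ∂ν ≤ B) (h2 : ∫ x, ψ x ^ 4 ∂ν ≤ B) :
    ∫ x, (φ x * ψ x) ^ 2 ∂ν ≤ B := by
  have i1 := integrable_pow_four hφ
  have i2 := integrable_pow_four hψ
  calc ∫ x, (φ x * ψ x) ^ 2 ∂ν ≤ ∫ x, (2⁻¹ * φ x ^ 4 + 2⁻¹ * ψ x ^ 4) ∂ν := by
        refine integral_mono_of_nonneg (ae_of_all _ fun x => sq_nonneg _)
          ((i1.const_mul _).add (i2.const_mul _)) (ae_of_all _ fun x => ?_)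
        dsimp only
        nlinarith [sq_nonneg (φ x ^ 2 - ψ x ^ 2)]
    _ = 2⁻¹ * ∫ x, φ x ^ 4 ∂ν + 2⁻¹ * ∫ x, ψ x ^ 4 ∂ν := by
        rw [integral_add (i1.const_mul _) (i2.const_mul _), integral_const_mul, integral_const_mul]
    _ ≤ _ := by linarith

omit [IsProbabilityMeasure ν] in
lemma integral_pow_four_sub_le (hφ : MemLp φ 4 ν) (hψ : MemLp ψ 4 ν) {B : ℝ}
    (h1 : ∫ x, φ x ^ 4 ∂ν ≤ B) (h2 : ∫ x, ψ x ^ 4 ∂ν ≤ B) :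
    ∫ x, (φ x - ψ x) ^ 4 ∂ν ≤ 16 * B := by
  have i1 := integrable_pow_four hφ
  have i2 := integrable_pow_four hψ
  calc ∫ x, (φ x - ψ x) ^ 4 ∂ν ≤ ∫ x, (8 * φ x ^ 4 + 8 * ψ x ^ 4) ∂ν := by
        refine integral_mono_of_nonneg (ae_of_all _ fun x => by dsimp only; positivity)
          ((i1.const_mul _).add (i2.const_mul _)) (ae_of_all _ fun x => ?_)
        dsimp only
        have h3 : (φ x - ψ x) ^ 2 ≤ 2 * φ x ^ 2 + 2 * ψ x ^ 2 := by
          nlinarith [sq_nonneg (φ x + ψ x)]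
        have h4 := pow_le_pow_left₀ (sq_nonneg _) h3 2
        nlinarith [sq_nonneg (φ x ^ 2 - ψ x ^ 2)]
    _ = 8 * ∫ x, φ x ^ 4 ∂ν + 8 * ∫ x, ψ x ^ 4 ∂ν := by
        rw [integral_add (i1.const_mul _) (i2.const_mul _), integral_const_mul, integral_const_mul]
    _ ≤ _ := by linarith

omit [IsProbabilityMeasure ν] in
lemma memLp_two_of_lintegral_le {φ : 𝒳 → ℝ} (hφ : Measurable φ) (hC : 0 ≤ C)
    (h : ∫⁻ x, ‖φ x‖ₑ ^ 2 ∂ν ≤ ENNReal.ofReal C) : MemLp φ 2 ν ∧ ∫ x, φ x ^ 2 ∂ν ≤ C := by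
  have heq : ∀ x, ENNReal.ofReal (φ x ^ 2) = ‖φ x‖ₑ ^ 2 := fun x => by
    rw [Real.enorm_eq_ofReal_abs, ← ENNReal.ofReal_pow (abs_nonneg _), sq_abs]
  have hint : Integrable (fun x => φ x ^ 2) ν := by
    refine ⟨(hφ.pow_const 2).aestronglyMeasurable, ?_⟩
    rw [hasFiniteIntegral_iff_ofReal (ae_of_all _ fun x => sq_nonneg _)]
    simp only [heq]
    exact h.trans_lt ENNReal.ofReal_lt_top
  refine ⟨(memLp_two_iff_integrable_sq hφ.aestronglyMeasurable).2 hint, ?_⟩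
  rw [integral_eq_lintegral_of_nonneg_ae (ae_of_all _ fun x => sq_nonneg _)
    hint.aestronglyMeasurable]
  simp only [heq]
  exact ENNReal.toReal_le_of_le_ofReal hC h

end PopulationMoments

/-! ### Moment conditions on a model -/

/-- Moment conditions on a family of estimating functions at a fixed sample size. -/
structure MomentModel {d p : ℕ} {ι : Type} (ν : Measure (EuclideanSpace ℝ (Fin d)))
    (Θ : Set (EuclideanSpace ℝ (Fin p))) (θ₀ : EuclideanSpace ℝ (Fin p))
    (g : EstFun ι d p) (γ B C₁ : ℝ) : Prop where
  mean_zero : ∀ j, ∫ x, g j x θ₀ ∂ν = 0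
  B_nonneg : 0 ≤ B
  C₁_pos : 0 < C₁
  gamma : 4 < γ
  moment : ∀ j, ∀ θ ∈ Θ, ∫⁻ x, ‖g j x θ‖ₑ ^ γ ∂ν ≤ ENNReal.ofReal B
  grad : ∀ j k, ∫⁻ x, ‖pderiv Θ g j x θ₀ k‖ₑ ^ 2 ∂ν ≤ ENNReal.ofReal B
  ident : ∀ ε > 0, ∀ θ ∈ Θ, ε < vecSup (fun k => θ k - θ₀ k) →
      C₁ * ε ≤ vecSup (popMean ν g θ)

section Model

variable {d p : ℕ} {ι : Type} {ν : Measure (EuclideanSpace ℝ (Fin d))}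
  [IsProbabilityMeasure ν]
  {Θ : Set (EuclideanSpace ℝ (Fin p))} {θ₀ : EuclideanSpace ℝ (Fin p)} {ρ γ B C₁ : ℝ}
  {g : EstFun ι d p}

/-- Measurability in x is assumed only for the functions themselves. The partial derivative at the
interior point θ₀ is a limit of difference quotients along a sequence not depending on x. -/
lemma measurable_pderiv (hM : SmoothModel Θ θ₀ ρ g) (j : ι) (k : Fin p) :
    Measurable fun x => pderiv Θ g j x θ₀ k := by
  set e : EuclideanSpace ℝ (Fin p) := EuclideanSpace.single k 1 with he
  -- The shift by 2 keeps every step strictly shorter than ρ, inside the open ball.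
  set s : ℕ → ℝ := fun m => ρ / (m + 2) with hs
  have hspos : ∀ m, 0 < s m := fun m => div_pos hM.pos (by positivity)
  have hs0 : Tendsto s atTop (𝓝[≠] 0) := by
    refine tendsto_nhdsWithin_iff.2 ⟨?_, Eventually.of_forall fun m => (hspos m).ne'⟩
    exact tendsto_const_nhds.div_atTop
      (tendsto_atTop_add_const_right _ _ tendsto_natCast_atTop_atTop)
  have hmem : ∀ m, θ₀ + s m • e ∈ Θ := fun m => hM.ball (by
    rw [Metric.mem_ball, dist_eq_norm, add_sub_cancel_left, norm_smul, he,
      PiLp.norm_single, norm_one, mul_one, Real.norm_of_nonneg (hspos m).le]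
    exact div_lt_self hM.pos (by
      have : (0 : ℝ) ≤ m := by positivity
      linarith))
  refine measurable_of_tendsto_metrizable
    (f := fun m x => (s m)⁻¹ * (g j x (θ₀ + s m • e) - g j x θ₀))
    (fun m => ((hM.measurable j _ (hmem m)).sub (hM.measurable j _ hM.mem)).const_mul _) ?_
  rw [tendsto_pi_nhds]
  intro x
  have h1 : HasFDerivAt (g j x) (fderivWithin ℝ (g j x) Θ θ₀) θ₀ :=
    (hM.hasFDerivWithinAt j x hM.mem).hasFDerivAt hM.mem_nhds
  have h2 := (h1.hasLineDerivAt e).tendsto_slope_zero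
  exact h2.comp hs0

namespace MomentModel

variable (hM : SmoothModel Θ θ₀ ρ g) (hm : MomentModel ν Θ θ₀ g γ B C₁)
include hM hm

lemma memLp_four (j : ι) {θ : EuclideanSpace ℝ (Fin p)} (hθ : θ ∈ Θ) :
    MemLp (fun x => g j x θ) 4 ν :=
  (memLp_four_of_lintegral_le hm.gamma hm.B_nonneg (hM.measurable j θ hθ) (hm.moment j θ hθ)).1

lemma integral_four_le (j : ι) {θ : EuclideanSpace ℝ (Fin p)} (hθ : θ ∈ Θ) :
    ∫ x, g j x θ ^ 4 ∂ν ≤ 1 + B := by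
  have := (memLp_four_of_lintegral_le hm.gamma hm.B_nonneg (hM.measurable j θ hθ)
    (hm.moment j θ hθ)).2 4 le_rfl
  simpa only [Even.pow_abs (⟨2, rfl⟩ : Even 4)] using this

lemma integral_two_le (j : ι) {θ : EuclideanSpace ℝ (Fin p)} (hθ : θ ∈ Θ) :
    ∫ x, g j x θ ^ 2 ∂ν ≤ 1 + B := by
  have := (memLp_four_of_lintegral_le hm.gamma hm.B_nonneg (hM.measurable j θ hθ)
    (hm.moment j θ hθ)).2 2 (by norm_num)
  simpa only [sq_abs] using this

lemma abs_popMean_le (j : ι) {θ : EuclideanSpace ℝ (Fin p)} (hθ : θ ∈ Θ) :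
    |popMean ν g θ j| ≤ 1 + B := by
  have := (memLp_four_of_lintegral_le hm.gamma hm.B_nonneg (hM.measurable j θ hθ)
    (hm.moment j θ hθ)).2 1 (by norm_num)
  simp only [pow_one] at this
  exact (abs_integral_le_integral_abs).trans this

-- Identification is stated for ε strictly below the distance, so a violation is refuted with an ε
-- strictly between M / C₁ and the distance.
omit [IsProbabilityMeasure ν] hM in
lemma vecSup_sub_le_of_popMean_le [Nonempty ι] {θ : EuclideanSpace ℝ (Fin p)} (hθ : θ ∈ Θ) {M : ℝ}
    (hM : ∀ j, |popMean ν g θ j| ≤ M) : C₁ * vecSup (fun k => θ k - θ₀ k) ≤ M := by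
  have hM0 : 0 ≤ M := (abs_nonneg _).trans (hM (Classical.arbitrary ι))
  by_contra! hcon
  have h1 : M / C₁ < vecSup (fun k => θ k - θ₀ k) := by
    rwa [div_lt_iff₀ hm.C₁_pos, mul_comm]
  obtain ⟨ε, h2, h3⟩ := exists_between h1
  have h4 := hm.ident ε ((div_nonneg hM0 hm.C₁_pos.le).trans_lt h2) θ hθ h3
  rw [div_lt_iff₀ hm.C₁_pos, mul_comm] at h2
  exact absurd (h4.trans (vecSup_le hM)) h2.not_ge

/-- Identification together with uniformly bounded moments forces Θ to be bounded in maximum norm,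
with a bound free of the dimensions. This is what makes a finite net possible. -/
lemma vecSup_sub_le [Nonempty ι] {θ : EuclideanSpace ℝ (Fin p)} (hθ : θ ∈ Θ) :
    vecSup (fun k => θ k - θ₀ k) ≤ (1 + B) / C₁ := by
  rw [le_div_iff₀ hm.C₁_pos, mul_comm]
  exact hm.vecSup_sub_le_of_popMean_le hθ fun j => hm.abs_popMean_le hM j hθ

omit [IsProbabilityMeasure ν] in
lemma memLp_pderiv (j : ι) (k : Fin p) : MemLp (fun x => pderiv Θ g j x θ₀ k) 2 ν ∧
    ∫ x, pderiv Θ g j x θ₀ k ^ 2 ∂ν ≤ B :=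
  memLp_two_of_lintegral_le (measurable_pderiv hM j k) hm.B_nonneg (hm.grad j k)

end MomentModel

end Model

/-! ### Nets -/

/-- A set whose points lie within `B₀` of `θ₀` in the maximum norm has a small finite net. -/
lemma exists_net {p : ℕ} {Θ : Set (EuclideanSpace ℝ (Fin p))} {θ₀ : EuclideanSpace ℝ (Fin p)}
    {B₀ η : ℝ} (hη : 0 < η) (hB : ∀ θ ∈ Θ, vecSup (fun k => θ k - θ₀ k) ≤ B₀) :
    ∃ T : Finset (EuclideanSpace ℝ (Fin p)), (∀ θ ∈ T, θ ∈ Θ) ∧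
      (∀ θ ∈ Θ, ∃ θ' ∈ T, ∀ k, |θ k - θ' k| ≤ η) ∧
      T.card ≤ (2 * (⌈B₀ / η⌉₊ + 1)) ^ p := by
  set c : EuclideanSpace ℝ (Fin p) → Fin p → ℤ := fun θ k => ⌊(θ k - θ₀ k) / η⌋ with hc
  -- One representative is chosen in each grid cell of side η that meets Θ, so the net consists of
  -- points of Θ.
  obtain ⟨s, hsΘ, hs⟩ := Set.exists_subset_bijOn Θ c
  set m : ℕ := ⌈B₀ / η⌉₊ with hm
  set F : Finset (Fin p → ℤ) := Fintype.piFinset fun _ => Finset.Ico (-(m : ℤ) - 1) (m + 1) with hF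
  have himg : c '' Θ ⊆ ↑F := by
    rintro _ ⟨θ, hθ, rfl⟩
    rw [Finset.mem_coe, Fintype.mem_piFinset]
    intro k
    have h1 : |θ k - θ₀ k| ≤ B₀ := (le_vecSup (fun k => θ k - θ₀ k) k).trans (hB θ hθ)
    have h2 : |(θ k - θ₀ k) / η| ≤ m := by
      rw [abs_div, abs_of_pos hη]
      exact (div_le_div_of_nonneg_right h1 hη.le).trans (Nat.le_ceil _)
    rw [abs_le] at h2
    rw [Finset.mem_Ico]
    constructor
    · have : (-(m : ℤ)) ≤ ⌊(θ k - θ₀ k) / η⌋ := Int.le_floor.2 (by push_cast; exact h2.1)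
      simp only [hc]; omega
    · have : ⌊(θ k - θ₀ k) / η⌋ < (m : ℤ) + 1 := Int.floor_lt.2 (by push_cast; linarith [h2.2])
      exact this
  have hfin : (c '' Θ).Finite := F.finite_toSet.subset himg
  have hsfin : s.Finite := Set.Finite.of_finite_image (hs.image_eq ▸ hfin) hs.injOn
  refine ⟨hsfin.toFinset, fun θ hθ => hsΘ (by simpa using hθ), fun θ hθ => ?_, ?_⟩
  · obtain ⟨θ', hθ', h⟩ := hs.surjOn (Set.mem_image_of_mem c hθ)
    refine ⟨θ', by simpa using hθ', fun k => ?_⟩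
    have h1 := congrFun h k
    simp only [hc] at h1
    have h2 := (Int.abs_sub_lt_one_of_floor_eq_floor h1).le
    rw [← sub_div, abs_div, abs_of_pos hη, div_le_one hη, sub_sub_sub_cancel_right] at h2
    rwa [abs_sub_comm]
  · calc hsfin.toFinset.card ≤ F.card := by
          refine Finset.card_le_card_of_injOn c (fun θ hθ => ?_) fun a ha b hb hab => ?_
          · exact himg (hs.mapsTo (by simpa using hθ))
          · exact hs.injOn (by simpa using ha) (by simpa using hb) hab
      _ = _ := by
          rw [hF, Fintype.card_piFinset]
          simp only [Int.card_Ico, Finset.prod_const, Finset.card_univ, Fintype.card_fin]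
          congr 1; omega

/-! ### Uniform deviations and the population criterion -/

section Uniform

variable {d p n : ℕ} {ι : Type} [Fintype ι] {Ω : Type*} [MeasurableSpace Ω] {P : Measure Ω}
  [IsProbabilityMeasure P] {ν : Measure (EuclideanSpace ℝ (Fin d))} [IsProbabilityMeasure ν]
  {X : Fin n → Ω → EuclideanSpace ℝ (Fin d)}
  {Θ : Set (EuclideanSpace ℝ (Fin p))} {θ₀ : EuclideanSpace ℝ (Fin p)} {ρ γ B C₁ K : ℝ}
  {g : EstFun ι d p}

omit [IsProbabilityMeasure ν] in
/-- Empirical moments are Lipschitz in the parameter when `regTerm` is bounded. -/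
lemma empMean_sq_sub_le {x : Fin n → EuclideanSpace ℝ (Fin d)} (hM : SmoothModel Θ θ₀ ρ g)
    (hK : 0 ≤ K) (h : ∀ θ ∈ Θ, regTerm γ Θ x g θ ≤ K) {θ θ' : EuclideanSpace ℝ (Fin p)}
    (hθ : θ ∈ Θ) (hθ' : θ' ∈ Θ) {r : ℝ} (hr : 0 ≤ r) (hrk : ∀ k, |θ k - θ' k| ≤ r) (j : ι) :
    empMean (fun i => (g j (x i) θ - g j (x i) θ') ^ 2) ≤ (√K * p * r) ^ 2 := by
  have h1 := empMean_norm_image_sub_sq_le (f := fun i => g j (x i))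
    (f' := fun i θ => fderivWithin ℝ (g j (x i)) Θ θ) (B := √K * p * r) hM.convex
    (fun i θ hθ => hM.hasFDerivWithinAt j (x i) hθ) hθ' hθ (by positivity) fun w hw => ?_
  · simpa only [Real.norm_eq_abs, sq_abs] using h1
  have hwΘ := hM.convex.segment_subset hθ' hθ hw
  obtain ⟨h2, -, -⟩ := regTerm_bounds (h w hwΘ)
  simp only [Real.norm_eq_abs, sq_abs, fderivWithin_apply_eq_sum]
  calc empMean (fun i => (∑ k, pderiv Θ g j (x i) w k * (θ - θ') k) ^ 2)
      ≤ empMean (fun i => (p * r ^ 2) * ∑ k, pderiv Θ g j (x i) w k ^ 2) := by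
        refine empMean_mono fun i => (Finset.sum_mul_sq_le_sq_mul_sq _ _ _).trans ?_
        rw [mul_comm]
        gcongr
        calc ∑ k, ((θ - θ') k) ^ 2 ≤ ∑ _k : Fin p, r ^ 2 := by
              refine Finset.sum_le_sum fun k _ => ?_
              rw [← sq_abs]
              exact pow_le_pow_left₀ (abs_nonneg _) (hrk k) 2
          _ = _ := by simp
    _ = (p * r ^ 2) * ∑ k, empMean (fun i => pderiv Θ g j (x i) w k ^ 2) := by
        rw [empMean_const_mul, empMean_finset_sum]
    _ ≤ (p * r ^ 2) * ∑ _k : Fin p, K := by gcongr; exact h2 j _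
    _ = _ := by
        rw [mul_pow, mul_pow, Real.sq_sqrt hK]; simp; ring

variable (hM : SmoothModel Θ θ₀ ρ g) (hm : MomentModel ν Θ θ₀ g γ B C₁) (hn : 0 < n)
  (hlaw : ∀ i, HasLaw (X i) ν P) (hindep : iIndepFun X P) (hK : 0 ≤ K)
  (hhalf : P.real {ω | ¬ ∀ θ ∈ Θ, regTerm γ Θ (fun i => X i ω) g θ ≤ K} < 1 / 2)

include hM hm hn hlaw hindep hK hhalf

/-- A population bound is read off a single sample. The control of `regTerm` fails with probability
below 1/2 and the Chebyshev bound with probability at most 1/2, so some outcome satisfies both;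
there the empirical mean square is quadratic in the distance. -/
lemma integral_sq_sub_le {θ : EuclideanSpace ℝ (Fin p)} (hθ : θ ∈ Θ) (j : ι) :
    ∫ x, (g j x θ - g j x θ₀) ^ 2 ∂ν
      ≤ (√K * p * vecSup (fun k => θ k - θ₀ k)) ^ 2 + √(32 * (1 + B) / n) := by
  have hn' : (0 : ℝ) < n := by positivity
  have hB := hm.B_nonneg
  have hf4 : MemLp (fun x => g j x θ - g j x θ₀) 4 ν :=
    (hm.memLp_four hM j hθ).sub (hm.memLp_four hM j hM.mem)
  have hfm : Measurable fun x => g j x θ - g j x θ₀ :=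
    (hM.measurable j θ hθ).sub (hM.measurable j θ₀ hM.mem)
  have hsq : MemLp (fun x => (g j x θ - g j x θ₀) ^ 2) 2 ν := by
    simpa only [sq] using memLp_mul_two hf4 hf4
  have h4 : ∫ x, ((g j x θ - g j x θ₀) ^ 2) ^ 2 ∂ν ≤ 16 * (1 + B) := by
    simp only [← pow_mul]
    exact integral_pow_four_sub_le (hm.memLp_four hM j hθ) (hm.memLp_four hM j hM.mem)
      (hm.integral_four_le hM j hθ) (hm.integral_four_le hM j hM.mem)
  have h5 := measureReal_sum_sq_dev_le hn hlaw hindep (κ := Unit)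
    (φ := fun _ x => (g j x θ - g j x θ₀) ^ 2) (fun _ => hfm.pow_const 2) (fun _ => hsq)
    (B := 16 * (1 + B)) (fun _ => h4) (t := 32 * (1 + B) / n) (by positivity)
  have h6 : (Fintype.card Unit : ℝ) * (16 * (1 + B)) / (n * (32 * (1 + B) / n)) = 1 / 2 := by
    have : 1 + B ≠ 0 := by positivity
    simp; field_simp; norm_num
  rw [h6] at h5
  set R := {ω | ¬ ∀ θ ∈ Θ, regTerm γ Θ (fun i => X i ω) g θ ≤ K}
  set Q := {ω | 32 * (1 + B) / n ≤ ∑ _k : Unit, ((empMean fun i =>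
    (g j (X i ω) θ - g j (X i ω) θ₀) ^ 2) - ∫ x, (g j x θ - g j x θ₀) ^ 2 ∂ν) ^ 2} with hQ
  have h7 : R ∪ Q ≠ Set.univ := fun hcon => by
    have h8 := measureReal_union_le (μ := P) R Q
    rw [hcon, probReal_univ] at h8
    linarith
  obtain ⟨ω, hω⟩ := (Set.ne_univ_iff_exists_notMem _).1 h7
  rw [Set.mem_union, not_or] at hω
  obtain ⟨hR, hω2⟩ := hω
  have hR' : ∀ θ ∈ Θ, regTerm γ Θ (fun i => X i ω) g θ ≤ K := by
    by_contra hcon; exact hR hcon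
  have h8 := empMean_sq_sub_le hM hK hR' hθ hM.mem (vecSup_nonneg fun k => θ k - θ₀ k)
    (le_vecSup (fun k => θ k - θ₀ k)) j
  simp only [hQ, Set.mem_ofPred_eq, Finset.univ_unique, Finset.sum_singleton, not_le] at hω2
  have h9 := Real.abs_le_sqrt hω2.le
  linarith [neg_abs_le ((empMean fun i =>
    (g j (X i ω) θ - g j (X i ω) θ₀) ^ 2) - ∫ x, (g j x θ - g j x θ₀) ^ 2 ∂ν)]

/-- Uniform control of the population criterion: outside an event of small probability, the
distance to `θ₀` is bounded by the size of the sample moments. -/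
theorem exists_uniform_event [Nonempty ι] {η ξ : ℝ} (hη : 0 < η) (hξ : 0 ≤ ξ)
    (hsmall : √(10 * ξ / n) * (√K * p) ≤ C₁ / 2) :
    ∃ N : Set Ω, P.real N ≤ (2 * (⌈(1 + B) / C₁ / η⌉₊ + 1) : ℝ) ^ p * Fintype.card ι
        * (2 * Real.exp (-ξ)) ∧
      ∀ ω ∉ N, (∀ θ ∈ Θ, regTerm γ Θ (fun i => X i ω) g θ ≤ K) → ∀ θ ∈ Θ,
        C₁ / 2 * vecSup (fun k => θ k - θ₀ k) ≤ C₁ / 2 * η +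
          (‖empMean fun i => momentVec g (fun i => X i ω) i θ‖
          + ‖empMean fun i => momentVec g (fun i => X i ω) i θ₀‖
          + √K * p * η + √(10 * ξ / n * √(32 * (1 + B) / n))) := by
  have hn' : (0 : ℝ) < n := by positivity
  have hB := hm.B_nonneg
  have hC₁ := hm.C₁_pos
  obtain ⟨T, hTΘ, hTnet, hTcard⟩ := exists_net (p := p) hη fun θ hθ => hm.vecSup_sub_le hM hθ
  set q := √(32 * (1 + B) / n) with hq
  have hqpos : 0 < q := Real.sqrt_pos.2 (by positivity)
  set r : EuclideanSpace ℝ (Fin p) → ℝ := fun θ => vecSup (fun k => θ k - θ₀ k) with hr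
  have hr0 : ∀ θ, 0 ≤ r θ := fun θ => vecSup_nonneg _
  -- The same `A` bounds the population and the empirical second moments of g_j(θ) - g_j(θ₀). Its
  -- quadratic part is absorbed by identification; q, of order n^(-1/2), leaves a lower-order
  -- fluctuation.
  set A : EuclideanSpace ℝ (Fin p) → ℝ := fun θ => (√K * p * r θ) ^ 2 + q with hA
  have hApos : ∀ θ, 0 < A θ := fun θ => by positivity
  set f : EuclideanSpace ℝ (Fin p) × ι → EuclideanSpace ℝ (Fin d) → ℝ :=
    fun k x => g k.2 x k.1 - g k.2 x θ₀ with hf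
  -- Putting the second moment bound inside the event lets the self-normalised inequality apply at
  -- each net point; the bound holds automatically where `regTerm` is controlled.
  set E : EuclideanSpace ℝ (Fin p) × ι → Set Ω := fun k =>
    {ω | √(10 * ξ / n * A k.1) ≤ |(empMean fun i => f k (X i ω)) - ∫ x, f k x ∂ν| ∧
      (empMean fun i => f k (X i ω) ^ 2) ≤ A k.1} with hE
  have hEP : ∀ k ∈ T ×ˢ (Finset.univ : Finset ι), P.real (E k) ≤ 2 * Real.exp (-ξ) := by
    rintro ⟨θ, j⟩ hk
    have hθ : θ ∈ Θ := hTΘ θ (Finset.mem_product.1 hk).1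
    have hf4 : MemLp (f (θ, j)) 4 ν := (hm.memLp_four hM j hθ).sub (hm.memLp_four hM j hM.mem)
    have hfm : Measurable (f (θ, j)) :=
      (hM.measurable j θ hθ).sub (hM.measurable j θ₀ hM.mem)
    have h1 := measureReal_abs_empMean_sub_ge_le hn hlaw hindep hfm (memLp_two_of_four hf4)
      (hApos θ) (integral_sq_sub_le hM hm hn hlaw hindep hK hhalf hθ j)
      (Real.sqrt_nonneg (10 * ξ / n * A θ))
    refine h1.trans_eq ?_
    have h2 : -((n : ℝ) * √(10 * ξ / n * A θ) ^ 2 / (2 * (2 * A θ + 3 * A θ))) = -ξ := by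
      rw [Real.sq_sqrt (by have := hApos θ; positivity)]
      have := (hApos θ).ne'
      field_simp
      ring
    rw [← h2]
  refine ⟨⋃ k ∈ T ×ˢ (Finset.univ : Finset ι), E k, ?_, fun ω hω hreg θ hθ => ?_⟩
  · calc _ ≤ ∑ k ∈ T ×ˢ (Finset.univ : Finset ι), P.real (E k) :=
          measureReal_biUnion_finset_le _ _
      _ ≤ ∑ _k ∈ T ×ˢ (Finset.univ : Finset ι), 2 * Real.exp (-ξ) := Finset.sum_le_sum hEP
      _ = (T.card : ℝ) * Fintype.card ι * (2 * Real.exp (-ξ)) := by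
          rw [Finset.sum_const, Finset.card_product, nsmul_eq_mul]; simp
      _ ≤ _ := by
          gcongr
          exact_mod_cast hTcard
  obtain ⟨θ', hθ'T, hθθ'⟩ := hTnet θ hθ
  have hθ' := hTΘ θ' hθ'T
  have hcoord : ∀ (θ : EuclideanSpace ℝ (Fin p)) j,
      |empMean fun i => g j (X i ω) θ| ≤ ‖empMean fun i => momentVec g (fun i => X i ω) i θ‖ := by
    intro θ j
    have h1 := PiLp.norm_apply_le (empMean fun i => momentVec g (fun i => X i ω) i θ) j
    rwa [ofLp_empMean, Real.norm_eq_abs] at h1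
  set s := √(10 * ξ / n) with hs
  set M := ‖empMean fun i => momentVec g (fun i => X i ω) i θ‖
    + ‖empMean fun i => momentVec g (fun i => X i ω) i θ₀‖
    + √K * p * η + √(10 * ξ / n * q) with hMdef
  have hdev : ∀ j, |popMean ν g θ' j| ≤ M + C₁ / 2 * r θ' := by
    intro j
    have hωE : ω ∉ E (θ', j) := fun hcon => hω (Set.mem_biUnion
      (Finset.mem_coe.2 (Finset.mem_product.2 ⟨hθ'T, Finset.mem_univ j⟩)) hcon)
    have h1 : (empMean fun i => f (θ', j) (X i ω) ^ 2) ≤ A θ' := by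
      have := empMean_sq_sub_le hM hK hreg hθ' hM.mem (hr0 θ')
        (le_vecSup (fun k => θ' k - θ₀ k)) j
      refine this.trans ?_
      simp only [hA]; linarith
    have h2 : |(empMean fun i => f (θ', j) (X i ω)) - ∫ x, f (θ', j) x ∂ν|
        ≤ √(10 * ξ / n * A θ') := by
      by_contra! hcon
      exact hωE ⟨hcon.le, h1⟩
    have h3 : √(10 * ξ / n * A θ') ≤ C₁ / 2 * r θ' + √(10 * ξ / n * q) := by
      calc √(10 * ξ / n * A θ') = √(10 * ξ / n * (√K * p * r θ') ^ 2 + 10 * ξ / n * q) := by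
            simp only [hA]; ring_nf
        _ ≤ √(10 * ξ / n * (√K * p * r θ') ^ 2) + √(10 * ξ / n * q) :=
            Real.sqrt_le_iff.2 ⟨by positivity, by
              rw [add_sq, Real.sq_sqrt (by positivity), Real.sq_sqrt (by positivity)]
              have : 0 ≤ 2 * √(10 * ξ / n * (√K * p * r θ') ^ 2) * √(10 * ξ / n * q) := by
                positivity
              linarith⟩
        _ = s * (√K * p) * r θ' + √(10 * ξ / n * q) := by
            rw [Real.sqrt_mul (by positivity), Real.sqrt_sq (by have := hr0 θ'; positivity)]
            ring
        _ ≤ _ := by have := hr0 θ'; gcongr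
    have h4 : ∫ x, f (θ', j) x ∂ν = popMean ν g θ' j := by
      simp only [hf]
      rw [integral_sub ((hm.memLp_four hM j hθ').integrable (by norm_num))
        ((hm.memLp_four hM j hM.mem).integrable (by norm_num)), hm.mean_zero j, sub_zero]
      rfl
    have h5 : (empMean fun i => f (θ', j) (X i ω))
        = (empMean fun i => g j (X i ω) θ') - empMean fun i => g j (X i ω) θ₀ := empMean_sub _ _
    have h6 : |(empMean fun i => g j (X i ω) θ') - empMean fun i => g j (X i ω) θ|
        ≤ √K * p * η := by
      rw [← empMean_sub]
      apply abs_le_of_sq_le_sq _ (by positivity)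
      refine (sq_empMean_le _).trans (empMean_sq_sub_le hM hK hreg hθ' hθ hη.le (fun k => ?_) j)
      rw [abs_sub_comm]; exact hθθ' k
    have h7 := hcoord θ j
    have h8 := hcoord θ₀ j
    rw [h4, h5] at h2
    have h9 := h2.trans h3
    rw [abs_le] at h6 h7 h8 h9 ⊢
    constructor <;> linarith [h6.1, h6.2, h7.1, h7.2, h8.1, h8.2, h9.1, h9.2]
  have hident := hm.vecSup_sub_le_of_popMean_le hθ' hdev
  -- With no coordinates the supremum takes its default value 0.
  have htri : r θ ≤ r θ' + η := by
    rcases isEmpty_or_nonempty (Fin p) with hp | hp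
    · have : r θ = 0 := Real.iSup_of_isEmpty _
      rw [this]; have := hr0 θ'; linarith
    · refine vecSup_le fun k => ?_
      have h1 := le_vecSup (fun k => θ' k - θ₀ k) k
      have h2 := hθθ' k
      calc |θ k - θ₀ k| ≤ |θ k - θ' k| + |θ' k - θ₀ k| := abs_sub_le _ _ _
        _ ≤ _ := by simp only [hr]; linarith
  have h10 : C₁ / 2 * r θ ≤ C₁ / 2 * (r θ' + η) := by gcongr
  -- The deviation costs half of the identification slope, so half of it survives.
  have h11 : C₁ * r θ' ≤ M + C₁ / 2 * r θ' := hident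
  change C₁ / 2 * r θ ≤ C₁ / 2 * η + M
  linarith

end Uniform

/-! ### The efficient direction -/

section EfficientDirection

variable {ι κ : Type} [Fintype ι] [DecidableEq ι] [Fintype κ] [DecidableEq κ]

omit [Fintype κ] [DecidableEq κ] in
lemma tensorSq_mul_symPow {V : Matrix ι ι ℝ} (hV : V.PosDef) (D : Matrix ι κ ℝ) :
    tensorSq (Dᵀ * symPow V (-(1 / 2))) = Dᵀ * V⁻¹ * D := by
  rw [tensorSq, Matrix.transpose_mul, symPow_transpose, Matrix.transpose_transpose,
    ← symPow_neg_one hV, Matrix.mul_assoc, ← Matrix.mul_assoc (symPow V _), symPow_mul_symPow hV,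
    Matrix.mul_assoc]
  norm_num

omit [DecidableEq ι] in
lemma posDef_of_inner_ge {V : Matrix ι ι ℝ} (hV : V.IsHermitian) {c : ℝ} (hc : 0 < c)
    (h : ∀ u : EuclideanSpace ℝ ι, c * ‖u‖ ^ 2 ≤ ⟪u, matCLM V u⟫) : V.PosDef := by
  refine Matrix.PosDef.of_dotProduct_mulVec_pos hV fun x hx => ?_
  have h1 := h (WithLp.toLp 2 x)
  rw [inner_eq_dotProduct, ofLp_matCLM] at h1
  refine lt_of_lt_of_le ?_ h1
  have : WithLp.toLp 2 x ≠ 0 := fun h => hx (by simpa using congrArg WithLp.ofLp h)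
  have := norm_pos_iff.2 this
  positivity

/-- The direction in the space of moments along which the estimator is asymptotically normal. -/
lemma exists_efficient_direction {V : Matrix ι ι ℝ} (hV : V.IsHermitian) {D : Matrix ι κ ℝ} {C : ℝ}
    (h1C : 1 ≤ C)
    (hV' : ∀ u : EuclideanSpace ℝ ι, C⁻¹ * ‖u‖ ^ 2 ≤ ⟪u, matCLM V u⟫ ∧
      ⟪u, matCLM V u⟫ ≤ C * ‖u‖ ^ 2)
    (hD : ∀ v : EuclideanSpace ℝ κ, ‖v‖ ≤ C * ‖matCLM D v‖) {α : EuclideanSpace ℝ κ}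
    (hα : ‖α‖ = 1) :
    ∃ (v : EuclideanSpace ℝ κ) (w : EuclideanSpace ℝ ι),
      ⟪w, matCLM V w⟫ = 1 ∧ ‖w‖ ^ 2 ≤ C ∧ ‖v‖ ≤ C ^ 2 ∧
      ∀ (z : EuclideanSpace ℝ ι) (δ : EuclideanSpace ℝ κ),
        ∃ μ, matCLM V μ = z + matCLM D δ ∧ ⟪matCLM D v, μ⟫ = ⟪w, z⟫ +
          α.ofLp ⬝ᵥ (symPow (tensorSq (Dᵀ * symPow V (-(1 / 2)))) (1 / 2) *ᵥ δ.ofLp) := by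
  have hC : 0 < C := by linarith
  have hVpos : V.PosDef := posDef_of_inner_ge hV (inv_pos.2 hC) fun u => (hV' u).1
  have hVu : IsUnit V.det := (Matrix.isUnit_iff_isUnit_det _).1 hVpos.isUnit
  have hVT : Vᵀ = V := by
    rw [← Matrix.conjTranspose_eq_transpose_of_trivial]; exact hV
  have hViT : (V⁻¹)ᵀ = V⁻¹ := by rw [Matrix.transpose_nonsing_inv, hVT]
  set J := tensorSq (Dᵀ * symPow V (-(1 / 2))) with hJ
  have hJD : J = Dᵀ * V⁻¹ * D := tensorSq_mul_symPow hVpos D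
  have hDinj : Function.Injective D.mulVec := by
    intro x y hxy
    have h1 := hD (WithLp.toLp 2 (x - y))
    have h2 : matCLM D (WithLp.toLp 2 (x - y)) = 0 := by
      apply WithLp.ofLp_injective 2
      rw [ofLp_matCLM]
      simp [Matrix.mulVec_sub, hxy]
    rw [h2, norm_zero, mul_zero] at h1
    have h3 := norm_le_zero_iff.1 h1
    exact sub_eq_zero.1 (by simpa using congrArg WithLp.ofLp h3)
  have hJpos : J.PosDef := by
    rw [hJD, ← Matrix.conjTranspose_eq_transpose_of_trivial]
    exact hVpos.inv.conjTranspose_mul_mul_same hDinj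
  set R := symPow J (-(1 / 2)) with hR
  have hRT : Rᵀ = R := symPow_transpose _ _
  have hRJ : R * J = symPow J (1 / 2) := by
    rw [hR]
    nth_rw 2 [← symPow_one hJpos.isHermitian]
    rw [symPow_mul_symPow hJpos]; norm_num
  have hRJR : R * J * R = 1 := by
    rw [hRJ, hR, symPow_mul_symPow hJpos, add_neg_cancel, symPow_zero hJpos.isHermitian]
  -- With R = J^(-1/2), the form ⟪w, V w⟫ becomes αᵀ R J R α = 1, and R J = J^(1/2) produces the
  -- required coefficient of δ.
  set v : EuclideanSpace ℝ κ := matCLM R α with hv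
  set w : EuclideanSpace ℝ ι := matCLM V⁻¹ (matCLM D v) with hw
  have hVw : matCLM V w = matCLM D v := by
    apply WithLp.ofLp_injective 2
    rw [hw, ofLp_matCLM, ofLp_matCLM V⁻¹, Matrix.mulVec_mulVec, Matrix.mul_nonsing_inv _ hVu,
      Matrix.one_mulVec]
  have hadj : ∀ (z : EuclideanSpace ℝ ι), ⟪matCLM D v, matCLM V⁻¹ z⟫ = ⟪w, z⟫ := by
    intro z
    rw [hw, inner_eq_dotProduct, inner_eq_dotProduct, ofLp_matCLM V⁻¹, ofLp_matCLM V⁻¹,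
      Matrix.dotProduct_mulVec, ← Matrix.mulVec_transpose, hViT]
  have hadj' : ∀ (δ : EuclideanSpace ℝ κ), ⟪w, matCLM D δ⟫ = α.ofLp ⬝ᵥ ((R * J) *ᵥ δ.ofLp) := by
    intro δ
    rw [hw, hv, inner_eq_dotProduct]
    simp only [ofLp_matCLM, Matrix.mulVec_mulVec]
    rw [Matrix.dotProduct_mulVec, ← Matrix.mulVec_transpose, Matrix.mulVec_mulVec,
      dotProduct_comm, Matrix.dotProduct_mulVec, ← Matrix.mulVec_transpose, dotProduct_comm]
    congr 2
    rw [hJD]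
    simp only [Matrix.transpose_mul, Matrix.transpose_transpose, hRT, hViT, Matrix.mul_assoc]
  have hone : ⟪w, matCLM V w⟫ = 1 := by
    rw [hVw, hadj', hv, ofLp_matCLM, Matrix.mulVec_mulVec, hRJR, Matrix.one_mulVec,
      ← sq_norm_eq_dotProduct, hα, one_pow]
  have hwC : ‖w‖ ^ 2 ≤ C := by
    have := (hV' w).1
    rwa [hone, inv_mul_le_iff₀ hC, mul_one] at this
  -- Here D v = V w. With S = V^(1/2), ‖V w‖² = ⟪S w, V (S w)⟫ ≤ C ‖S w‖², and ‖S w‖² = ⟪w, V w⟫ =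
  -- 1.
  have hDv : ‖matCLM D v‖ ≤ C := by
    rw [← hVw]
    set S := symPow V (1 / 2) with hS
    have hSS : S * S = V := by
      rw [hS, symPow_mul_symPow hVpos]; norm_num
      exact symPow_one hVpos.isHermitian
    have hST : Sᵀ = S := symPow_transpose _ _
    have hSinner : ∀ a : EuclideanSpace ℝ ι, ⟪a, matCLM V a⟫ = ‖matCLM S a‖ ^ 2 := fun a => by
      rw [sq_norm_eq_dotProduct, inner_eq_dotProduct, ofLp_matCLM, ofLp_matCLM, ← hSS,
        ← Matrix.mulVec_mulVec, Matrix.dotProduct_mulVec, ← Matrix.mulVec_transpose, hST]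
    have h2 : ∀ u, matCLM V u = matCLM S (matCLM S u) := fun u => by
      apply WithLp.ofLp_injective 2
      rw [ofLp_matCLM, ofLp_matCLM, ofLp_matCLM, Matrix.mulVec_mulVec, hSS]
    have h3 : ‖matCLM S w‖ ^ 2 = 1 := by rw [← hSinner, hone]
    have h4 : ‖matCLM V w‖ ^ 2 ≤ C := by
      rw [h2, ← hSinner]
      refine (hV' _).2.trans_eq ?_
      rw [h3, mul_one]
    apply le_of_sq_le_sq _ hC.le
    nlinarith
  refine ⟨v, w, hone, hwC, ?_, fun z δ => ⟨matCLM V⁻¹ (z + matCLM D δ), ?_, ?_⟩⟩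
  · refine (hD v).trans ?_
    rw [sq]; gcongr
  · apply WithLp.ofLp_injective 2
    rw [ofLp_matCLM, ofLp_matCLM V⁻¹, Matrix.mulVec_mulVec, Matrix.mul_nonsing_inv _ hVu,
      Matrix.one_mulVec]
  · rw [hadj, inner_add_right, hadj', hRJ]

end EfficientDirection

/-! ### Rates -/

section Deterministic

variable {n : ℕ} {E H : Type*} [NormedAddCommGroup E] [InnerProductSpace ℝ E]
  [NormedAddCommGroup H] [InnerProductSpace ℝ H] [FiniteDimensional ℝ H]
  {Θ : Set E} {θ₀ θhat : E} {g : Fin n → E → H} {g' : Fin n → E → E →L[ℝ] H}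
  {D : E →L[ℝ] H} {V : H →L[ℝ] H} {C a b L S e eV κ : ℝ} {𝒱 : Set ℝ}

/-- The constant in the rate of convergence. -/
def rateConst (C : ℝ) : ℝ := 2 * C * (17 * C ^ 2 + 1) + 1

lemma one_le_rateConst (hC : 1 ≤ C) : 1 ≤ rateConst C := by
  unfold rateConst; nlinarith [sq_nonneg C]

/-- The estimator is asymptotically linear as soon as it is in a neighbourhood where the
derivative of the sample moments is stable. -/
theorem RegularSample.abs_inner_le_of_close (hR : RegularSample Θ θ₀ g g' D V C a b L S e eV)
    (hκ : κ ≤ 1 / 8) (h𝒱 : ∀ y, |y| ≤ κ → y ∈ 𝒱) (h𝒱' : 𝒱 ⊆ Set.Ioi (-1))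
    (hmin : IsProfileMin 𝒱 Θ g θhat) (he : C * e ≤ 1 / 4)
    (hS : C * (S * ‖θhat - θ₀‖) ≤ 1 / 4) (hball : Metric.ball θ₀ (rateConst C * a) ⊆ Θ)
    (heS : e + S * (rateConst C * a) ≤ C) (hab : 13 * C ^ 2 * rateConst C * a * b ≤ κ) {μ : H}
    (hμ : V μ = (empMean fun i => g i θ₀) + D (θhat - θ₀)) (v : E) :
    |⟪D v, μ⟫| ≤ ‖v‖ * (6 * C ^ 3 * (13 * C ^ 2 * rateConst C * (a * (e + eV))
      + (13 * C ^ 2 * rateConst C) ^ 2 * (a ^ 2 * (L + S + b)))) := by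
  have hC := hR.C_pos
  have h1C := hR.one_le
  have ha := hR.a_pos
  have hb := hR.b_nonneg
  set M := rateConst C with hM
  have hM1 : 1 ≤ M := one_le_rateConst h1C
  have hCC : C ≤ C ^ 2 := le_self_pow₀ h1C two_ne_zero
  have hCCM : C ≤ C ^ 2 * M := by nlinarith [sq_nonneg C]
  have h1 := hR.norm_empMean_estimate_le hκ h𝒱 h𝒱' hmin (by
    refine le_trans ?_ hab
    have : 8 * C ≤ 13 * C ^ 2 * M := by nlinarith
    gcongr)
  have h2 := hR.norm_estimate_sub_le hmin.mem h1 he hS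
  have hr : ‖θhat - θ₀‖ < M * a := by
    refine h2.trans_lt ?_
    simp only [hM, rateConst]
    nlinarith
  rcases eq_or_ne v 0 with rfl | hv
  · simp
  have hv' := norm_pos_iff.2 hv
  -- The radius is M a. The requirement 4C(a + 2CMa) < Λ needs at most 12 C² M a, so the factor 13
  -- leaves room for strictness. The direction is normalised because that bound is for unit vectors.
  have h3 := hR.abs_inner_le hκ h𝒱 h𝒱' hmin hr hball (Λ := 13 * C ^ 2 * M * a) (by
      have : 1 ≤ C ^ 2 := by nlinarith
      have : M ≤ 13 * C ^ 2 * M := by nlinarith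
      nlinarith) heS (by
      have h4 : C * a ≤ C ^ 2 * M * a := by gcongr
      have h5 : 0 < C ^ 2 * M * a := by positivity
      nlinarith) hab hμ (v := ‖v‖⁻¹ • v) (by
      rw [norm_smul, norm_inv, norm_norm, inv_mul_cancel₀ hv'.ne'])
  rw [map_smul, inner_smul_left, abs_mul, RCLike.conj_to_real, abs_of_pos (inv_pos.2 hv'),
    inv_mul_le_iff₀ hv'] at h3
  refine h3.trans_eq ?_
  ring

end Deterministic

lemma le_mul_sqrt_of_sq_le {x y c : ℝ} (hc : 0 ≤ c) (hy : 0 ≤ y) (h : x ^ 2 ≤ c ^ 2 * y) :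
    x ≤ c * √y := by
  apply le_of_sq_le_sq _ (by positivity)
  rwa [mul_pow, Real.sq_sqrt hy]

/-! ### Products of error sizes in terms of n, h and p -/

section Rates

/-- Rates in terms of `n`, the number `h` of moments and the number `p` of parameters. -/
structure RateBounds (n h p K γ : ℝ) : Prop where
  n_pos : 0 < n
  one_le_p : 1 ≤ p
  p_le_h : p ≤ h
  one_le_K : 1 ≤ K
  gamma : 2 ≤ γ

variable {n h p K γ : ℝ} (hr : RateBounds n h p K γ)

namespace RateBounds

include hr

lemma p_pos : 0 < p := zero_lt_one.trans_le hr.one_le_p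

lemma h_pos : 0 < h := hr.p_pos.trans_le hr.p_le_h

lemma one_le_h : 1 ≤ h := hr.one_le_p.trans hr.p_le_h

lemma K_pos : 0 < K := zero_lt_one.trans_le hr.one_le_K

lemma K_le_sq : K ≤ K ^ 2 := le_self_pow₀ hr.one_le_K two_ne_zero

lemma h_le_cube : h ≤ h ^ 3 * p ^ 2 := by
  calc h = h * 1 * 1 := by ring
    _ ≤ h * h ^ 2 * p ^ 2 := by
      have := hr.h_pos
      have := hr.one_le_h
      have := hr.one_le_p
      gcongr
      · exact one_le_pow₀ hr.one_le_h
      · exact one_le_pow₀ hr.one_le_p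
    _ = _ := by ring

lemma score_rate : K * √(h / n) ≤ K * √(h ^ 3 * p ^ 2 / n) := by
  have := hr.n_pos
  have := hr.K_pos
  have := hr.h_le_cube
  gcongr

lemma grad_rate : K * √(h * p / n) ≤ K * √(h ^ 3 * p ^ 2 / n) := by
  have := hr.n_pos
  have := hr.K_pos
  have := hr.p_pos
  have := hr.h_pos
  gcongr
  · exact le_self_pow₀ hr.one_le_h (by norm_num)
  · exact le_self_pow₀ hr.one_le_p two_ne_zero

lemma second_rate : K * (h / √n) ≤ K * √(h ^ 3 * p ^ 2 / n) := by
  have hn := hr.n_pos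
  have := hr.K_pos
  have hh := hr.h_pos
  gcongr
  apply Real.le_sqrt_of_sq_le
  rw [div_pow, Real.sq_sqrt hn.le]
  gcongr
  calc h ^ 2 = h ^ 2 * 1 * 1 := by ring
    _ ≤ h ^ 2 * h * p ^ 2 := by
      gcongr
      · exact hr.one_le_h
      · exact one_le_pow₀ hr.one_le_p
    _ = _ := by ring

/-- Size of the derivative Lipschitz constant against the preliminary rate. -/
lemma lip_rate : √(h * K) * p * (√p * √(h / n)) ≤ K * √(h ^ 3 * p ^ 2 / n) := by
  have hn := hr.n_pos
  have hK := hr.K_pos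
  have hp := hr.p_pos
  have hh := hr.h_pos
  refine le_mul_sqrt_of_sq_le hK.le (by positivity) ?_
  simp only [mul_pow]
  rw [Real.sq_sqrt (by positivity), Real.sq_sqrt (by positivity), Real.sq_sqrt (by positivity)]
  calc _ = K * (h * h * p * p ^ 2 / n) := by ring
    _ ≤ K ^ 2 * (h * h * h * p ^ 2 / n) := by
      have := hr.K_le_sq
      have := hr.p_le_h
      gcongr
    _ = _ := by ring

lemma lip_score_rate : √(h * K) * p * (K * √(h / n)) ≤ K ^ 2 * √(h ^ 3 * p ^ 2 / n) := by
  have hn := hr.n_pos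
  have hK := hr.K_pos
  have hp := hr.p_pos
  have hh := hr.h_pos
  calc _ = K * (√(h * K) * p * (1 * √(h / n))) := by ring
    _ ≤ K * (√(h * K) * p * (√p * √(h / n))) := by
      gcongr
      exact Real.one_le_sqrt.2 hr.one_le_p
    _ ≤ K * (K * √(h ^ 3 * p ^ 2 / n)) := mul_le_mul_of_nonneg_left hr.lip_rate hK.le
    _ = _ := by ring

/-- Writing n^(2/γ) as n^(-1+2/γ) · n exposes the factor of the growth condition; K^(2/γ) ≤ K
because K ≥ 1 and γ ≥ 2. -/
lemma sq_envelope : (√h * (n * K) ^ γ⁻¹) ^ 2 ≤ h * K * (n ^ (-1 + 2 / γ) * n) := by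
  have hn := hr.n_pos
  have hK := hr.K_pos
  have hh := hr.h_pos
  have hγ : 0 < γ := by linarith [hr.gamma]
  have h1 : ((n * K) ^ γ⁻¹) ^ 2 = n ^ (2 / γ) * K ^ (2 / γ) := by
    rw [← Real.rpow_natCast, ← Real.rpow_mul (by positivity), Real.mul_rpow hn.le hK.le]
    congr 2 <;> push_cast <;> ring
  have h2 : K ^ (2 / γ) ≤ K := by
    conv_rhs => rw [← Real.rpow_one K]
    exact Real.rpow_le_rpow_of_exponent_le hr.one_le_K ((div_le_one hγ).2 hr.gamma)
  have h3 : n ^ (-1 + 2 / γ) * n = n ^ (2 / γ) := by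
    rw [← Real.rpow_add_one hn.ne']
    congr 1; ring
  rw [mul_pow, Real.sq_sqrt hh.le, h1, h3]
  calc _ = h * (n ^ (2 / γ) * K ^ (2 / γ)) := rfl
    _ ≤ h * (n ^ (2 / γ) * K) := by gcongr
    _ = _ := by ring

lemma score_envelope_rate : K * √(h / n) * (√h * (n * K) ^ γ⁻¹)
    ≤ K ^ 2 * √(h ^ 3 * n ^ (-1 + 2 / γ)) := by
  have hn := hr.n_pos
  have hK := hr.K_pos
  have hh := hr.h_pos
  refine le_mul_sqrt_of_sq_le (by positivity) (by positivity) ?_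
  rw [mul_pow, mul_pow, Real.sq_sqrt (by positivity)]
  calc _ ≤ K ^ 2 * (h / n) * (h * K * (n ^ (-1 + 2 / γ) * n)) := by
        gcongr; exact hr.sq_envelope
    _ = K ^ 3 * (h ^ 2 * n ^ (-1 + 2 / γ)) := by field_simp
    _ ≤ K ^ 4 * (h ^ 3 * n ^ (-1 + 2 / γ)) := by
      gcongr
      · exact hr.one_le_K
      · norm_num
      · exact hr.one_le_h
      · norm_num
    _ = _ := by ring

/-- The term √n a (e + eV): here √n a is of order √h, and multiplying by √(hp/n) and h/√n stays
within √(h³p²/n). -/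
lemma first_remainder_rate : √n * (K * √(h / n) * (K * √(h * p / n) + K * (h / √n)))
    ≤ 2 * K ^ 2 * √(h ^ 3 * p ^ 2 / n) := by
  have hn := hr.n_pos
  have hK := hr.K_pos
  have hp := hr.p_pos
  have hh := hr.h_pos
  have h1 : √n * (K * √(h / n)) = K * √h := by
    rw [Real.sqrt_div hh.le]
    have := (Real.sqrt_pos.2 hn).ne'
    field_simp
  have h2 : √h * √(h * p / n) ≤ √(h ^ 3 * p ^ 2 / n) := by
    rw [← Real.sqrt_mul hh.le]
    apply Real.sqrt_le_sqrt
    rw [← mul_div_assoc]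
    refine div_le_div_of_nonneg_right ?_ hn.le
    calc h * (h * p) = h ^ 2 * p := by ring
      _ ≤ h ^ 3 * p ^ 2 := by
        gcongr
        · exact hr.one_le_h
        · norm_num
        · exact le_self_pow₀ hr.one_le_p two_ne_zero
  have h3 : √h * (h / √n) ≤ √(h ^ 3 * p ^ 2 / n) := by
    apply Real.le_sqrt_of_sq_le
    rw [mul_pow, div_pow, Real.sq_sqrt hh.le, Real.sq_sqrt hn.le, ← mul_div_assoc]
    refine div_le_div_of_nonneg_right ?_ hn.le
    calc h * h ^ 2 = h ^ 3 * 1 := by ring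
      _ ≤ _ := by
        gcongr
        exact one_le_pow₀ hr.one_le_p
  calc _ = √n * (K * √(h / n)) * (K * √(h * p / n) + K * (h / √n)) := by ring
    _ = K ^ 2 * (√h * √(h * p / n) + √h * (h / √n)) := by rw [h1]; ring
    _ ≤ K ^ 2 * (√(h ^ 3 * p ^ 2 / n) + √(h ^ 3 * p ^ 2 / n)) := by gcongr
    _ = _ := by ring

/-- The term √n a² (L + S + b), where √n a² is of order h/√n. The constant S exhausts the condition
on h³p²/n, and the envelope b the condition on h³ n^(-1+2/γ). -/
lemma second_remainder_rate : √n * ((K * √(h / n)) ^ 2 * (√(h * p * K) + √(h * K) * p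
      + √h * (n * K) ^ γ⁻¹))
    ≤ 2 * K ^ 3 * √(h ^ 3 * p ^ 2 / n) + K ^ 3 * √(h ^ 3 * n ^ (-1 + 2 / γ)) := by
  have hn := hr.n_pos
  have hK := hr.K_pos
  have hp := hr.p_pos
  have hh := hr.h_pos
  have hsn := Real.sqrt_pos.2 hn
  have h1 : √n * (K * √(h / n)) ^ 2 = K ^ 2 * (h / √n) := by
    rw [mul_pow, Real.sq_sqrt (by positivity)]
    have : n = √n ^ 2 := (Real.sq_sqrt hn.le).symm
    field_simp
    rw [← this]
  have hKK : K ≤ K ^ 2 := hr.K_le_sq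
  have hpp : p ≤ p ^ 2 := le_self_pow₀ hr.one_le_p two_ne_zero
  have h2 : h / √n * √(h * p * K) ≤ K * √(h ^ 3 * p ^ 2 / n) := by
    refine le_mul_sqrt_of_sq_le hK.le (by positivity) ?_
    rw [mul_pow, div_pow, Real.sq_sqrt hn.le, Real.sq_sqrt (by positivity)]
    calc _ = K * (h ^ 3 * p / n) := by ring
      _ ≤ _ := by gcongr
  have h3 : h / √n * (√(h * K) * p) ≤ K * √(h ^ 3 * p ^ 2 / n) := by
    refine le_mul_sqrt_of_sq_le hK.le (by positivity) ?_
    rw [mul_pow, div_pow, mul_pow, Real.sq_sqrt hn.le, Real.sq_sqrt (by positivity)]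
    calc _ = K * (h ^ 3 * p ^ 2 / n) := by ring
      _ ≤ _ := by gcongr
  have h4 : h / √n * (√h * (n * K) ^ γ⁻¹) ≤ K * √(h ^ 3 * n ^ (-1 + 2 / γ)) := by
    refine le_mul_sqrt_of_sq_le hK.le (by positivity) ?_
    rw [mul_pow, div_pow, Real.sq_sqrt hn.le]
    calc _ ≤ h ^ 2 / n * (h * K * (n ^ (-1 + 2 / γ) * n)) := by
          gcongr; exact hr.sq_envelope
      _ = K * (h ^ 3 * n ^ (-1 + 2 / γ)) := by field_simp
      _ ≤ _ := by gcongr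
  rw [← mul_assoc, h1]
  calc _ = K ^ 2 * (h / √n * √(h * p * K) + h / √n * (√(h * K) * p)
        + h / √n * (√h * (n * K) ^ γ⁻¹)) := by ring
    _ ≤ K ^ 2 * (K * √(h ^ 3 * p ^ 2 / n) + K * √(h ^ 3 * p ^ 2 / n)
        + K * √(h ^ 3 * n ^ (-1 + 2 / γ))) := by gcongr
    _ = _ := by ring

end RateBounds

end Rates

/-! ### Linearisation of the estimator on good samples -/

section GoodSample

variable {d p n : ℕ} {ι : Type} [Fintype ι]
  {Θ : Set (EuclideanSpace ℝ (Fin p))} {θ₀ : EuclideanSpace ℝ (Fin p)} {ρ : ℝ}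
  {g : EstFun ι d p} {x : Fin n → EuclideanSpace ℝ (Fin d)}
  {ν : Measure (EuclideanSpace ℝ (Fin d))} {γ C₁ C₃ C₄ C K U κ : ℝ} {𝒱 : Set ℝ}
  {t : EuclideanSpace ℝ (Fin p)}

/-- Control of the fluctuations of the sample moments at `θ₀`. -/
structure CenteredSample (ν : Measure (EuclideanSpace ℝ (Fin d)))
    (Θ : Set (EuclideanSpace ℝ (Fin p))) (θ₀ : EuclideanSpace ℝ (Fin p)) (g : EstFun ι d p)
    (C₃ K : ℝ) (x : Fin n → EuclideanSpace ℝ (Fin d)) : Prop where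
  eig : ∀ θ ∈ Θ, ∀ u : EuclideanSpace ℝ ι,
      C₃⁻¹ * ‖u‖ ^ 2 ≤ (empMean fun i => ⟪u, momentVec g x i θ⟫ ^ 2) ∧
        (empMean fun i => ⟪u, momentVec g x i θ⟫ ^ 2) ≤ C₃ * ‖u‖ ^ 2
  score : ∑ j, (empMean fun i => g j (x i) θ₀) ^ 2 ≤ (K * √(Fintype.card ι / n)) ^ 2
  grad : ∑ j, ∑ k, (empMean (fun i => pderiv Θ g j (x i) θ₀ k)
      - ∫ y, pderiv Θ g j y θ₀ k ∂ν) ^ 2 ≤ (K * √(Fintype.card ι * p / n)) ^ 2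
  second : ∑ j, ∑ k, (empMean (fun i => g j (x i) θ₀ * g k (x i) θ₀)
      - ∫ y, g j y θ₀ * g k y θ₀ ∂ν) ^ 2 ≤ (K * (Fintype.card ι / √n)) ^ 2

/-- Control of the sample moments, uniformly over the parameter set. -/
structure GoodSample (ν : Measure (EuclideanSpace ℝ (Fin d)))
    (Θ : Set (EuclideanSpace ℝ (Fin p))) (θ₀ : EuclideanSpace ℝ (Fin p)) (g : EstFun ι d p)
    (γ C₁ C₃ K U : ℝ) (x : Fin n → EuclideanSpace ℝ (Fin d)) : Prop
    extends CenteredSample ν Θ θ₀ g C₃ K x where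
  reg : ∀ θ ∈ Θ, regTerm γ Θ x g θ ≤ K
  uniform : ∀ θ ∈ Θ, C₁ / 2 * vecSup (fun k => θ k - θ₀ k) ≤
    ‖empMean fun i => momentVec g x i θ‖ + ‖empMean fun i => momentVec g x i θ₀‖
      + U * √(Fintype.card ι / n)

lemma norm_le_sqrt_mul_vecSup (v : EuclideanSpace ℝ (Fin p)) :
    ‖v‖ ≤ √p * vecSup (fun k => v k) := by
  have h0 : 0 ≤ vecSup (fun k => v k) := vecSup_nonneg _
  apply le_of_sq_le_sq _ (by positivity)
  rw [EuclideanSpace.real_norm_sq_eq, mul_pow, Real.sq_sqrt (by positivity)]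
  calc ∑ k, v k ^ 2 ≤ ∑ _k : Fin p, vecSup (fun k => v k) ^ 2 := by
        refine Finset.sum_le_sum fun k _ => ?_
        rw [← sq_abs]
        exact pow_le_pow_left₀ (abs_nonneg _) (le_vecSup (fun k => v k) k) 2
    _ = _ := by simp

/-- Bounds on the quadratic form of the population second moment matrix. -/
lemma CenteredSample.popV_bounds (hG : CenteredSample ν Θ θ₀ g C₃ K x) (hθ₀ : θ₀ ∈ Θ)
    (hC₃ : 1 ≤ C₃) (hC : 2 * C₃ ≤ C) (hK : 0 ≤ K)
    (heV : K * (Fintype.card ι / √n) ≤ (2 * C₃)⁻¹) (u : EuclideanSpace ℝ ι) :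
    C⁻¹ * ‖u‖ ^ 2 ≤ ⟪u, matCLM (popV ν g θ₀) u⟫ ∧ ⟪u, matCLM (popV ν g θ₀) u⟫ ≤ C * ‖u‖ ^ 2 := by
  have he : 0 ≤ K * (Fintype.card ι / √n) := by positivity
  have h0 : (2 * C₃)⁻¹ ≤ 1 := inv_le_one_of_one_le₀ (by linarith)
  constructor
  · refine le_trans ?_ (inner_matCLM_popV_ge he (fun u => (hG.eig θ₀ hθ₀ u).1) hG.second u)
    gcongr
    have h1 : C₃⁻¹ = (2 * C₃)⁻¹ + (2 * C₃)⁻¹ := by field_simp; norm_num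
    have h2 : C⁻¹ ≤ (2 * C₃)⁻¹ := inv_anti₀ (by linarith) hC
    linarith
  · have h1 := norm_empMean_momentVec_sub_matCLM_le he hG.second u
    have h2 : ⟪u, empMean fun i => ⟪u, momentVec g x i θ₀⟫ • momentVec g x i θ₀⟫
        = empMean fun i => ⟪u, momentVec g x i θ₀⟫ ^ 2 := by
      rw [inner_empMean]
      congr 1; ext i
      rw [inner_smul_right, sq]
    have h3 := neg_le_of_abs_le (abs_real_inner_le_norm u
      (empMean (fun i => ⟪u, momentVec g x i θ₀⟫ • momentVec g x i θ₀)
        - matCLM (popV ν g θ₀) u))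
    rw [inner_sub_right, h2] at h3
    have h4 : ‖u‖ * ‖empMean (fun i => ⟪u, momentVec g x i θ₀⟫ • momentVec g x i θ₀)
        - matCLM (popV ν g θ₀) u‖ ≤ ‖u‖ * (1 * ‖u‖) := by
      gcongr
      exact h1.trans (by gcongr; linarith)
    have h5 := (hG.eig θ₀ hθ₀ u).2
    have h6 : (C₃ + 1) * ‖u‖ ^ 2 ≤ C * ‖u‖ ^ 2 := by gcongr; linarith
    nlinarith

/-- The constants in the consistency and linearisation bounds are dominated by the rates. -/
structure SmallRates (n h p : ℕ) (γ ρ C C₁ C₃ K U κ : ℝ) : Prop where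
  second : K * √((h : ℝ) ^ 3 * p ^ 2 / n) ≤ (2 * C₃)⁻¹
  grad : C * (K * √((h : ℝ) ^ 3 * p ^ 2 / n)) ≤ 1 / 4
  close : C * (2 / C₁ * ((17 * C ^ 2 + 1) * K + U) * (K * √((h : ℝ) ^ 3 * p ^ 2 / n))) ≤ 1 / 4
  ball : rateConst C * (K * √((h : ℝ) ^ 3 * p ^ 2 / n)) ≤ ρ
  lip : K * √((h : ℝ) ^ 3 * p ^ 2 / n)
    + rateConst C * (K ^ 2 * √((h : ℝ) ^ 3 * p ^ 2 / n)) ≤ C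
  envelope : 13 * C ^ 2 * rateConst C * (K ^ 2 * √((h : ℝ) ^ 3 * (n : ℝ) ^ (-1 + 2 / γ))) ≤ κ

/-- The remainder in the linearisation of the estimator. -/
def remainder (C K s t : ℝ) : ℝ :=
  C ^ 2 * (6 * C ^ 3 * (13 * C ^ 2 * rateConst C * (2 * K ^ 2 * s)
    + (13 * C ^ 2 * rateConst C) ^ 2 * (2 * K ^ 3 * s + K ^ 3 * t)))

/-- Linearisation of the estimator on good samples. -/
theorem GoodSample.abs_sqrt_mul_inner_le [Nonempty (Fin p)]
    (hG : GoodSample ν Θ θ₀ g γ C₁ C₃ K U x) (hM : SmoothModel Θ θ₀ ρ g) (hγ : 2 ≤ γ)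
    (hC₁ : 0 < C₁) (hC₃ : 1 ≤ C₃) (hC₄ : 1 ≤ C₄) (hC : 2 * C₃ ≤ C) (hC' : C₄ ≤ C) (hK : 1 ≤ K)
    (hn : 0 < n)
    (hQ : C₄⁻¹ ≤ lamMin (matQ ν Θ g θ₀) ∧ lamMax (matQ ν Θ g θ₀) ≤ C₄)
    (hκ : κ ≤ 1 / 8) (h𝒱 : ∀ y, |y| ≤ κ → y ∈ 𝒱) (h𝒱' : 𝒱 ⊆ Set.Ioi (-1))
    (hsmall : SmallRates n (Fintype.card ι) p γ ρ C C₁ C₃ K U κ)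
    (ht : IsELEstimate 𝒱 Θ x g t) {μ : EuclideanSpace ℝ ι}
    (hμ : matCLM (popV ν g θ₀) μ
      = (empMean fun i => momentVec g x i θ₀) + matCLM (popGrad ν Θ g θ₀) (t - θ₀))
    {v : EuclideanSpace ℝ (Fin p)} (hv : ‖v‖ ≤ C ^ 2) :
    √n * |⟪matCLM (popGrad ν Θ g θ₀) v, μ⟫| ≤
      remainder C K (√((Fintype.card ι : ℝ) ^ 3 * p ^ 2 / n))
        (√((Fintype.card ι : ℝ) ^ 3 * (n : ℝ) ^ (-1 + 2 / γ))) := by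
  have hp : 1 ≤ p := Fin.pos_iff_nonempty.2 inferInstance
  have hph : p ≤ Fintype.card ι := card_le_card_of_popGrad hQ hC₄
  set h := Fintype.card ι with hh
  have hr : RateBounds (n : ℝ) h p K γ :=
    ⟨by exact_mod_cast hn, by exact_mod_cast hp, by exact_mod_cast hph, hK, hγ⟩
  have hn' := hr.n_pos
  have hK0 := hr.K_pos
  have hh0 := hr.h_pos
  have hp0 := hr.p_pos
  have h1C : 1 ≤ C := by linarith
  have hM1 := one_le_rateConst h1C
  set s := √((h : ℝ) ^ 3 * p ^ 2 / n) with hs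
  set τ := √((h : ℝ) ^ 3 * (n : ℝ) ^ (-1 + 2 / γ)) with hτ
  have hs0 : 0 ≤ s := Real.sqrt_nonneg _
  have hτ0 : 0 ≤ τ := Real.sqrt_nonneg _
  have hR := regularSample_moments (a := K * √(h / n)) (e := K * √(h * p / n))
    (eV := K * (h / √n)) hM hn (by linarith) hC₃ hC₄ hC hC' hK0.le (by positivity) (by positivity)
    (by positivity) (hr.second_rate.trans hsmall.second) hQ hG.eig hG.reg hG.score hG.grad
    hG.second
  have hmin := isProfileMin_of_isELEstimate ht
  have hab : 13 * C ^ 2 * rateConst C * (K * √(h / n)) * (√h * (n * K) ^ γ⁻¹) ≤ κ := by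
    refine le_trans ?_ hsmall.envelope
    rw [mul_assoc]
    exact mul_le_mul_of_nonneg_left hr.score_envelope_rate (by positivity)
  have hest := hR.norm_empMean_estimate_le hκ h𝒱 h𝒱' hmin (by
    refine le_trans ?_ hab
    have : 8 * C ≤ 13 * C ^ 2 * rateConst C := by
      have h1 : C ≤ C ^ 2 := le_self_pow₀ h1C two_ne_zero
      nlinarith [sq_nonneg C]
    gcongr)
  have hclose : vecSup (fun k => t k - θ₀ k)
      ≤ 2 / C₁ * ((17 * C ^ 2 + 1) * K + U) * √(h / n) := by
    have h1 := hG.uniform t ht.1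
    have h2 := hR.score
    have h3 : C₁ / 2 * vecSup (fun k => t k - θ₀ k) ≤ ((17 * C ^ 2 + 1) * K + U) * √(h / n) := by
      linarith
    calc vecSup (fun k => t k - θ₀ k) = 2 / C₁ * (C₁ / 2 * vecSup (fun k => t k - θ₀ k)) := by
          field_simp
      _ ≤ 2 / C₁ * (((17 * C ^ 2 + 1) * K + U) * √(h / n)) := by gcongr
      _ = _ := by ring
  set W := 2 / C₁ * ((17 * C ^ 2 + 1) * K + U) with hW
  have hW0 : 0 ≤ W := by
    have h1 : 0 ≤ W * √((h : ℝ) / n) := (vecSup_nonneg _).trans hclose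
    have h2 : 0 < √((h : ℝ) / n) := by positivity
    exact nonneg_of_mul_nonneg_left h1 h2
  -- Going from maximum to Euclidean norm costs √p, so S‖t - θ₀‖ is of order h p^(3/2)/√n; p ≤ h
  -- turns this into √(h³p²/n).
  have hlip : C * (√(h * K) * p * ‖t - θ₀‖) ≤ 1 / 4 := by
    refine le_trans ?_ hsmall.close
    have h1 : ‖t - θ₀‖ ≤ √p * (W * √(h / n)) :=
      (norm_le_sqrt_mul_vecSup (t - θ₀)).trans (by gcongr; exact hclose)
    have h2 : √(h * K) * p * ‖t - θ₀‖ ≤ W * (K * s) := by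
      calc _ ≤ √(h * K) * p * (√p * (W * √(h / n))) := by gcongr
        _ = W * (√(h * K) * p * (√p * √(h / n))) := by ring
        _ ≤ _ := mul_le_mul_of_nonneg_left hr.lip_rate hW0
    gcongr
  have hmain := hR.abs_inner_le_of_close hκ h𝒱 h𝒱' hmin (by
      refine le_trans ?_ hsmall.grad
      gcongr C * ?_
      exact hr.grad_rate) hlip (by
      refine (Metric.ball_subset_ball ?_).trans hM.ball
      refine le_trans ?_ hsmall.ball
      gcongr rateConst C * ?_
      exact hr.score_rate) (by
      refine le_trans ?_ hsmall.lip
      have h1 := hr.grad_rate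
      have h2 := mul_le_mul_of_nonneg_left hr.lip_score_rate (by linarith : 0 ≤ rateConst C)
      linarith) hab hμ v
  calc _ ≤ √n * (‖v‖ * _) := mul_le_mul_of_nonneg_left hmain (Real.sqrt_nonneg _)
    _ = ‖v‖ * (6 * C ^ 3 * (13 * C ^ 2 * rateConst C *
        (√n * (K * √(h / n) * (K * √(h * p / n) + K * (h / √n))))
        + (13 * C ^ 2 * rateConst C) ^ 2 * (√n * ((K * √(h / n)) ^ 2 * (√(h * p * K)
          + √(h * K) * p + √h * (n * K) ^ γ⁻¹))))) := by ring
    _ ≤ C ^ 2 * (6 * C ^ 3 * (13 * C ^ 2 * rateConst C * (2 * K ^ 2 * s)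
        + (13 * C ^ 2 * rateConst C) ^ 2 * (2 * K ^ 3 * s + K ^ 3 * τ))) := by
      exact mul_le_mul hv (mul_le_mul_of_nonneg_left (add_le_add
        (mul_le_mul_of_nonneg_left hr.first_remainder_rate (by positivity))
        (mul_le_mul_of_nonneg_left hr.second_remainder_rate (by positivity))) (by positivity))
        (by positivity) (by positivity)
    _ = _ := rfl

end GoodSample

/-- The constant of the uniform bound over the parameter set. -/
def uniformConst (C₁ K B : ℝ) : ℝ := C₁ / 2 + √K + √(60 * √(32 * (1 + B)))

/-- Growth conditions under which the net argument applies. -/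
structure NetRates (n h p : ℕ) (C₁ K B : ℝ) : Prop where
  dims : h ^ 3 * p ^ 2 ≤ n
  log_le : Real.log n ≤ √n
  log_le' : 60 * K * (√n * √√n) * Real.log n ≤ (C₁ / 2) ^ 2 * n
  card : 2 * ((1 + B) / C₁ * n ^ 2) + 4 ≤ (n : ℝ) ^ 3

/-! ### Probability of good samples -/

section Probability

variable {d p n : ℕ} {ι : Type} [Fintype ι] {Ω : Type*} [MeasurableSpace Ω] {P : Measure Ω}
  [IsProbabilityMeasure P] {ν : Measure (EuclideanSpace ℝ (Fin d))} [IsProbabilityMeasure ν]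
  {X : Fin n → Ω → EuclideanSpace ℝ (Fin d)}
  {Θ : Set (EuclideanSpace ℝ (Fin p))} {θ₀ : EuclideanSpace ℝ (Fin p)} {ρ γ B C₁ C₃ K : ℝ}
  {g : EstFun ι d p}

omit [IsProbabilityMeasure ν] in
/-- Chebyshev's inequality for a nonempty family of sample means, at the scale of its size. -/
lemma measureReal_sum_sq_dev_gt_le (hn : 0 < n) (hlaw : ∀ i, HasLaw (X i) ν P)
    (hindep : iIndepFun X P) {κ : Type*} [Fintype κ] [Nonempty κ]
    {φ : κ → EuclideanSpace ℝ (Fin d) → ℝ}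
    (hφm : ∀ k, Measurable (φ k)) (hφ : ∀ k, MemLp (φ k) 2 ν) {B : ℝ}
    (hB : ∀ k, ∫ x, φ k x ^ 2 ∂ν ≤ B) (hK : 0 < K) :
    P.real {ω | ¬ ∑ k, ((empMean fun i => φ k (X i ω)) - ∫ x, φ k x ∂ν) ^ 2
      ≤ K ^ 2 * (Fintype.card κ / n)} ≤ B / K ^ 2 := by
  have hn' : (0 : ℝ) < n := by positivity
  have hκ : (0 : ℝ) < Fintype.card κ := by exact_mod_cast Fintype.card_pos
  have h := measureReal_sum_sq_dev_le hn hlaw hindep hφm hφ hB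
    (t := K ^ 2 * (Fintype.card κ / n)) (by positivity)
  refine (measureReal_mono fun ω hω => ?_).trans (h.trans_eq (by field_simp))
  exact (not_le.1 hω).le

variable (hM : SmoothModel Θ θ₀ ρ g) (hm : MomentModel ν Θ θ₀ g γ B C₁) (hn : 0 < n)
  (hlaw : ∀ i, HasLaw (X i) ν P) (hindep : iIndepFun X P) (hK : 1 ≤ K) [Nonempty ι]
  [Nonempty (Fin p)]
include hM hm hn hlaw hindep hK

/-- Most samples are regular at `θ₀`. -/
theorem measureReal_not_centeredSample_le :
    P.real {ω | ¬ CenteredSample ν Θ θ₀ g C₃ K fun i => X i ω} ≤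
      P.real {ω | ¬ ∀ θ ∈ Θ, ∀ u : EuclideanSpace ℝ ι,
        C₃⁻¹ * ‖u‖ ^ 2 ≤ (empMean fun i => ⟪u, momentVec g (fun i => X i ω) i θ⟫ ^ 2) ∧
        (empMean fun i => ⟪u, momentVec g (fun i => X i ω) i θ⟫ ^ 2) ≤ C₃ * ‖u‖ ^ 2}
      + 3 * (1 + B) / K ^ 2 := by
  have hn' : (0 : ℝ) < n := by positivity
  have hK0 : 0 < K := by linarith
  have h1 := measureReal_sum_sq_dev_gt_le (K := K) hn hlaw hindep
    (φ := fun j x => g j x θ₀) (fun j => hM.measurable j θ₀ hM.mem)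
    (fun j => memLp_two_of_four (hm.memLp_four hM j hM.mem))
    (fun j => hm.integral_two_le hM j hM.mem) hK0
  have h2 := measureReal_sum_sq_dev_gt_le (K := K) hn hlaw hindep
    (φ := fun (k : ι × Fin p) x => pderiv Θ g k.1 x θ₀ k.2)
    (fun k => measurable_pderiv hM k.1 k.2)
    (fun k => (hm.memLp_pderiv hM k.1 k.2).1) (fun k => (hm.memLp_pderiv hM k.1 k.2).2) hK0
  have h3 := measureReal_sum_sq_dev_gt_le (K := K) hn hlaw hindep
    (φ := fun (k : ι × ι) x => g k.1 x θ₀ * g k.2 x θ₀)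
    (fun k => (hM.measurable k.1 θ₀ hM.mem).mul (hM.measurable k.2 θ₀ hM.mem))
    (fun k => memLp_mul_two (hm.memLp_four hM k.1 hM.mem) (hm.memLp_four hM k.2 hM.mem))
    (fun k => integral_sq_mul_le (hm.memLp_four hM k.1 hM.mem) (hm.memLp_four hM k.2 hM.mem)
      (hm.integral_four_le hM k.1 hM.mem) (hm.integral_four_le hM k.2 hM.mem)) hK0
  set E := {ω | ¬ ∀ θ ∈ Θ, ∀ u : EuclideanSpace ℝ ι,
        C₃⁻¹ * ‖u‖ ^ 2 ≤ (empMean fun i => ⟪u, momentVec g (fun i => X i ω) i θ⟫ ^ 2) ∧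
        (empMean fun i => ⟪u, momentVec g (fun i => X i ω) i θ⟫ ^ 2) ≤ C₃ * ‖u‖ ^ 2} with hE
  set S₁ := {ω | ¬ ∑ k, ((empMean fun i => g k (X i ω) θ₀) - ∫ x, g k x θ₀ ∂ν) ^ 2
      ≤ K ^ 2 * (Fintype.card ι / n)} with hS₁
  set S₂ := {ω | ¬ ∑ k : ι × Fin p, ((empMean fun i => pderiv Θ g k.1 (X i ω) θ₀ k.2)
      - ∫ x, pderiv Θ g k.1 x θ₀ k.2 ∂ν) ^ 2
      ≤ K ^ 2 * (Fintype.card (ι × Fin p) / n)} with hS₂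
  set S₃ := {ω | ¬ ∑ k : ι × ι, ((empMean fun i => g k.1 (X i ω) θ₀ * g k.2 (X i ω) θ₀)
      - ∫ x, g k.1 x θ₀ * g k.2 x θ₀ ∂ν) ^ 2
      ≤ K ^ 2 * (Fintype.card (ι × ι) / n)} with hS₃
  have hsub : {ω | ¬ CenteredSample ν Θ θ₀ g C₃ K fun i => X i ω} ⊆ E ∪ (S₁ ∪ (S₂ ∪ S₃)) := by
    intro ω hω
    by_contra hcon
    simp only [Set.mem_union, not_or, hE, hS₁, hS₂, hS₃, Set.mem_ofPred_eq, not_not] at hcon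
    obtain ⟨h4, h5, h6, h7⟩ := hcon
    refine hω ⟨h4, ?_, ?_, ?_⟩
    · rw [mul_pow, Real.sq_sqrt (by positivity)]
      simpa only [hm.mean_zero, sub_zero] using h5
    · rw [mul_pow, Real.sq_sqrt (by positivity)]
      rw [Fintype.sum_prod_type] at h6
      simpa using h6
    · rw [mul_pow, div_pow, Real.sq_sqrt hn'.le]
      rw [Fintype.sum_prod_type] at h7
      simpa [sq] using h7
  have hB := hm.B_nonneg
  calc _ ≤ P.real (E ∪ (S₁ ∪ (S₂ ∪ S₃))) := measureReal_mono hsub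
    _ ≤ P.real E + (P.real S₁ + (P.real S₂ + P.real S₃)) :=
      (measureReal_union_le _ _).trans (add_le_add_right ((measureReal_union_le _ _).trans
        (add_le_add_right (measureReal_union_le _ _) _)) _)
    _ ≤ P.real E + ((1 + B) / K ^ 2 + ((1 + B) / K ^ 2 + (1 + B) / K ^ 2)) := by
      have h4 : B / K ^ 2 ≤ (1 + B) / K ^ 2 := by gcongr; linarith
      gcongr
      exact h2.trans h4
    _ = _ := by ring

/-- Most samples are good. -/
theorem measureReal_not_goodSample_le (hph : p ≤ Fintype.card ι)
    (hnet : NetRates n (Fintype.card ι) p C₁ K B)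
    (hhalf : P.real {ω | ¬ ∀ θ ∈ Θ, regTerm γ Θ (fun i => X i ω) g θ ≤ K} < 1 / 2) :
    P.real {ω | ¬ GoodSample ν Θ θ₀ g γ C₁ C₃ K (uniformConst C₁ K B) fun i => X i ω} ≤
      P.real {ω | ¬ ∀ θ ∈ Θ, ∀ u : EuclideanSpace ℝ ι,
        C₃⁻¹ * ‖u‖ ^ 2 ≤ (empMean fun i => ⟪u, momentVec g (fun i => X i ω) i θ⟫ ^ 2) ∧
        (empMean fun i => ⟪u, momentVec g (fun i => X i ω) i θ⟫ ^ 2) ≤ C₃ * ‖u‖ ^ 2}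
      + 3 * (1 + B) / K ^ 2
      + P.real {ω | ¬ ∀ θ ∈ Θ, regTerm γ Θ (fun i => X i ω) g θ ≤ K} + 2 / n := by
  have hp : 1 ≤ p := Fin.pos_iff_nonempty.2 inferInstance
  have hp' : (1 : ℝ) ≤ p := by exact_mod_cast hp
  set h := Fintype.card ι with hh
  have hh1 : 1 ≤ h := hp.trans hph
  have hn' : (0 : ℝ) < n := by positivity
  have hn1 : (1 : ℝ) ≤ n := by exact_mod_cast hn
  have hph' : (p : ℝ) ≤ h := by exact_mod_cast hph
  have hh' : (1 : ℝ) ≤ h := by exact_mod_cast hh1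
  have hB := hm.B_nonneg
  have hC₁ := hm.C₁_pos
  have hK0 : 0 < K := by linarith
  have hlog : 0 ≤ Real.log n := Real.log_nonneg hn1
  -- Since p ≤ h, the growth condition bounds powers of p alone; this makes p³ log n / n small in
  -- the absorption condition.
  have hpn : p ^ 4 ≤ n := by
    refine le_trans ?_ hnet.dims
    calc p ^ 4 ≤ p ^ 3 * p ^ 2 := by rw [← pow_add]; exact Nat.pow_le_pow_right hp (by norm_num)
      _ ≤ _ := by gcongr
  have hhn : h ≤ n := by
    refine le_trans ?_ hnet.dims
    calc h = h ^ 1 * 1 := by ring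
      _ ≤ _ := by
        exact Nat.mul_le_mul (Nat.pow_le_pow_right hh1 (by norm_num)) (Nat.one_le_pow _ _ hp)
  have hhn' : (h : ℝ) ≤ n := by exact_mod_cast hhn
  have hp4 : (p : ℝ) ^ 4 ≤ n := by exact_mod_cast hpn
  have hp2 : (p : ℝ) ^ 2 ≤ √n := by
    apply Real.le_sqrt_of_sq_le
    rw [← pow_mul]; exact hp4
  have hp1 : (p : ℝ) ≤ √√n := Real.le_sqrt_of_sq_le hp2
  -- Mesh n^(-2) makes the discretisation error at most of order 1/n and the net of size at most
  -- n^(3p); ξ = 6p log n gives exponential weights n^(-6p), which beat the union bound.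
  set η : ℝ := ((n : ℝ) ^ 2)⁻¹ with hη
  set ξ : ℝ := 6 * p * Real.log n with hξ
  have hξ0 : 0 ≤ ξ := by positivity
  obtain ⟨N, hNP, hN⟩ := exists_uniform_event (η := η) (ξ := ξ) hM hm hn hlaw hindep hK0.le hhalf
    (by positivity) hξ0 (by
      rw [← mul_assoc, ← Real.sqrt_mul (by positivity)]
      apply le_of_sq_le_sq _ (by positivity)
      rw [mul_pow, Real.sq_sqrt (by positivity)]
      calc 10 * ξ / n * K * p ^ 2 = 60 * K * (p ^ 2 * p) * Real.log n / n := by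
            simp only [hξ]; ring
        _ ≤ 60 * K * (√n * √√n) * Real.log n / n := by gcongr
        _ ≤ (C₁ / 2) ^ 2 * n / n := by gcongr ?_ / _; exact hnet.log_le'
        _ = _ := by field_simp)
  have hNle : P.real N ≤ 2 / n := by
    refine hNP.trans ?_
    have h1 : (2 * (⌈(1 + B) / C₁ / η⌉₊ + 1) : ℝ) ≤ (n : ℝ) ^ 3 := by
      refine le_trans ?_ hnet.card
      have h2 := (Nat.ceil_lt_add_one (by positivity : 0 ≤ (1 + B) / C₁ / η)).le
      have h3 : (1 + B) / C₁ / η = (1 + B) / C₁ * n ^ 2 := by rw [hη, div_inv_eq_mul]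
      rw [h3] at h2 ⊢
      linarith
    have h2 : Real.exp (-ξ) = (((n : ℝ) ^ 6)⁻¹) ^ p := by
      have h3 : -ξ = (p : ℕ) * -((6 : ℕ) * Real.log n) := by simp only [hξ]; push_cast; ring
      rw [h3, Real.exp_nat_mul, Real.exp_neg, Real.exp_nat_mul, Real.exp_log hn']
    rw [h2]
    calc _ ≤ ((n : ℝ) ^ 3) ^ p * h * (2 * (((n : ℝ) ^ 6)⁻¹) ^ p) := by gcongr
      _ = 2 * h * (((n : ℝ) ^ 3)⁻¹) ^ p := by
        have h3 : ((n : ℝ) ^ 6)⁻¹ = ((n : ℝ) ^ 3)⁻¹ * ((n : ℝ) ^ 3)⁻¹ := by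
          rw [← mul_inv, ← pow_add]
        have h4 : ((n : ℝ) ^ 3) ^ p * (((n : ℝ) ^ 3)⁻¹) ^ p = 1 := by
          rw [← mul_pow, mul_inv_cancel₀ (by positivity), one_pow]
        rw [h3, mul_pow]
        linear_combination 2 * (h : ℝ) * (((n : ℝ) ^ 3)⁻¹) ^ p * h4
      _ ≤ 2 * n * (((n : ℝ) ^ 3)⁻¹) ^ 1 := by
        have h5 : ((n : ℝ) ^ 3)⁻¹ ≤ 1 := inv_le_one_of_one_le₀ (one_le_pow₀ hn1)
        have h6 := pow_le_pow_of_le_one (by positivity) h5 hp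
        gcongr 2 * ?_ * ?_
      _ = 2 / n * (n : ℝ)⁻¹ := by field_simp
      _ ≤ 2 / n * 1 := by gcongr; exact inv_le_one_of_one_le₀ hn1
      _ = _ := mul_one _
  have hsub : {ω | ¬ GoodSample ν Θ θ₀ g γ C₁ C₃ K (uniformConst C₁ K B) fun i => X i ω} ⊆
      ({ω | ¬ CenteredSample ν Θ θ₀ g C₃ K fun i => X i ω} ∪
        {ω | ¬ ∀ θ ∈ Θ, regTerm γ Θ (fun i => X i ω) g θ ≤ K}) ∪ N := by
    intro ω hω
    by_contra hcon
    simp only [Set.mem_union, not_or, Set.mem_ofPred_eq, not_not] at hcon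
    obtain ⟨⟨h1, h2⟩, h3⟩ := hcon
    refine hω ⟨h1, h2, fun θ hθ => (hN ω h3 h2 θ hθ).trans ?_⟩
    have hroot : (n : ℝ)⁻¹ ≤ √(h / n) := by
      apply Real.le_sqrt_of_sq_le
      rw [inv_pow, ← one_div]
      gcongr
      exact le_self_pow₀ hn1 two_ne_zero
    have hηn : η * n = (n : ℝ)⁻¹ := by simp only [hη]; field_simp
    have hη1 : η ≤ (n : ℝ)⁻¹ := by
      rw [← hηn]; exact le_mul_of_one_le_right (by positivity) hn1
    have hη2 : p * η ≤ (n : ℝ)⁻¹ := by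
      rw [← hηn, mul_comm]
      have : (p : ℝ) ≤ n := hph'.trans hhn'
      gcongr
    -- The extra n^(-1/2) from q absorbs log n, so no logarithm is left in the rate √(h/n).
    have h4 : √(10 * ξ / n * √(32 * (1 + B) / n)) ≤ √(60 * √(32 * (1 + B))) * √(h / n) := by
      rw [← Real.sqrt_mul (by positivity)]
      apply Real.sqrt_le_sqrt
      rw [Real.sqrt_div (by positivity)]
      have hsn := Real.sqrt_pos.2 hn'
      calc _ = 60 * √(32 * (1 + B)) * (p * (Real.log n / √n) / n) := by simp only [hξ]; ring
        _ ≤ 60 * √(32 * (1 + B)) * (h * 1 / n) := by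
          gcongr
          exact (div_le_one hsn).2 hnet.log_le
        _ = _ := by ring
    have h5 : C₁ / 2 * η ≤ C₁ / 2 * √(h / n) := by gcongr; exact hη1.trans hroot
    have h6 : √K * p * η ≤ √K * √(h / n) := by
      rw [mul_assoc]; gcongr; exact hη2.trans hroot
    simp only [uniformConst]
    linarith
  refine (measureReal_mono hsub).trans ((measureReal_union_le _ _).trans ?_)
  refine add_le_add ((measureReal_union_le _ _).trans (add_le_add_left ?_ _)) hNle
  exact measureReal_not_centeredSample_le hM hm hn hlaw hindep hK

end Probability

/-! ### Measurability of the eigenvalue event -/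

section Measurability

variable {d p n : ℕ} {ι : Type} [Fintype ι] {Ω : Type*} [MeasurableSpace Ω] {P : Measure Ω}
  {ν : Measure (EuclideanSpace ℝ (Fin d))} {X : Fin n → Ω → EuclideanSpace ℝ (Fin d)}
  {Θ : Set (EuclideanSpace ℝ (Fin p))} {θ₀ : EuclideanSpace ℝ (Fin p)} {ρ : ℝ}
  {g : EstFun ι d p}

lemma continuous_sample_quadratic (hM : SmoothModel Θ θ₀ ρ g)
    (x : Fin n → EuclideanSpace ℝ (Fin d)) :
    Continuous fun q : Θ × EuclideanSpace ℝ ι =>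
      empMean fun i => ⟪q.2, momentVec g x i q.1.1⟫ ^ 2 := by
  have h : ∀ (i : Fin n) (j : ι), Continuous fun q : Θ × EuclideanSpace ℝ ι =>
      g j (x i) q.1.1 := fun i j =>
    ((hM.continuousOn j (x i)).domRestrict).comp continuous_fst
  have h2 : ∀ j : ι, Continuous fun q : Θ × EuclideanSpace ℝ ι => q.2 j := fun j => by fun_prop
  simp only [empMean, inner_momentVec]
  refine Continuous.const_smul ?_ (n : ℝ)⁻¹
  exact continuous_finsetSum _ fun i _ => (continuous_finsetSum _ fun j _ =>
    (h2 j).mul (h i j)).pow 2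

lemma le_of_dense {T : Type*} [TopologicalSpace T] {s : Set T} (hs : Dense s) {F G : T → ℝ}
    (hF : Continuous F) (hG : Continuous G) (h : ∀ q ∈ s, F q ≤ G q) (q : T) : F q ≤ G q := by
  have hall := (isClosed_le hF hG).closure_subset_iff.2 h
  rw [hs.closure_eq] at hall
  exact hall (Set.mem_univ q)

/-- Continuity in (θ, u) reduces the uncountable intersection to a countable dense set. Without
this, an event of outer measure tending to 1 need not have a complement of measure tending to 0. -/
lemma nullMeasurableSet_eigenvalue_event (hM : SmoothModel Θ θ₀ ρ g)
    (hlaw : ∀ i, HasLaw (X i) ν P) (c C : ℝ) :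
    NullMeasurableSet {ω | ∀ θ ∈ Θ, ∀ u : EuclideanSpace ℝ ι,
        c * ‖u‖ ^ 2 ≤ (empMean fun i => ⟪u, momentVec g (fun i => X i ω) i θ⟫ ^ 2) ∧
        (empMean fun i => ⟪u, momentVec g (fun i => X i ω) i θ⟫ ^ 2) ≤ C * ‖u‖ ^ 2} P := by
  obtain ⟨s, hs, hsd⟩ := TopologicalSpace.exists_countable_dense (Θ × EuclideanSpace ℝ ι)
  have heq : {ω | ∀ θ ∈ Θ, ∀ u : EuclideanSpace ℝ ι,
        c * ‖u‖ ^ 2 ≤ (empMean fun i => ⟪u, momentVec g (fun i => X i ω) i θ⟫ ^ 2) ∧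
        (empMean fun i => ⟪u, momentVec g (fun i => X i ω) i θ⟫ ^ 2) ≤ C * ‖u‖ ^ 2}
      = ⋂ q ∈ s, ({ω | c * ‖q.2‖ ^ 2
          ≤ empMean fun i => ⟪q.2, momentVec g (fun i => X i ω) i q.1.1⟫ ^ 2} ∩
        {ω | (empMean fun i => ⟪q.2, momentVec g (fun i => X i ω) i q.1.1⟫ ^ 2)
          ≤ C * ‖q.2‖ ^ 2}) := by
    ext ω
    simp only [Set.mem_iInter, Set.mem_inter_iff, Set.mem_ofPred_eq]
    refine ⟨fun h q _ => h q.1.1 q.1.2 q.2, fun h θ hθ u => ?_⟩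
    have hc := continuous_sample_quadratic hM (fun i => X i ω)
    have hn : Continuous fun q : Θ × EuclideanSpace ℝ ι => ‖q.2‖ ^ 2 := by fun_prop
    exact ⟨le_of_dense hsd (hn.const_mul c) hc (fun q hq => (h q hq).1) (⟨θ, hθ⟩, u),
      le_of_dense hsd hc (hn.const_mul C) (fun q hq => (h q hq).2) (⟨θ, hθ⟩, u)⟩
  rw [heq]
  refine NullMeasurableSet.biInter hs fun q _ => ?_
  have hF : AEMeasurable (fun ω => empMean fun i =>
      ⟪q.2, momentVec g (fun i => X i ω) i q.1.1⟫ ^ 2) P := by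
    simp only [inner_momentVec]
    exact aemeasurable_empMean hlaw (φ := fun x => (∑ j, q.2 j * g j x q.1.1) ^ 2)
      ((Finset.measurable_fun_sum _ fun j _ => (hM.measurable j _ q.1.2).const_mul _).pow_const 2)
  exact (nullMeasurableSet_le aemeasurable_const hF).inter
    (nullMeasurableSet_le hF aemeasurable_const)

end Measurability

/-- Complements of null measurable events whose probability tends to one. -/
lemma tendsto_measureReal_compl {Ω : ℕ → Type*} [∀ n, MeasurableSpace (Ω n)]
    {P : ∀ n, Measure (Ω n)} [∀ n, IsProbabilityMeasure (P n)] {A : ∀ n, Set (Ω n)}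
    (hA : ∀ᶠ n in atTop, NullMeasurableSet (A n) (P n))
    (h : Tendsto (fun n => P n (A n)) atTop (𝓝 1)) :
    Tendsto (fun n => (P n).real (A n)ᶜ) atTop (𝓝 0) := by
  have h1 : Tendsto (fun n => (P n).real (A n)) atTop (𝓝 1) := by
    rw [← ENNReal.toReal_one]
    exact (ENNReal.tendsto_toReal ENNReal.one_ne_top).comp h
  have h2 := h1.const_sub 1
  rw [sub_self] at h2
  refine h2.congr' ?_
  filter_upwards [hA] with n hn
  have h3 : P n (A n)ᶜ = 1 - P n (A n) := prob_compl_eq_one_sub₀ hn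
  rw [Measure.real, Measure.real, h3, ENNReal.toReal_sub_of_le prob_le_one ENNReal.one_ne_top]
  simp

/-- Tail bounds for a family of variables which is bounded in probability. -/
lemma IsBigOpOne.eventually_measureReal_le {Ω : ℕ → Type*} [∀ n, MeasurableSpace (Ω n)]
    {P : ∀ n, Measure (Ω n)} [∀ n, IsProbabilityMeasure (P n)] {T : ℕ → Type*}
    {S : ∀ n, Set (T n)} {f : ∀ n, Ω n → T n → ℝ}
    (h : IsBigOpOne P fun n ω => ⨆ t ∈ S n, ENNReal.ofReal (f n ω t)) {ε : ℝ} (hε : 0 < ε) :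
    ∃ K₀ : ℝ, ∀ K ≥ K₀, ∀ᶠ n in atTop, (P n).real {ω | ¬ ∀ t ∈ S n, f n ω t ≤ K} ≤ ε := by
  obtain ⟨M, hM⟩ := h (ENNReal.ofReal ε) (by simpa using hε)
  refine ⟨M, fun K hK => ?_⟩
  filter_upwards [hM] with n hn
  refine ENNReal.toReal_le_of_le_ofReal hε.le (le_trans (measure_mono fun ω hω => ?_) hn)
  have hω' : ∃ t ∈ S n, K < f n ω t := by
    by_contra! hcon
    exact hω hcon
  obtain ⟨t, ht, hlt⟩ := hω'
  refine lt_of_lt_of_le ?_ (le_iSup₂ (f := fun t (_ : t ∈ S n) => ENNReal.ofReal (f n ω t)) t ht)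
  rw [← ENNReal.ofReal_coe_nnreal]
  exact (ENNReal.ofReal_lt_ofReal_iff_of_nonneg M.2).2 (lt_of_le_of_lt hK hlt)

/-! ### Eventual smallness of the rates -/

section Eventually

variable {h p : ℕ → ℕ} {γ : ℝ}

lemma eventually_smallRates
    (hs : Tendsto (fun n : ℕ => √((h n : ℝ) ^ 3 * (p n : ℝ) ^ 2 / n)) atTop (𝓝 0))
    (ht : Tendsto (fun n : ℕ => √((h n : ℝ) ^ 3 * (n : ℝ) ^ (-1 + 2 / γ))) atTop (𝓝 0))
    {ρ C C₃ κ : ℝ} (C₁ K U : ℝ) (hρ : 0 < ρ) (hC : 0 < C) (hC₃ : 0 < C₃) (hκ : 0 < κ) :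
    ∀ᶠ n in atTop, SmallRates n (h n) (p n) γ ρ C C₁ C₃ K U κ := by
  have e : ∀ {u : ℕ → ℝ} (_ : Tendsto u atTop (𝓝 0)) {c : ℝ} (_ : 0 < c),
      ∀ᶠ n in atTop, u n ≤ c := fun hu _ hc => (hu.eventually_lt_const hc).mono fun _ h => h.le
  have h1 := hs.const_mul K
  have h2 := h1.const_mul C
  have h3 := (h1.const_mul (2 / C₁ * ((17 * C ^ 2 + 1) * K + U))).const_mul C
  have h4 := h1.const_mul (rateConst C)
  have h5 := h1.add ((hs.const_mul (K ^ 2)).const_mul (rateConst C))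
  have h6 := (ht.const_mul (K ^ 2)).const_mul (13 * C ^ 2 * rateConst C)
  simp only [mul_zero, add_zero] at h1 h2 h3 h4 h5 h6
  filter_upwards [e h1 (by positivity : 0 < (2 * C₃)⁻¹), e h2 (by norm_num : (0 : ℝ) < 1 / 4),
    e h3 (by norm_num : (0 : ℝ) < 1 / 4), e h4 hρ, e h5 hC, e h6 hκ] with n a1 a2 a3 a4 a5 a6
  exact ⟨a1, a2, a3, a4, a5, a6⟩

lemma tendsto_remainder
    (hs : Tendsto (fun n : ℕ => √((h n : ℝ) ^ 3 * (p n : ℝ) ^ 2 / n)) atTop (𝓝 0))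
    (ht : Tendsto (fun n : ℕ => √((h n : ℝ) ^ 3 * (n : ℝ) ^ (-1 + 2 / γ))) atTop (𝓝 0))
    (C K : ℝ) :
    Tendsto (fun n : ℕ => remainder C K (√((h n : ℝ) ^ 3 * (p n : ℝ) ^ 2 / n))
      (√((h n : ℝ) ^ 3 * (n : ℝ) ^ (-1 + 2 / γ)))) atTop (𝓝 0) := by
  have h1 := ((((hs.const_mul (2 * K ^ 2)).const_mul (13 * C ^ 2 * rateConst C)).add
    (((hs.const_mul (2 * K ^ 3)).add (ht.const_mul (K ^ 3))).const_mul
      ((13 * C ^ 2 * rateConst C) ^ 2))).const_mul (6 * C ^ 3)).const_mul (C ^ 2)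
  simp only [mul_zero, add_zero] at h1
  exact h1

lemma eventually_netRates
    (hr : Tendsto (fun n : ℕ => (h n : ℝ) ^ 3 * (p n : ℝ) ^ 2 * (n : ℝ)⁻¹) atTop (𝓝 0))
    {C₁ : ℝ} (K B : ℝ) (hC₁ : 0 < C₁) :
    ∀ᶠ n in atTop, NetRates n (h n) (p n) C₁ K B := by
  have hlog : ∀ {c a : ℝ}, 0 < c → 0 < a → ∀ᶠ n : ℕ in atTop, Real.log n ≤ c * (n : ℝ) ^ a :=
    fun {c a} hc ha => by
      have h1 := (isLittleO_log_rpow_atTop ha).bound hc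
      filter_upwards [tendsto_natCast_atTop_atTop.eventually h1] with n hn
      exact (le_abs_self _).trans (hn.trans_eq (by
        rw [Real.norm_of_nonneg (by positivity)]))
  have hKpos : 0 < (C₁ / 2) ^ 2 / (60 * (|K| + 1)) := by positivity
  have hcard : Tendsto (fun n : ℕ => 2 * ((1 + B) / C₁) * (n : ℝ)⁻¹ + 4 * ((n : ℝ)⁻¹) ^ 3)
      atTop (𝓝 0) := by
    have h0 := tendsto_inv_atTop_nhds_zero_nat (𝕜 := ℝ)
    simpa using (h0.const_mul (2 * ((1 + B) / C₁))).add ((h0.pow 3).const_mul 4)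
  filter_upwards [hr.eventually_lt_const one_pos, hlog one_pos (by norm_num : (0 : ℝ) < 1 / 2),
    hlog hKpos (by norm_num : (0 : ℝ) < 1 / 4), eventually_gt_atTop 0,
    hcard.eventually_lt_const one_pos] with n h1 h2 h3 hn h4
  have hn' : (0 : ℝ) < n := by positivity
  have hn1 : (1 : ℝ) ≤ n := by exact_mod_cast hn
  refine ⟨?_, ?_, ?_, ?_⟩
  · rw [← div_eq_mul_inv, div_lt_one hn'] at h1
    exact_mod_cast h1.le
  · rwa [one_mul, ← Real.sqrt_eq_rpow] at h2
  · have h5 : √(n : ℝ) * √√(n : ℝ) * (n : ℝ) ^ (1 / 4 : ℝ) = n := by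
      rw [Real.sqrt_eq_rpow, Real.sqrt_eq_rpow, ← Real.rpow_mul hn'.le, ← Real.rpow_add hn',
        ← Real.rpow_add hn']
      norm_num
    have hl : 0 ≤ Real.log n := Real.log_nonneg hn1
    calc 60 * K * (√n * √√n) * Real.log n
        ≤ 60 * (|K| + 1) * (√n * √√n) * Real.log n := by
          gcongr
          linarith [le_abs_self K]
      _ ≤ 60 * (|K| + 1) * (√n * √√n)
          * ((C₁ / 2) ^ 2 / (60 * (|K| + 1)) * (n : ℝ) ^ (1 / 4 : ℝ)) := by gcongr
      _ = (C₁ / 2) ^ 2 * (√n * √√n * (n : ℝ) ^ (1 / 4 : ℝ)) := by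
          have : |K| + 1 ≠ 0 := by positivity
          field_simp
      _ = _ := by rw [h5]
  · have h5 : (2 * ((1 + B) / C₁) * (n : ℝ)⁻¹ + 4 * ((n : ℝ)⁻¹) ^ 3) * (n : ℝ) ^ 3
        ≤ 1 * (n : ℝ) ^ 3 := by gcongr
    rw [one_mul] at h5
    refine le_trans (le_of_eq ?_) h5
    field_simp

end Eventually

/-! ### The efficient score -/

section Score

variable {d p : ℕ} {ι : Type} [Fintype ι] {ν : Measure (EuclideanSpace ℝ (Fin d))}
  [IsProbabilityMeasure ν]
  {Θ : Set (EuclideanSpace ℝ (Fin p))} {θ₀ : EuclideanSpace ℝ (Fin p)} {ρ γ B C₁ : ℝ}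
  {g : EstFun ι d p}

/-- Projection of the moment functions at `θ₀` on a direction. -/
def scoreFun (g : EstFun ι d p) (θ₀ : EuclideanSpace ℝ (Fin p)) (w : EuclideanSpace ℝ ι)
    (x : EuclideanSpace ℝ (Fin d)) : ℝ :=
  -∑ j, w j * g j x θ₀

/-- The minus sign in the score comes from solving ⟪w, ḡ(θ₀)⟫ + αᵀ J^(1/2) (θhat - θ₀) ≈ 0 for the
second term. -/
lemma empMean_scoreFun {n : ℕ} (x : Fin n → EuclideanSpace ℝ (Fin d)) (w : EuclideanSpace ℝ ι) :
    (empMean fun i => scoreFun g θ₀ w (x i))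
      = -⟪w, empMean fun i => momentVec g x i θ₀⟫ := by
  rw [inner_empMean]
  simp only [inner_momentVec, scoreFun, empMean, Finset.sum_neg_distrib, smul_neg]

variable (hM : SmoothModel Θ θ₀ ρ g)
include hM

lemma measurable_scoreFun (w : EuclideanSpace ℝ ι) : Measurable (scoreFun g θ₀ w) :=
  (Finset.measurable_fun_sum _ fun j _ => (hM.measurable j _ hM.mem).const_mul _).neg

variable (hm : MomentModel ν Θ θ₀ g γ B C₁)
include hm

lemma memLp_scoreFun (w : EuclideanSpace ℝ ι) : MemLp (scoreFun g θ₀ w) 4 ν :=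
  (memLp_finsetSum _ fun j _ => (hm.memLp_four hM j hM.mem).const_mul _).neg

lemma integral_scoreFun (w : EuclideanSpace ℝ ι) : ∫ x, scoreFun g θ₀ w x ∂ν = 0 := by
  simp only [scoreFun]
  rw [integral_neg, integral_finsetSum _ fun j _ =>
    ((hm.memLp_four hM j hM.mem).integrable (by norm_num)).const_mul _]
  simp [integral_const_mul, hm.mean_zero]

lemma integral_scoreFun_sq (w : EuclideanSpace ℝ ι) :
    ∫ x, scoreFun g θ₀ w x ^ 2 ∂ν = ⟪w, matCLM (popV ν g θ₀) w⟫ := by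
  have h1 : ∀ j k, Integrable (fun x => g j x θ₀ * g k x θ₀) ν := fun j k =>
    (memLp_mul_two (hm.memLp_four hM j hM.mem) (hm.memLp_four hM k hM.mem)).integrable
      one_le_two
  have h2 : ∀ x, scoreFun g θ₀ w x ^ 2 = ∑ j, ∑ k, w j * w k * (g j x θ₀ * g k x θ₀) := by
    intro x
    rw [scoreFun, neg_sq, sq, Finset.sum_mul_sum]
    refine Finset.sum_congr rfl fun j _ => Finset.sum_congr rfl fun k _ => ?_
    ring
  simp only [h2]
  rw [integral_finsetSum _ fun j _ => integrable_finsetSum _ fun k _ => (h1 j k).const_mul _,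
    inner_eq_dotProduct, ofLp_matCLM]
  refine Finset.sum_congr rfl fun j _ => ?_
  rw [integral_finsetSum _ fun k _ => (h1 j k).const_mul _, Matrix.mulVec, dotProduct,
    Finset.mul_sum]
  refine Finset.sum_congr rfl fun k _ => ?_
  rw [integral_const_mul, popV, Matrix.of_apply]; ring

/-- Cauchy–Schwarz twice: once to separate w from the moments, once over the h coordinates. The
factor h² is harmless in the Lyapunov ratio because h²/n tends to 0. -/
lemma integral_scoreFun_four_le (w : EuclideanSpace ℝ ι) :
    ∫ x, scoreFun g θ₀ w x ^ 4 ∂ν ≤ (‖w‖ ^ 2) ^ 2 * (1 + B) * (Fintype.card ι) ^ 2 := by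
  have h1 : ∀ j, Integrable (fun x => g j x θ₀ ^ 4) ν := fun j =>
    integrable_pow_four (hm.memLp_four hM j hM.mem)
  have h2 : ∀ x, scoreFun g θ₀ w x ^ 4
      ≤ (‖w‖ ^ 2) ^ 2 * (Fintype.card ι * ∑ j, g j x θ₀ ^ 4) := by
    intro x
    have h3 : scoreFun g θ₀ w x ^ 2 ≤ ‖w‖ ^ 2 * ∑ j, g j x θ₀ ^ 2 := by
      rw [scoreFun, neg_sq, EuclideanSpace.real_norm_sq_eq]
      exact Finset.sum_mul_sq_le_sq_mul_sq _ _ _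
    have h4 : (∑ j, g j x θ₀ ^ 2) ^ 2 ≤ Fintype.card ι * ∑ j, g j x θ₀ ^ 4 := by
      have := sq_sum_le_card_mul_sum_sq (s := (Finset.univ : Finset ι))
        (f := fun j => g j x θ₀ ^ 2)
      simpa only [← pow_mul, Finset.card_univ] using this
    calc scoreFun g θ₀ w x ^ 4 = (scoreFun g θ₀ w x ^ 2) ^ 2 := by ring
      _ ≤ (‖w‖ ^ 2 * ∑ j, g j x θ₀ ^ 2) ^ 2 := by gcongr
      _ = (‖w‖ ^ 2) ^ 2 * (∑ j, g j x θ₀ ^ 2) ^ 2 := by ring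
      _ ≤ _ := by gcongr
  calc ∫ x, scoreFun g θ₀ w x ^ 4 ∂ν
      ≤ ∫ x, (‖w‖ ^ 2) ^ 2 * (Fintype.card ι * ∑ j, g j x θ₀ ^ 4) ∂ν :=
        integral_mono (integrable_pow_four (memLp_scoreFun hM hm w))
          (((integrable_finsetSum _ fun j _ => h1 j).const_mul _).const_mul _) h2
    _ = (‖w‖ ^ 2) ^ 2 * (Fintype.card ι * ∑ j, ∫ x, g j x θ₀ ^ 4 ∂ν) := by
        rw [integral_const_mul, integral_const_mul, integral_finsetSum _ fun j _ => h1 j]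
    _ ≤ (‖w‖ ^ 2) ^ 2 * (Fintype.card ι * ∑ _j : ι, (1 + B)) := by
        gcongr with j
        exact hm.integral_four_le hM j hM.mem
    _ = _ := by simp; ring

end Score

/-! ### Asymptotic normality -/

section Asymptotics

variable {d p : ℕ → ℕ} {Ω : ℕ → Type*} [∀ n, MeasurableSpace (Ω n)]
  {P : ∀ n, Measure (Ω n)} [∀ n, IsProbabilityMeasure (P n)]
  {ν : ∀ n, Measure (EuclideanSpace ℝ (Fin (d n)))} [∀ n, IsProbabilityMeasure (ν n)]
  {X : ∀ n, Fin n → Ω n → EuclideanSpace ℝ (Fin (d n))}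
  {Θ : ∀ n, Set (EuclideanSpace ℝ (Fin (p n)))} {θ₀ : ∀ n, EuclideanSpace ℝ (Fin (p n))}
  {ι : ℕ → Type} [∀ n, Fintype (ι n)] [∀ n, DecidableEq (ι n)]
  {g : ∀ n, EstFun (ι n) (d n) (p n)} {ρ γ B C₁ C₃ C₄ : ℝ}

section Events

variable (hlaw : ∀ n i, HasLaw (X n i) (ν n) (P n)) (hindep : ∀ n, iIndepFun (X n) (P n))
  (hM : ∀ n, SmoothModel (Θ n) (θ₀ n) ρ (g n))
  (hm : ∀ n, MomentModel (ν n) (Θ n) (θ₀ n) (g n) γ B C₁)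
  [∀ n, Nonempty (ι n)] [∀ n, Nonempty (Fin (p n))]
  (heig : Tendsto (fun n => P n {ω | ∀ θ ∈ Θ n,
        C₃⁻¹ ≤ lamMin (sampleV (fun i => X n i ω) (g n) θ) ∧
        lamMax (sampleV (fun i => X n i ω) (g n) θ) ≤ C₃}) atTop (𝓝 1))
  (hph : ∀ n, p n ≤ Fintype.card (ι n))
  (hrate : Tendsto (fun n : ℕ => (Fintype.card (ι n) : ℝ) ^ 3 * (p n : ℝ) ^ 2 * (n : ℝ)⁻¹)
    atTop (𝓝 0))
include hlaw hM heig

omit [∀ n, IsProbabilityMeasure (ν n)] [∀ n, Nonempty (Fin (p n))] in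
lemma tendsto_measureReal_not_eigenvalue :
    Tendsto (fun n => (P n).real {ω | ¬ ∀ θ ∈ Θ n, ∀ u : EuclideanSpace ℝ (ι n),
        C₃⁻¹ * ‖u‖ ^ 2 ≤ (empMean fun i => ⟪u, momentVec (g n) (fun i => X n i ω) i θ⟫ ^ 2) ∧
        (empMean fun i => ⟪u, momentVec (g n) (fun i => X n i ω) i θ⟫ ^ 2) ≤ C₃ * ‖u‖ ^ 2})
      atTop (𝓝 0) := by
  refine tendsto_measureReal_compl (A := fun n => {ω | ∀ θ ∈ Θ n, ∀ u : EuclideanSpace ℝ (ι n),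
        C₃⁻¹ * ‖u‖ ^ 2 ≤ (empMean fun i => ⟪u, momentVec (g n) (fun i => X n i ω) i θ⟫ ^ 2) ∧
        (empMean fun i => ⟪u, momentVec (g n) (fun i => X n i ω) i θ⟫ ^ 2) ≤ C₃ * ‖u‖ ^ 2})
    (Eventually.of_forall fun n => nullMeasurableSet_eigenvalue_event (hM n) (hlaw n) _ _) ?_
  simpa only [sampleV_eigenvalue_iff] using heig

include hindep hm hph hrate in
/-- Good samples have probability arbitrarily close to one. -/
lemma exists_eventually_measureReal_not_goodSample_le
    (hreg : IsBigOpOne P fun n ω => ⨆ θ ∈ Θ n,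
      ENNReal.ofReal (regTerm γ (Θ n) (fun i => X n i ω) (g n) θ)) {ε : ℝ} (hε : 0 < ε) :
    ∃ K ≥ 1, ∀ᶠ n in atTop, (P n).real {ω | ¬ GoodSample (ν n) (Θ n) (θ₀ n) (g n) γ C₁ C₃ K
      (uniformConst C₁ K B) fun i => X n i ω} ≤ ε := by
  have hB := (hm 0).B_nonneg
  -- The bound 1/4 keeps the failure probability of the `regTerm` control strictly below the 1/2
  -- required for reading population bounds off a sample.
  have hε' : 0 < min (ε / 4) (1 / 4) := by positivity
  obtain ⟨K₀, hK₀⟩ := hreg.eventually_measureReal_le hε'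
  have hlim : Tendsto (fun K : ℝ => 3 * (1 + B) / K ^ 2) atTop (𝓝 0) :=
    tendsto_const_nhds.div_atTop (tendsto_pow_atTop two_ne_zero)
  obtain ⟨K, hK1, hK2, hK3⟩ := ((eventually_ge_atTop (1 : ℝ)).and ((eventually_ge_atTop K₀).and
    (hlim.eventually_lt_const (by positivity : 0 < ε / 4)))).exists
  refine ⟨K, hK1, ?_⟩
  have h2n : Tendsto (fun n : ℕ => (2 : ℝ) / n) atTop (𝓝 0) :=
    tendsto_const_nhds.div_atTop tendsto_natCast_atTop_atTop
  filter_upwards [hK₀ K hK2, eventually_gt_atTop 0, eventually_netRates hrate K B (hm 0).C₁_pos,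
    (tendsto_measureReal_not_eigenvalue hlaw hM heig).eventually_lt_const
      (by positivity : 0 < ε / 4),
    h2n.eventually_lt_const (by positivity : 0 < ε / 4)] with n h1 hn h2 h3 h4
  have h5 := measureReal_not_goodSample_le (C₃ := C₃) (hM n) (hm n) hn (hlaw n) (hindep n) hK1
    (hph n) h2 (h1.trans_lt ((min_le_right _ _).trans_lt (by norm_num)))
  have h6 := h1.trans (min_le_left _ _)
  linarith

end Events

/-- Asymptotic normality of the empirical likelihood estimator based on valid moments. -/
theorem tendstoInDistribution_estimator
    (hlaw : ∀ n i, HasLaw (X n i) (ν n) (P n)) (hindep : ∀ n, iIndepFun (X n) (P n))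
    (hM : ∀ n, SmoothModel (Θ n) (θ₀ n) ρ (g n))
    (hm : ∀ n, MomentModel (ν n) (Θ n) (θ₀ n) (g n) γ B C₁)
    (hC₃ : 1 ≤ C₃) (hC₄ : 1 ≤ C₄)
    (heig : Tendsto (fun n => P n {ω | ∀ θ ∈ Θ n,
          C₃⁻¹ ≤ lamMin (sampleV (fun i => X n i ω) (g n) θ) ∧
          lamMax (sampleV (fun i => X n i ω) (g n) θ) ≤ C₃}) atTop (𝓝 1))
    (hreg : IsBigOpOne P fun n ω => ⨆ θ ∈ Θ n,
      ENNReal.ofReal (regTerm γ (Θ n) (fun i => X n i ω) (g n) θ))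
    (hQ : ∀ n, C₄⁻¹ ≤ lamMin (matQ (ν n) (Θ n) (g n) (θ₀ n)) ∧
      lamMax (matQ (ν n) (Θ n) (g n) (θ₀ n)) ≤ C₄)
    (hrate₁ : Tendsto (fun n : ℕ => (Fintype.card (ι n) : ℝ) ^ 3 * (n : ℝ) ^ (-1 + 2 / γ))
      atTop (𝓝 0))
    (hrate₂ : Tendsto (fun n : ℕ => (Fintype.card (ι n) : ℝ) ^ 3 * (p n : ℝ) ^ 2 * (n : ℝ)⁻¹)
      atTop (𝓝 0))
    {𝒱 : Set ℝ} (hV_open : IsOpen 𝒱) (hV_zero : (0 : ℝ) ∈ 𝒱) (hV_log : 𝒱 ⊆ Set.Ioi (-1))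
    {θhat : ∀ n, Ω n → EuclideanSpace ℝ (Fin (p n))} (hθhat_meas : ∀ n, AEMeasurable (θhat n) (P n))
    (hθhat : ∀ n, ∀ᵐ ω ∂(P n), IsELEstimate 𝒱 (Θ n) (fun i => X n i ω) (g n) (θhat n ω))
    {α : ∀ n, EuclideanSpace ℝ (Fin (p n))} (hα : ∀ n, ‖α n‖ = 1) :
    TendstoInDistribution
      (fun (n : ℕ) ω => √(n : ℝ) * ((α n).ofLp ⬝ᵥ
        (symPow (matJ (ν n) (Θ n) (g n) (θ₀ n)) (1 / 2) *ᵥ (θhat n ω - θ₀ n).ofLp)))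
      atTop (id : ℝ → ℝ) P (gaussianReal 0 1) := by
  -- A unit vector excludes dimension zero; p ≤ h then makes the set of moments nonempty as well.
  have hpne : ∀ n, Nonempty (Fin (p n)) := fun n => by
    by_contra hcon
    rw [not_nonempty_iff] at hcon
    have : α n = 0 := Subsingleton.elim _ _
    have h1 := hα n
    rw [this, norm_zero] at h1
    exact zero_ne_one h1
  have hph : ∀ n, p n ≤ Fintype.card (ι n) := fun n => card_le_card_of_popGrad (hQ n) hC₄
  have hιne : ∀ n, Nonempty (ι n) := fun n =>
    Fintype.card_pos_iff.1 ((Fin.pos_iff_nonempty.2 (hpne n)).trans_le (hph n))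
  have hγ : 4 < γ := (hm 0).gamma
  have hC₁ : 0 < C₁ := (hm 0).C₁_pos
  have hρ : 0 < ρ := (hM 0).pos
  have hs : Tendsto (fun n : ℕ => √((Fintype.card (ι n) : ℝ) ^ 3 * (p n : ℝ) ^ 2 / n)) atTop
      (𝓝 0) := by
    simpa [div_eq_mul_inv] using hrate₂.sqrt
  have ht : Tendsto (fun n : ℕ => √((Fintype.card (ι n) : ℝ) ^ 3 * (n : ℝ) ^ (-1 + 2 / γ))) atTop
      (𝓝 0) := by
    simpa using hrate₁.sqrt
  obtain ⟨κ, hκ0, hκ8, hκ𝒱⟩ : ∃ κ : ℝ, 0 < κ ∧ κ ≤ 1 / 8 ∧ ∀ y, |y| ≤ κ → y ∈ 𝒱 := by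
    obtain ⟨δ, hδ, hball⟩ := Metric.isOpen_iff.1 hV_open 0 hV_zero
    refine ⟨min (δ / 2) (1 / 8), by positivity, min_le_right _ _, fun y hy => hball ?_⟩
    rw [Metric.mem_ball, dist_zero_right, Real.norm_eq_abs]
    exact hy.trans_lt ((min_le_left _ _).trans_lt (half_lt_self hδ))
  set C : ℝ := 2 * C₃ + C₄ with hC
  have hC3 : 2 * C₃ ≤ C := by linarith
  have hC4 : C₄ ≤ C := by linarith
  have h1C : 1 ≤ C := by linarith
  have hgood := fun {ε : ℝ} (hε : 0 < ε) =>
    exists_eventually_measureReal_not_goodSample_le hlaw hindep hM hm heig hph hrate₂ hreg hε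
  have hsmall := fun K : ℝ => eventually_smallRates (γ := γ) hs ht (ρ := ρ) (C := C) (C₃ := C₃)
    (κ := κ) C₁ K (uniformConst C₁ K B) hρ (by linarith) (by linarith) hκ0
  set Eff : ∀ n, EuclideanSpace ℝ (Fin (p n)) × EuclideanSpace ℝ (ι n) → Prop := fun n q =>
    ⟪q.2, matCLM (popV (ν n) (g n) (θ₀ n)) q.2⟫ = 1 ∧ ‖q.2‖ ^ 2 ≤ C ∧ ‖q.1‖ ≤ C ^ 2 ∧
      ∀ (z : EuclideanSpace ℝ (ι n)) (δ : EuclideanSpace ℝ (Fin (p n))),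
        ∃ μ, matCLM (popV (ν n) (g n) (θ₀ n)) μ = z + matCLM (popGrad (ν n) (Θ n) (g n) (θ₀ n)) δ ∧
          ⟪matCLM (popGrad (ν n) (Θ n) (g n) (θ₀ n)) q.1, μ⟫ = ⟪q.2, z⟫ +
          (α n).ofLp ⬝ᵥ (symPow (matJ (ν n) (Θ n) (g n) (θ₀ n)) (1 / 2) *ᵥ δ.ofLp) with hEff
  -- No bounds on V(θ₀) are assumed. They are deterministic, so one good outcome suffices to
  -- transfer them from the sample matrix.
  have hex : ∀ᶠ n in atTop, ∃ q, Eff n q := by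
    obtain ⟨K, hK, hev⟩ := hgood (by norm_num : (0 : ℝ) < 1 / 2)
    filter_upwards [hev, hsmall K, eventually_gt_atTop 0] with n h1 h2 hn
    obtain ⟨ω, hω⟩ : ∃ ω, GoodSample (ν n) (Θ n) (θ₀ n) (g n) γ C₁ C₃ K
        (uniformConst C₁ K B) fun i => X n i ω := by
      by_contra! hcon
      have h3 : {ω | ¬ GoodSample (ν n) (Θ n) (θ₀ n) (g n) γ C₁ C₃ K
          (uniformConst C₁ K B) fun i => X n i ω} = Set.univ := Set.eq_univ_of_forall hcon
      rw [h3, probReal_univ] at h1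
      norm_num at h1
    have hr : RateBounds (n : ℝ) (Fintype.card (ι n)) (p n) K γ :=
      ⟨by exact_mod_cast hn, by exact_mod_cast Fin.pos_iff_nonempty.2 (hpne n),
        by exact_mod_cast hph n, hK, by linarith⟩
    have hbd := hω.toCenteredSample.popV_bounds (hM n).mem hC₃ hC3 (by linarith)
      (hr.second_rate.trans h2.second)
    obtain ⟨v, w, h⟩ := exists_efficient_direction (isHermitian_popV (θ₀ n)) h1C hbd
      (fun v => (norm_le_matCLM_popGrad (hQ n) hC₄ v).trans (by gcongr)) (hα n)
    exact ⟨(v, w), h⟩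
  obtain ⟨q, hq⟩ : ∃ q : ∀ n, EuclideanSpace ℝ (Fin (p n)) × EuclideanSpace ℝ (ι n),
      ∀ᶠ n in atTop, Eff n (q n) := by
    classical
    -- The value 0 at the finitely many remaining sample sizes is irrelevant to the limit.
    refine ⟨fun n => if h : ∃ q, Eff n q then h.choose else 0, hex.mono fun n hn => ?_⟩
    simp only [dif_pos hn]
    exact hn.choose_spec
  have hclt := tendstoInDistribution_of_rows hlaw hindep
    (φ := fun n => scoreFun (g n) (θ₀ n) (q n).2)
    (fun n => measurable_scoreFun (hM n) _) (by
      filter_upwards [hq] with n hn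
      exact ⟨memLp_scoreFun (hM n) (hm n) _, integral_scoreFun (hM n) (hm n) _,
        (integral_scoreFun_sq (hM n) (hm n) _).trans hn.1⟩) (by
      -- Lyapunov ratio: the fourth moment is at most C²(1 + B)h², and h² ≤ h³p².
      have hB := (hm 0).B_nonneg
      have hlim := hrate₂.const_mul (C ^ 2 * (1 + B))
      rw [mul_zero] at hlim
      refine squeeze_zero' (Eventually.of_forall fun n => div_nonneg
        (integral_nonneg fun x => by positivity) (by positivity)) ?_ hlim
      filter_upwards [hq] with n hn
      have hh1 : (1 : ℝ) ≤ Fintype.card (ι n) := by exact_mod_cast Fintype.card_pos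
      have hp1 : (1 : ℝ) ≤ p n := by exact_mod_cast Fin.pos_iff_nonempty.2 (hpne n)
      rw [div_eq_mul_inv, ← mul_assoc]
      refine mul_le_mul_of_nonneg_right ((integral_scoreFun_four_le (hM n) (hm n) _).trans ?_)
        (by positivity)
      have h1 : (Fintype.card (ι n) : ℝ) ^ 2 ≤ (Fintype.card (ι n) : ℝ) ^ 3 * (p n : ℝ) ^ 2 := by
        calc (Fintype.card (ι n) : ℝ) ^ 2 = (Fintype.card (ι n) : ℝ) ^ 2 * 1 := (mul_one _).symm
          _ ≤ _ := by
            refine mul_le_mul (pow_le_pow_right₀ hh1 (by norm_num)) (one_le_pow₀ hp1)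
              zero_le_one (by positivity)
      have h2 := hn.2.1
      gcongr)
  refine tendstoInDistribution_of_sub hclt (fun n => ?_) fun ε hε => ?_
  · have hcont : Continuous fun θ : EuclideanSpace ℝ (Fin (p n)) => √(n : ℝ) * ((α n).ofLp ⬝ᵥ
        (symPow (matJ (ν n) (Θ n) (g n) (θ₀ n)) (1 / 2) *ᵥ (θ - θ₀ n).ofLp)) := by
      simp only [dotProduct, Matrix.mulVec]
      fun_prop
    exact hcont.measurable.comp_aemeasurable (hθhat_meas n)
  · refine Metric.tendsto_atTop.2 fun δ hδ => ?_
    obtain ⟨K, hK, hev⟩ := hgood (half_pos hδ)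
    have hrem := (tendsto_remainder hs ht C K).eventually_lt_const hε
    refine eventually_atTop.1 ?_
    filter_upwards [hev, hsmall K, eventually_gt_atTop 0, hrem, hq] with n h1 h2 hn h3 h4
    rw [Real.dist_eq, sub_zero, abs_of_nonneg measureReal_nonneg]
    refine lt_of_le_of_lt ?_ (half_lt_self hδ)
    refine le_trans ?_ h1
    -- Almost surely θhat is a minimiser, and then a deviation above ε can occur only on a sample
    -- that is not good, since on good samples the remainder is below ε.
    refine ENNReal.toReal_mono (measure_ne_top _ _) (measure_mono_ae ?_)
    filter_upwards [hθhat n] with ω hω hω1 hω2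
    refine absurd hω1 (not_lt.2 (le_trans ?_ h3.le))
    obtain ⟨μ, hμ, hμ'⟩ := h4.2.2.2
      (empMean fun i => momentVec (g n) (fun i => X n i ω) i (θ₀ n)) (θhat n ω - θ₀ n)
    have h5 := hω2.abs_sqrt_mul_inner_le (hM n) (by linarith) hC₁ hC₃ hC₄ hC3 hC4 hK hn (hQ n)
      hκ8 hκ𝒱 hV_log h2 hω hμ h4.2.2.1
    refine le_trans (le_of_eq ?_) h5
    rw [empMean_scoreFun (fun i => X n i ω), hμ', ← abs_of_nonneg (Real.sqrt_nonneg (n : ℝ)),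
      ← abs_mul, abs_of_nonneg (Real.sqrt_nonneg (n : ℝ))]
    congr 1; ring

end Asymptotics

end OracleEL

end

theorem proposition1
    -- dimensions of the observations and of the parameter, numbers of moments in `ℐ` and `𝒟`
    (d p r₁ r₂ : ℕ → ℕ)
    -- for each sample size `n`: an i.i.d. sample `X₁, …, Xₙ` with law `ν n` on `ℝ^{d n}`
    {Ω : ℕ → Type*} [∀ n, MeasurableSpace (Ω n)]
    (P : ∀ n, Measure (Ω n)) [∀ n, IsProbabilityMeasure (P n)]
    (ν : ∀ n, Measure (EuclideanSpace ℝ (Fin (d n))))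
    (X : ∀ n, Fin n → Ω n → EuclideanSpace ℝ (Fin (d n)))
    [∀ n, IsProbabilityMeasure (ν n)]
    (hlaw : ∀ n i, HasLaw (X n i) (ν n) (P n))
    (hindep : ∀ n, iIndepFun (X n) (P n))
    -- parameter space and true parameter
    (Θ : ∀ n, Set (EuclideanSpace ℝ (Fin (p n))))
    (θ₀ : ∀ n, EuclideanSpace ℝ (Fin (p n)))
    (hconv : ∀ n, Convex ℝ (Θ n))
    (ρ : ℝ) (hρ : 0 < ρ) (hint : ∀ n, Metric.ball (θ₀ n) ρ ⊆ Θ n)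
    -- estimating functions
    (gI : ∀ n, OracleEL.EstFun (Fin (r₁ n)) (d n) (p n))
    (gD : ∀ n, OracleEL.EstFun (Fin (r₂ n)) (d n) (p n))
    (hgI_meas : ∀ n j, ∀ θ ∈ Θ n, Measurable fun x => gI n j x θ)
    (hgD_meas : ∀ n j, ∀ θ ∈ Θ n, Measurable fun x => gD n j x θ)
    (hgI_zero : ∀ n j, ∫ x, gI n j x (θ₀ n) ∂(ν n) = 0)
    -- the valid moments `g^{(ℋ)}`
    (gH : ∀ n, OracleEL.EstFun (OracleEL.OracleIndex (r₁ n) (ν n) (gD n) (θ₀ n)) (d n) (p n))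
    (hgH : ∀ n, gH n = OracleEL.oracleFun (ν n) (gI n) (gD n) (θ₀ n))
    -- universal constants
    (C₁ C₂ C₃ C₄ C₅ γ : ℝ) (hC₁ : 0 < C₁) (hC₂ : 0 < C₂) (hC₃ : 1 < C₃) (hC₄ : 1 < C₄)
    (hγ : 4 < γ)
    -- identification
    (hident : ∀ n, ∀ ε > 0, ∀ θ ∈ Θ n, ε < OracleEL.vecSup (fun k => θ k - θ₀ n k) →
      C₁ * ε ≤ OracleEL.vecSup (OracleEL.popMean (ν n) (gH n) θ))
    -- uniform moments
    (hmom : ∀ n j, ∫⁻ x, ⨆ θ ∈ Θ n, ‖gH n j x θ‖ₑ ^ γ ∂(ν n) ≤ ENNReal.ofReal C₂)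
    -- eigenvalues of the sample second-moment matrix
    (heig : Tendsto (fun n => P n {ω | ∀ θ ∈ Θ n,
        C₃⁻¹ ≤ OracleEL.lamMin (OracleEL.sampleV (fun i => X n i ω) (gH n) θ) ∧
        OracleEL.lamMax (OracleEL.sampleV (fun i => X n i ω) (gH n) θ) ≤ C₃}) atTop (𝓝 1))
    -- smoothness
    (hsmooth : ∀ n j x, ContDiffOn ℝ 2 (gH n j x) (Θ n))
    (hreg : OracleEL.IsBigOpOne P fun n ω => ⨆ θ ∈ Θ n,
      ENNReal.ofReal (OracleEL.regTerm γ (Θ n) (fun i => X n i ω) (gH n) θ))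
    (hgrad : ∀ n j k, ∫⁻ x, ‖OracleEL.pderiv (Θ n) (gH n) j x (θ₀ n) k‖ₑ ^ 2 ∂(ν n)
      ≤ ENNReal.ofReal C₅)
    -- eigenvalues of `Q`
    (hQ : ∀ n, C₄⁻¹ < OracleEL.lamMin (OracleEL.matQ (ν n) (Θ n) (gH n) (θ₀ n)) ∧
      OracleEL.lamMax (OracleEL.matQ (ν n) (Θ n) (gH n) (θ₀ n)) < C₄)
    -- growth of the dimensions, with `h = |ℋ|`
    (h : ℕ → ℕ) (hh : ∀ n, h n = Nat.card (OracleEL.OracleIndex (r₁ n) (ν n) (gD n) (θ₀ n)))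
    (hrate₁ : Tendsto (fun n : ℕ => (h n : ℝ) ^ 3 * (n : ℝ) ^ (-1 + 2 / γ)) atTop (𝓝 0))
    (hrate₂ : Tendsto (fun n : ℕ => (h n : ℝ) ^ 3 * (p n : ℝ) ^ 2 * (n : ℝ)⁻¹) atTop (𝓝 0))
    -- the oracle empirical likelihood estimator
    (𝒱 : Set ℝ) (hV_open : IsOpen 𝒱) (hV_int : 𝒱.OrdConnected) (hV_zero : (0 : ℝ) ∈ 𝒱)
    (hV_log : 𝒱 ⊆ Set.Ioi (-1))
    (θhat : ∀ n, Ω n → EuclideanSpace ℝ (Fin (p n)))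
    (hθhat_meas : ∀ n, AEMeasurable (θhat n) (P n))
    (hθhat : ∀ n, ∀ᵐ ω ∂(P n),
      OracleEL.IsELEstimate 𝒱 (Θ n) (fun i => X n i ω) (gH n) (θhat n ω))
    -- direction
    (α : ∀ n, EuclideanSpace ℝ (Fin (p n))) (hα : ∀ n, ‖α n‖ = 1) :
    TendstoInDistribution
      (fun (n : ℕ) ω => Real.sqrt (n : ℝ) * ((α n).ofLp ⬝ᵥ
        (OracleEL.symPow (OracleEL.matJ (ν n) (Θ n) (gH n) (θ₀ n)) (1 / 2) *ᵥ
          (θhat n ω - θ₀ n).ofLp)))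
      atTop (id : ℝ → ℝ) P (gaussianReal 0 1) := by
  -- A single nonnegative constant serves for both moment bounds; the 0 is needed because C₅ carries
  -- no sign condition.
  have hB : ∀ c ≤ max C₂ (max C₅ 0), ENNReal.ofReal c ≤ ENNReal.ofReal (max C₂ (max C₅ 0)) :=
    fun c hc => ENNReal.ofReal_le_ofReal hc
  have hmeas : ∀ n j, ∀ θ ∈ Θ n, Measurable fun x => gH n j x θ := by
    intro n j θ hθ
    rw [hgH n]
    rcases j with j | j
    · exact hgI_meas n j θ hθ
    · exact hgD_meas n j.1 θ hθ
  have hzero : ∀ n j, ∫ x, gH n j x (θ₀ n) ∂(ν n) = 0 := by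
    intro n j
    rw [hgH n]
    rcases j with j | j
    · exact hgI_zero n j
    · exact j.2.2
  have hcard : ∀ n, h n
      = Fintype.card (OracleEL.OracleIndex (r₁ n) (ν n) (gD n) (θ₀ n)) := fun n => by
    rw [hh n, Nat.card_eq_fintype_card]
  have hM : ∀ n, OracleEL.SmoothModel (Θ n) (θ₀ n) ρ (gH n) := fun n =>
    ⟨hconv n, hρ, hint n, hmeas n, hsmooth n⟩
  have hm : ∀ n, OracleEL.MomentModel (ν n) (Θ n) (θ₀ n) (gH n) γ (max C₂ (max C₅ 0)) C₁ :=
    fun n =>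
    { mean_zero := hzero n
      B_nonneg := (le_max_right _ _).trans (le_max_right _ _)
      C₁_pos := hC₁
      gamma := hγ
      moment := fun j θ hθ => (lintegral_mono fun x =>
        le_iSup₂ (f := fun θ (_ : θ ∈ Θ n) => ‖gH n j x θ‖ₑ ^ γ) θ hθ).trans
          ((hmom n j).trans (hB _ (le_max_left _ _)))
      grad := fun j k => (hgrad n j k).trans (hB _ ((le_max_left _ _).trans (le_max_right _ _)))
      ident := hident n }
  simp only [hcard] at hrate₁ hrate₂
  exact OracleEL.tendstoInDistribution_estimator hlaw hindep hM hm hC₃.le hC₄.le heig hreg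
    (fun n => ⟨(hQ n).1.le, (hQ n).2.le⟩) hrate₁ hrate₂ hV_open hV_zero hV_log hθhat_meas hθhat hα
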